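/- **Theorem 6.1 (Adaptivity of tensor denoising with trend filtering).** Fix $k\in\{1,2,3,4\}$. *Model.* Let $d\ge 1$, $n_1,\dots,n_d\ge k+1$, $n=n_1\cdots n_d$, and let $Y=f^0+\epsilon$ with $f^0\in\mathbb R^{n_1\times\dots\times n_d}$ and $\epsilon$ having i.i.d. $\mathcal N(0,\sigma^2)$ entries, $\sigma>0$. Write $[a:b]=\{a,\dots,b\}$, $[b]=[1:b]$; $\|\cdot\|_2$ is the Frobenius norm and $\|\cdot\|_1$ the sum of the absolute values of the entries. For $t>0$ let $\lambda_0(t)=\sigma\sqrt{(2\log(2n)+2t)/n}$. *Dictionary.* In $\mathbb R^N$ let $\phi^1_j=(1_{\{j'\ge j\}})_{j'\in[N]}$ and, for $k\ge2$, $\phi^k_j=\phi^j_j$ for $j\in[k-1]$ and $\phi^k_j=\frac1N\sum_{l\ge j}\phi^{k-1}_l$ for $j\in[k:N]$. Let $\tilde\phi^k_j$ be, for $j\in[k]$, the component of $\phi^j_j$ orthogonal to $\phi^1_1,\dots,\phi^{j-1}_{j-1}$, rescaled to squared norm $N$, and, for $j>k$, the component of $\phi^k_j$ orthogonal to $\phi^1_1,\dots,\phi^k_k$.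 For tensors, $\tilde\phi^k_{j_1,\dots,j_d}=\tilde\phi^k_{j_1}\times\dots\times\tilde\phi^k_{j_d}$, where the $i$-th factor is taken in $\mathbb R^{n_i}$. *ANOVA decomposition.* For $M\subseteq[d]$ and $h\in[k]^{d-|M|}$ (one entry $h_i$ for each $i\notin M$) let $\mathcal M(M,h)$ be the span of the $\tilde\phi^k_{j_1,\dots,j_d}$ with $j_i\in[k+1:n_i]$ for $i\in M$ and $j_i=h_i$ for $i\notin M$. The orthogonal projection of a tensor $f$ on $\mathcal M(M,h)$ can be written uniquely as $f_{\mathcal M(M,h)}=\bar f_{\mathcal M(M,h)}\times\prod_{i\notin M}\tilde\phi^k_{h_i}$ with an $|M|$-dimensional tensor $\bar f_{\mathcal M(M,h)}$ that has $n_M=\prod_{i\in M}n_i$ entries. *Estimator.* Let $D^k_M=\prod_{i\in M}D^k_i$, where $(D_i^kf)(j)=n_i^{k-1}\sum_{l=0}^k(-1)^l\binom kl f(\dots,j_i-l,\dots)$ for $j_i\in[k+1:n_i]$. For $M\ne\emptyset$ and tuning parameters $\lambda_{M,h}>0$ let $$\hat{\bar f}_{\mathcal M(M,h)}\in\operatorname*{argmin}_{F}\Big\{\|\bar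 Y_{\mathcal M(M,h)}-F\|_2^2/n_M+2\lambda_{M,h}\|D^k_MF\|_1\Big\},$$ where $F$ ranges over all $|M|$-dimensional tensors with side lengths $(n_i)_{i\in M}$, let $\hat{\bar f}_{\mathcal M(\emptyset,h)}=\bar Y_{\mathcal M(\emptyset,h)}$, and set $\hat f=\sum_{M}\sum_{h}\hat{\bar f}_{\mathcal M(M,h)}\times\prod_{i\notin M}\tilde\phi^k_{h_i}$. *Active sets.* For every $M\neq\emptyset$ and $h$ let $S_{M,h}=\{t_1,\dots,t_{s_{M,h}}\}$ be a set of $s_{M,h}$ distinct indices in $\prod_{i\in M}[k+1:n_i]$ and let $R_m=\prod_{i\in M}[t^-_{i,m}:t^+_{i,m}]$, $m\in[s_{M,h}]$, be discrete hyperrectangles such that: each $R_m$ is contained in $\prod_{i\in M}[k+1:n_i]$, and together they cover it; for $m\ne m'$, $R_m$ and $R_{m'}$ may share boundary points, but $R_{m'}$ contains no point that is interior to $R_m$; $\prod_{i\in M}[t_{i,m}:t_{i,m}+k-1]$ lies in the interior of $R_m$. Let $d^-_{i,m}=t_{i,m}-t^-_{i,m}$, $d^+_{i,m}=t^+_{i,m}-t_{i,m}-k+1$,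 $d_m^z=\prod_{i\in M}d_{i,m}^{z_i}$ for $z\in\{-,+\}^{|M|}$, and $d_{i,\max}=d_{i,\max}(S_{M,h})=\max_m\max\{d^-_{i,m},d^+_{i,m}\}$. Assume that $\min\{d^-_{i,m},d^+_{i,m}\}\ge(k+2)k$ for all $i,m$. *Claim.* There is a constant $C_0>0$ depending only on $k$ and a constant $K$ depending only on $k$ and $d$ such that the following holds for all $n_1,\dots,n_d$, $\sigma$, $f^0$, all $x,t>0$, all tensors $g\in\mathbb R^{n_1\times\dots\times n_d}$, and all active sets and hyperrectangles as above. If for all $M\ne\emptyset$ and $h$ $$\lambda_{M,h}\ge C_M\,|M|\sqrt{\sum_{i\in M}\Big(\frac{d_{i,\max}(S_{M,h})}{n_i}\Big)^{2k-1}}\;\lambda_0(t+d\log(k+1))\qquad\text{with } C_M\ge C_0,$$ then, with probability at least $1-e^{-x}-e^{-t}$, $$\begin{aligned}\frac{\|\hat f-f^0\|_2^2}{n}\le{}&\frac{\|g-f^0\|_2^2}{n}+4\sum_{M\ne\emptyset,\,h}\lambda_{M,h}\big\|(D^k_M\bar g_{\mathcal M(M,h)})_{-S_{M,h}}\big\|_1+\frac{2\sigma^2}{n}\Big(\sqrt{x+d\log(k+1)}+\sqrt{k^d}\Big)^2\\&+\sum_{M\ne\emptyset,\,h}\frac{2\sigma^2}{n}\Big(\sqrt{x+d\log(k+1)}+\sqrt{k\,s_{M,h}}\Big)^2\\&+K\sum_{M\ne\emptyset,\,h}\lambda_{M,h}^2\Big(\sum_{i\in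 M}\log(e\,d_{i,\max}(S_{M,h}))\Big)\sum_{m=1}^{s_{M,h}}\sum_{z\in\{-,+\}^{|M|}}\Big(\frac{n_M}{d_m^z}\Big)^{2k-1},\end{aligned}$$ where $(\cdot)_{-S}$ sets the entries with index in $S$ to zero. Moreover, as the distances tend to infinity, the constraint on the constant is $C_M\ge k^{(2k-1)/2}/a_0$ with $a_0=1,\ 8\sqrt2/7,\ 144\sqrt3/76,\ 10.10$ for $k=1,2,3,4$: there is an $r_0$ depending only on $k$ such that, for those $M$ for which all $d^{\pm}_{i,m}(S_{M,h})$ ($i\in M$, $m\in[s_{M,h}]$, $h\in[k]^{d-|M|}$) are at least $r_0$, the condition $C_M\ge C_0$ may be replaced by $C_M\ge k^{(2k-1)/2}/a_0$. -/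

import Mathlib

/-! Tensor denoising with `k`-th order Vitali trend filtering.

All positions are counted from `0`: position `j` here is position `j + 1` in the usual one-based
notation. Tensors with coordinate set `ι` (either `Fin d` or a subset `M` of it) and side lengths
`n i` are real functions on the multi-indices, with the Frobenius (Euclidean) norm. -/

noncomputable section

namespace TensorTF

open MeasureTheory ProbabilityTheory

/-- Multi-indices of a tensor with side lengths `n i`. -/
abbrev Idx {ι : Type} (n : ι → ℕ) : Type := (i : ι) → Fin (n i)

/-- Tensors with side lengths `n i`; the norm is the Frobenius norm. -/
abbrev Tensor {ι : Type} (n : ι → ℕ) : Type := EuclideanSpace ℝ (Idx n)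

/-- Side lengths of the coordinates in `M`. -/
abbrev sides {d : ℕ} (n : Fin d → ℕ) (M : Finset (Fin d)) : M → ℕ := fun i => n i

/-- Number of entries `∏ i, n i` of a tensor. -/
def size {ι : Type} [Fintype ι] (n : ι → ℕ) : ℕ := ∏ i, n i

/-! ### Differences and Vitali total variation -/

/-- The total `k`-th order difference: the product over all coordinates `i` of
`f ↦ (n i)^(k-1) * ∑ l ≤ k, (-1)^l * (k choose l) * f (…, j i - l, …)`, written out as one
multiple sum. It is only used at indices with `k ≤ j i` for all `i` (see `diffIdx`), where the
subtraction of naturals is the true one. -/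
def diffOp {ι : Type} [Fintype ι] [DecidableEq ι] (k : ℕ) {n : ι → ℕ} (f : Tensor n)
    (j : Idx n) : ℝ :=
  (∏ i, (n i : ℝ) ^ (k - 1)) *
    ∑ l : ι → Fin (k + 1), (∏ i, (-1 : ℝ) ^ (l i : ℕ) * (k.choose (l i) : ℝ)) *
      f (fun i => ⟨(j i : ℕ) - (l i : ℕ), lt_of_le_of_lt (Nat.sub_le _ _) (j i).isLt⟩)

/-- The indices of the difference tensor (one-based: the product of the sets `[k+1 : n i]`). -/
def diffIdx {ι : Type} [Fintype ι] [DecidableEq ι] (k : ℕ) (n : ι → ℕ) : Finset (Idx n) :=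
  Finset.univ.filter fun j => ∀ i, k ≤ (j i : ℕ)

/-- The `k`-th order Vitali total variation. -/
def vitaliTV {ι : Type} [Fintype ι] [DecidableEq ι] (k : ℕ) {n : ι → ℕ} (f : Tensor n) : ℝ :=
  ∑ j ∈ diffIdx k n, |diffOp k f j|

/-- The part of the `ℓ¹`-norm of the differences that comes from indices outside `S`. -/
def vitaliTVOff {ι : Type} [Fintype ι] [DecidableEq ι] (k : ℕ) {n : ι → ℕ} (S : Finset (Idx n))
    (f : Tensor n) : ℝ :=
  ∑ j ∈ diffIdx k n \ S, |diffOp k f j|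

/-! ### The dictionary -/

/-- The one-dimensional dictionary of order `k ≥ 1` in `ℝ^N`. Order `1`: indicators of
`{j' ≥ j}`. Order `k + 1`: the first `k` atoms are kept, and for the others
`φ^{k+1}_j = (∑ l ≥ j, φ^k_l) / N`. (Order `0` is not used.) -/
def atom (N : ℕ) : ℕ → ℕ → EuclideanSpace ℝ (Fin N)
  | 0, _ => 0
  | 1, j => WithLp.toLp 2 fun j' => if j ≤ (j' : ℕ) then 1 else 0
  | k + 2, j =>
      if j < k + 1 then atom N (k + 1) j
      else (N : ℝ)⁻¹ • ∑ l ∈ Finset.Ico j N, atom N (k + 1) l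

/-- Among the atoms of order `k`, the atom at (zero-based) position `j < k` is the atom
`φ^{j+1}_{j+1}` of the one-based notation, whatever `k` is. -/
theorem atom_of_lt (N k j : ℕ) (hj : j < k) : atom N k j = atom N (j + 1) j := by
  induction k with
  | zero => omega
  | succ k ih =>
    rcases Nat.lt_succ_iff_lt_or_eq.mp hj with h | h
    · obtain ⟨k, rfl⟩ : ∃ m, k = m + 1 := ⟨k - 1, by omega⟩
      rw [← ih h, atom, if_pos h]
    · rw [h]

/-- Span of the first `r` discrete monomials `φ^l_l`. -/
def polySpan (N r : ℕ) : Submodule ℝ (EuclideanSpace ℝ (Fin N)) :=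
  Submodule.span ℝ {v | ∃ l < r, v = atom N (l + 1) l}

/-- The partially orthonormalized one-dimensional dictionary: the first `k` atoms are
orthogonalized and scaled to squared norm `N`, the others are projected on the orthogonal
complement of the first `k`. -/
def orthoAtom (N k j : ℕ) : EuclideanSpace ℝ (Fin N) :=
  if j < k then
    (√(N : ℝ) / ‖(polySpan N j)ᗮ.starProjection (atom N (j + 1) j)‖) •
      (polySpan N j)ᗮ.starProjection (atom N (j + 1) j)
  else (polySpan N k)ᗮ.starProjection (atom N k j)

/-- The dictionary for tensors: products of one-dimensional atoms. -/
def tensorAtom {ι : Type} [Fintype ι] (k : ℕ) (n : ι → ℕ) (j : ι → ℕ) : Tensor n :=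
  WithLp.toLp 2 fun x => ∏ i, orthoAtom (n i) k (j i) (x i)

/-! ### Margins and the ANOVA decomposition -/

/-- The labels `h ∈ [k]^(d - |M|)`, one entry for each coordinate outside `M`. -/
abbrev Label {d : ℕ} (k : ℕ) (M : Finset (Fin d)) : Type := {i : Fin d // i ∉ M} → Fin k

/-- The marginal space `𝓜(M,h)`, spanned by the atoms whose index is at least `k` (zero-based)
in the coordinates of `M` and equals `h` in the other coordinates. -/
def marginSpace {d : ℕ} (k : ℕ) (n : Fin d → ℕ) (M : Finset (Fin d)) (h : Label k M) :
    Submodule ℝ (Tensor n) :=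
  Submodule.span ℝ {v | ∃ j : Fin d → ℕ, (∀ i ∈ M, k ≤ j i ∧ j i < n i) ∧
    (∀ i : {i // i ∉ M}, j i = (h i : ℕ)) ∧ v = tensorAtom k n j}

/-- The product of a tensor `F` in the coordinates of `M` with the atoms labelled by `h` in the
other coordinates. -/
def lift {d : ℕ} (k : ℕ) {n : Fin d → ℕ} (M : Finset (Fin d)) (h : Label k M)
    (F : Tensor (sides n M)) : Tensor n :=
  WithLp.toLp 2 fun x => F (fun i => x i) *
    ∏ i : {i // i ∉ M}, orthoAtom (n i) k (h i) (x i)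

/-- The multi-index with entries `y` in the coordinates of `M` and `u` in the others. -/
def glue {d : ℕ} {n : Fin d → ℕ} (M : Finset (Fin d)) (y : Idx (sides n M))
    (u : (i : {i : Fin d // i ∉ M}) → Fin (n i)) : Idx n :=
  fun i => if hi : i ∈ M then y ⟨i, hi⟩ else u ⟨i, hi⟩

/-- The margin of `f` in `𝓜(M,h)` as an `|M|`-dimensional tensor: the tensor `F` for which
`lift k M h F` is the orthogonal projection of `f` on `𝓜(M,h)`. As the atoms labelled by `h` have
squared norm `n i`, it is obtained by contracting the projection with them. -/
def bar {d : ℕ} (k : ℕ) {n : Fin d → ℕ} (M : Finset (Fin d)) (h : Label k M)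
    (f : Tensor n) : Tensor (sides n M) :=
  WithLp.toLp 2 fun y =>
    (∑ u : (i : {i : Fin d // i ∉ M}) → Fin (n i),
      (marginSpace k n M h).starProjection f (glue M y u) *
        ∏ i : {i : Fin d // i ∉ M}, orthoAtom (n i) k (h i) (u i)) / ∏ i : {i : Fin d // i ∉ M}, (n i : ℝ)

/-! ### The estimator -/

/-- The `|M|`-dimensional trend filtering objective. -/
def objective {ι : Type} [Fintype ι] [DecidableEq ι] (k : ℕ) {n : ι → ℕ} (lam : ℝ)
    (Y F : Tensor n) : ℝ :=
  ‖Y - F‖ ^ 2 / (size n : ℝ) + 2 * lam * vitaliTV k F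

/-- `fhat` is the sum of the estimators of all margins of `Y`: least squares for `M = ∅`, and a
minimizer of the `|M|`-dimensional trend filtering objective for `M ≠ ∅`. -/
def IsEstimator {d : ℕ} (k : ℕ) {n : Fin d → ℕ}
    (lam : (M : Finset (Fin d)) → Label k M → ℝ) (Y fhat : Tensor n) : Prop :=
  ∃ F : (M : Finset (Fin d)) → Label k M → Tensor (sides n M),
    (∀ h, F ∅ h = bar k ∅ h Y) ∧
    (∀ M, M.Nonempty → ∀ h, ∀ G : Tensor (sides n M),
      objective k (lam M h) (bar k M h Y) (F M h) ≤ objective k (lam M h) (bar k M h Y) G) ∧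
    fhat = ∑ M, ∑ h, lift k M h (F M h)

/-- A minimizer of the trend filtering objective exists, so that estimators exist. -/
theorem exists_isEstimator {d : ℕ} (k : ℕ) {n : Fin d → ℕ} (hn : ∀ i, k + 1 ≤ n i)
    (lam : (M : Finset (Fin d)) → Label k M → ℝ) (hlam : ∀ M, M.Nonempty → ∀ h, 0 < lam M h)
    (Y : Tensor n) : ∃ fhat, IsEstimator k lam Y fhat := by
  have key : ∀ M : Finset (Fin d), ∀ h : Label k M, ∃ F : Tensor (sides n M),
      (M = ∅ → F = bar k M h Y) ∧ (M.Nonempty → ∀ G : Tensor (sides n M),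
        objective k (lam M h) (bar k M h Y) F ≤ objective k (lam M h) (bar k M h Y) G) := by
    intro M h
    rcases M.eq_empty_or_nonempty with hM | hM
    · exact ⟨bar k M h Y, fun _ => rfl, fun h' => absurd hM h'.ne_empty⟩
    · have hs : (0 : ℝ) < (size (sides n M) : ℝ) := by
        unfold size
        exact Nat.cast_pos.mpr (Finset.prod_pos fun i _ => lt_of_lt_of_le (Nat.succ_pos k) (hn i))
      have hc : Continuous fun G : Tensor (sides n M) =>
          objective k (lam M h) (bar k M h Y) G := by
        unfold objective vitaliTV diffOp
        fun_prop
      have ht : Filter.Tendsto (fun G : Tensor (sides n M) =>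
          objective k (lam M h) (bar k M h Y) G)
          (Filter.cocompact _) Filter.atTop := by
        have h1 : Filter.Tendsto (fun G : Tensor (sides n M) => dist G (bar k M h Y))
            (Filter.cocompact _) Filter.atTop := tendsto_dist_right_cocompact_atTop _
        have h2 := ((Filter.tendsto_pow_atTop (two_ne_zero)).comp h1).atTop_div_const hs
        refine Filter.tendsto_atTop_mono (fun G => ?_) h2
        have : 0 ≤ 2 * lam M h * vitaliTV k G :=
          mul_nonneg (by linarith [hlam M hM h]) (Finset.sum_nonneg fun _ _ => abs_nonneg _)
        simp only [Function.comp, objective, dist_eq_norm, norm_sub_rev G]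
        linarith
      obtain ⟨F, hF⟩ := hc.exists_forall_le ht
      exact ⟨F, fun h' => absurd h' hM.ne_empty, fun _ G => hF G⟩
  choose F h1 h2 using key
  exact ⟨_, F, fun h => h1 ∅ h rfl, fun M hM h => h2 M h hM, rfl⟩

/-! ### Hyperrectangular tessellations -/

/-- To every multi-index `t` a hyperrectangle, the product of the intervals `[lo t i : hi t i]`. -/
structure Rects {ι : Type} (n : ι → ℕ) where
  /-- the lower corner -/
  lo : Idx n → Idx n
  /-- the upper corner -/
  hi : Idx n → Idx n

namespace Rects

variable {ι : Type} {n : ι → ℕ}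

/-- `j` lies in the hyperrectangle of `t`. -/
def Mem (R : Rects n) (t j : Idx n) : Prop := ∀ i, R.lo t i ≤ j i ∧ j i ≤ R.hi t i

/-- `j` is an interior point of the hyperrectangle of `t`. -/
def Interior (R : Rects n) (t j : Idx n) : Prop := ∀ i, R.lo t i < j i ∧ j i < R.hi t i

/-- The distance along coordinate `i` from the enlarged jump location `[t i : t i + k - 1]` to the
lower (`z = false`) or upper (`z = true`) end of its hyperrectangle. -/
def dist (k : ℕ) (R : Rects n) (t : Idx n) (i : ι) (z : Bool) : ℕ :=
  if z then (R.hi t i : ℕ) - ((t i : ℕ) + k - 1) else (t i : ℕ) - (R.lo t i : ℕ)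

/-- The maximal distance along coordinate `i`. -/
def dmax (k : ℕ) (R : Rects n) (S : Finset (Idx n)) (i : ι) : ℕ :=
  S.sup fun t => max (R.dist k t i false) (R.dist k t i true)

end Rects

/-- The hyperrectangles `R t`, `t ∈ S`, form a tessellation of the index set of the differences:
they are contained in it and cover it, different ones share no point that is interior to one of
them, and the enlarged jump location `∏ i, [t i : t i + k - 1]` is in the interior of `R t`. -/
structure IsTessellation {ι : Type} (k : ℕ) {n : ι → ℕ} (S : Finset (Idx n)) (R : Rects n) :
    Prop where
  subset : ∀ t ∈ S, ∀ j, R.Mem t j → ∀ i, k ≤ (j i : ℕ)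
  cover : ∀ j : Idx n, (∀ i, k ≤ (j i : ℕ)) → ∃ t ∈ S, R.Mem t j
  disjoint : ∀ t ∈ S, ∀ t' ∈ S, t ≠ t' → ∀ j, R.Interior t j → ¬ R.Mem t' j
  interior : ∀ t ∈ S, ∀ i, (R.lo t i : ℕ) < t i ∧ (t i : ℕ) + k - 1 < R.hi t i

/-- A tessellation suitable for discrete derivative matching: all distances are at least
`(k + 2) k`. -/
structure IsSuitable {ι : Type} (k : ℕ) {n : ι → ℕ} (S : Finset (Idx n)) (R : Rects n) :
    Prop extends IsTessellation k S R where
  dist_ge : ∀ t ∈ S, ∀ i z, (k + 2) * k ≤ R.dist k t i z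

/-! ### Tuning parameter and remainder -/

/-- The universal choice `λ₀(t)` for `N` observations. -/
def lambdaZero (σ : ℝ) (N : ℕ) (t : ℝ) : ℝ := σ * √((2 * Real.log (2 * N) + 2 * t) / N)

/-- `|M| √(∑ i, (d_{i,max} / n i)^(2k-1))`. -/
def scaling {ι : Type} [Fintype ι] (k : ℕ) {n : ι → ℕ} (S : Finset (Idx n)) (R : Rects n) : ℝ :=
  (Fintype.card ι : ℝ) * √(∑ i, ((R.dmax k S i : ℝ) / (n i : ℝ)) ^ (2 * k - 1))

/-- `(∑ i, log (e d_{i,max})) ∑ t ∈ S, ∑ z, (∏ i, n i / d_t^z)^(2k-1)`, where `d_t^z` is the product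
of the distances of `t` along the coordinates, with the signs `z`. -/
def sparsityBound {ι : Type} [Fintype ι] [DecidableEq ι] (k : ℕ) {n : ι → ℕ}
    (S : Finset (Idx n)) (R : Rects n) : ℝ :=
  (∑ i, Real.log (Real.exp 1 * (R.dmax k S i : ℝ))) *
    ∑ t ∈ S, ∑ z : ι → Bool,
      ((size n : ℝ) / ∏ i, (R.dist k t i (z i) : ℝ)) ^ (2 * k - 1)

/-- The constants `a₀` for `k = 1, 2, 3, 4`. -/
def aZero : ℕ → ℝ
  | 1 => 1
  | 2 => 8 * √2 / 7
  | 3 => 144 * √3 / 76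
  | 4 => 10.10
  | _ => 1

/-- The limiting constant `k^((2k-1)/2) / a₀`. -/
def limitConst (k : ℕ) : ℝ := (k : ℝ) ^ ((2 * (k : ℝ) - 1) / 2) / aZero k

/-- The entries of the noise are independent with law `N(0, σ²)`. -/
def IsGaussianNoise {d : ℕ} {n : Fin d → ℕ} {Ω : Type*} [MeasurableSpace Ω] (μ : Measure Ω)
    (σ : ℝ) (ε : Ω → Tensor n) : Prop :=
  iIndepFun (fun j ω => ε ω j) μ ∧
    ∀ j, HasLaw (fun ω => ε ω j) (gaussianReal 0 (Real.toNNReal (σ ^ 2))) μ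

/-- The oracle inequality, with constant `K` in front of the last (order) term. -/
def OracleInequality {d : ℕ} (k : ℕ) {n : Fin d → ℕ} (K σ x : ℝ)
    (S : (M : Finset (Fin d)) → Label k M → Finset (Idx (sides n M)))
    (R : (M : Finset (Fin d)) → Label k M → Rects (sides n M))
    (lam : (M : Finset (Fin d)) → Label k M → ℝ) (f0 g fhat : Tensor n) : Prop :=
  ‖fhat - f0‖ ^ 2 / (size n : ℝ) ≤
    ‖g - f0‖ ^ 2 / (size n : ℝ)
    + 4 * ∑ M with M.Nonempty, ∑ h, lam M h * vitaliTVOff k (S M h) (bar k M h g)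
    + 2 * σ ^ 2 / (size n : ℝ) * (√(x + d * Real.log (k + 1)) + √((k : ℝ) ^ d)) ^ 2
    + ∑ M with M.Nonempty, ∑ h : Label k M,
        2 * σ ^ 2 / (size n : ℝ) *
          (√(x + d * Real.log (k + 1)) + √((k : ℝ) * ((S M h).card : ℝ))) ^ 2
    + K * ∑ M with M.Nonempty, ∑ h, lam M h ^ 2 * sparsityBound k (S M h) (R M h)

end TensorTF

end

noncomputable section

namespace TensorTF

section Noise

open MeasureTheory ProbabilityTheory

/-! ### Gaussian vectors -/

section Gaussian

variable {E : Type*} [NormedAddCommGroup E] [InnerProductSpace ℝ E] [FiniteDimensional ℝ E]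
  [MeasurableSpace E] [BorelSpace E]

/-! The margin spaces are mutually orthogonal and span all tensors, so the squared error is a sum
over margins, and each margin with `M ≠ ∅` is a penalized least squares problem. Strong convexity of
the quadratic loss gives a basic inequality that keeps the squared distance from the estimator to
`g` on the left (`minimizer_basic_inequality`). The noise term has to be paid for by the penalty, by
that squared distance and by the remainder.

The noise is split by projection on `activeSpace`, spanned by the atoms in the windows `[t : t + k -
1]` of the active indices `t` of all margins, together with all margins with `M = ∅`. The projected
part is controlled by a chi-square bound. For the rest, every other atom is close to the active
space: a truncated monomial starting at `j` may be replaced by the same monomial truncated at `t`,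
whose `k`-th differences vanish outside the window of `t`, and the two differ at no more than `gap`
points (`norm_orthoAtom_sub_le`, tensorized in `exists_jumpTensorSpan_approx`). Hence the residual
noise costs at index `j` only a fraction `v j` of the penalty, where `v j` is at most the average
over the coordinates of `(gap / dmax) ^ (k - 1/2)` (`noise_weight_le`).

It then suffices to have an interpolating tensor that equals prescribed signs on the active set, is
at most `1 - v` in absolute value elsewhere, and whose adjoint difference has small norm
(`effective_sparsity_le`). On each hyperrectangle it is an average of products of one-dimensional
profiles. The exponent `k - 1/2` required by `v` is the borderline one: the squared `k`-th
differences of the profile add up to order `log d / d ^ (2k - 1)`. Each product has this exponent in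
one coordinate only and the exponent `k`, which costs no logarithm, in the others; so the logarithms
are added, not multiplied (`exists_interpolation_bound`).

Every active index contributes at least its own variance to the remainder
(`card_le_sq_mul_sparsityBound`). Therefore the dimension of the active space is absorbed by `K`,
and the explicit variance terms are needed only for the deviation `x`. The constraint on the tuning
constants enters only through `1 ≤ C M`, which both alternatives imply. -/

theorem hasLaw_inner_stdGaussian (u : E) :
    HasLaw (fun x : E => inner ℝ u x) (gaussianReal 0 (Real.toNNReal (‖u‖ ^ 2)))
      (stdGaussian E) := by
  refine ⟨by fun_prop, ?_⟩
  have h := ((IsGaussian.hasGaussianLaw_id (μ := stdGaussian E)).map_fun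
    (innerSL ℝ u)).map_eq_gaussianReal
  have e : (fun x : E => innerSL ℝ u (id x)) = fun x : E => inner ℝ u x := by ext; simp
  have e' : (fun x : E => innerSL ℝ u (id x)) = innerSL ℝ u := by ext; simp
  rw [e] at h
  rw [h, ← e, e', variance_dual_stdGaussian, integral_strongDual_stdGaussian, innerSL_apply_norm]

theorem iIndepFun_inner_stdGaussian {ι : Type*} [Fintype ι] {v : ι → E} (hv : Orthonormal ℝ v) :
    iIndepFun (fun i (x : E) => inner ℝ (v i) x) (stdGaussian E) := by
  apply HasGaussianLaw.iIndepFun_of_covariance_eq_zero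
  · exact (IsGaussian.hasGaussianLaw_id (μ := stdGaussian E)).map_fun
      (ContinuousLinearMap.pi fun i => innerSL ℝ (v i))
  · intro i j hij
    rw [← covarianceBilin_apply_eq_cov IsGaussian.memLp_two_id, covarianceBilin_stdGaussian]
    rw [innerSL_apply_apply]
    exact hv.2 hij

theorem integrable_exp_sq_gaussian :
    Integrable (fun z : ℝ => Real.exp (1 / 3 * z ^ 2)) (gaussianReal 0 1) := by
  rw [gaussianReal_of_var_ne_zero _ one_ne_zero, integrable_withDensity_iff (by fun_prop)
    (Filter.Eventually.of_forall fun _ => gaussianPDF_lt_top)]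
  have h := (integrable_exp_neg_mul_sq (b := 1 / 6) (by norm_num)).const_mul
    (√(2 * Real.pi))⁻¹
  refine h.congr (Filter.Eventually.of_forall fun z => ?_)
  simp only [toReal_gaussianPDF, gaussianPDFReal, sub_zero, NNReal.coe_one, mul_one]
  rw [mul_left_comm, ← Real.exp_add]
  ring_nf

/-- The value `(1 - 2 s)^(-1/2)` of the moment generating function of a squared standard normal
variable, at `s = 1/3`. -/
theorem mgf_sq_gaussian : ∫ z, Real.exp (1 / 3 * z ^ 2) ∂(gaussianReal 0 1) = √3 := by
  rw [integral_gaussianReal_eq_integral_smul one_ne_zero]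
  have : ∀ z : ℝ, gaussianPDFReal 0 1 z • Real.exp (1 / 3 * z ^ 2) =
      (√(2 * Real.pi))⁻¹ * Real.exp (-(1 / 6) * z ^ 2) := fun z => by
    simp only [gaussianPDFReal, sub_zero, NNReal.coe_one, mul_one, smul_eq_mul]
    rw [mul_assoc, ← Real.exp_add]
    ring_nf
  simp_rw [this]
  rw [integral_const_mul, integral_gaussian, ← Real.sqrt_inv, ← Real.sqrt_mul (by positivity)]
  congr 1
  field_simp
  norm_num

/-- In an orthonormal basis of `V` the squared norm is a sum of independent squared standard normal
variables, and Chernoff's bound is applied with parameter `1/3`. Since `√3 ≤ exp (2/3)`, the summand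
`2 * finrank` in the threshold pays for all the factors `√3`, and `3 * x` leaves `exp (-x)`. -/
theorem stdGaussian_projection_tail (V : Submodule ℝ E) (x : ℝ) :
    (stdGaussian E).real {y | 3 * x + 2 * (Module.finrank ℝ V : ℝ) ≤ ‖V.starProjection y‖ ^ 2}
      ≤ Real.exp (-x) := by
  set b := stdOrthonormalBasis ℝ V
  set R := Module.finrank ℝ V
  have hv : Orthonormal ℝ (fun i => (b i : E)) :=
    b.orthonormal.comp_linearIsometry V.subtypeₗᵢ
  have hsq : ∀ y : E, ‖V.starProjection y‖ ^ 2 = ∑ i, (inner ℝ (b i : E) y) ^ 2 := by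
    intro y
    rw [Submodule.starProjection_apply, ← Submodule.coe_norm, ← b.sum_sq_norm_inner_right]
    refine Finset.sum_congr rfl fun i _ => ?_
    rw [Real.norm_eq_abs, sq_abs,
      Submodule.inner_orthogonalProjectionOnto_eq_of_mem_left]
  have hind : iIndepFun (fun i (y : E) => (inner ℝ (b i : E) y) ^ 2) (stdGaussian E) :=
    (iIndepFun_inner_stdGaussian hv).comp (fun _ z => z ^ 2) fun _ => by fun_prop
  have hm : ∀ i, Measurable fun y : E => (inner ℝ (b i : E) y) ^ 2 := fun i => by fun_prop
  have hlaw : ∀ i, HasLaw (fun y : E => inner ℝ (b i : E) y) (gaussianReal 0 1)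
      (stdGaussian E) := fun i => by
    have := hasLaw_inner_stdGaussian (b i : E)
    rwa [hv.1 i, one_pow, Real.toNNReal_one] at this
  have hint : ∀ i, Integrable (fun y : E => Real.exp (1 / 3 * (inner ℝ (b i : E) y) ^ 2))
      (stdGaussian E) := fun i => by
    have := integrable_exp_sq_gaussian
    rw [← (hlaw i).map_eq] at this
    exact this.comp_aemeasurable (hlaw i).aemeasurable
  have hmgf : ∀ i, mgf (fun y : E => (inner ℝ (b i : E) y) ^ 2) (stdGaussian E) (1 / 3) = √3 :=
    fun i => by
    rw [mgf, ← mgf_sq_gaussian]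
    exact (hlaw i).integral_comp (f := fun z => Real.exp (1 / 3 * z ^ 2)) (by fun_prop)
  have hI := hind.integrable_exp_mul_sum (t := 1 / 3) hm (s := Finset.univ) fun i _ => hint i
  have hc := measure_ge_le_exp_mul_mgf (3 * x + 2 * (R : ℝ)) (by norm_num : (0 : ℝ) ≤ 1 / 3) hI
  rw [hind.mgf_sum hm, Finset.prod_congr rfl fun i _ => hmgf i] at hc
  simp only [Finset.sum_apply, Finset.prod_const, Finset.card_univ, Fintype.card_fin] at hc
  simp_rw [hsq]
  refine hc.trans ?_
  have h3 : √3 ≤ Real.exp (2 / 3) := by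
    rw [Real.sqrt_le_left (by positivity), ← Real.exp_nat_mul]
    have h4 : (1 + 1 / 3 : ℝ) ≤ Real.exp (1 / 3) := by
      have := Real.add_one_le_exp (1 / 3 : ℝ); linarith
    have h5 : Real.exp ((2 : ℕ) * (2 / 3)) = Real.exp (1 / 3) ^ 4 := by
      rw [← Real.exp_nat_mul]; norm_num
    rw [h5]
    calc (3 : ℝ) ≤ (1 + 1 / 3) ^ 4 := by norm_num
      _ ≤ _ := by gcongr
  calc Real.exp (-(1 / 3) * (3 * x + 2 * R)) * √3 ^ R
      ≤ Real.exp (-(1 / 3) * (3 * x + 2 * R)) * Real.exp (2 / 3) ^ R := by gcongr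
    _ = Real.exp (-x) := by rw [← Real.exp_nat_mul, ← Real.exp_add]; ring_nf

theorem stdGaussian_inner_tail (u : E) {s : ℝ} (hs : 0 ≤ s) :
    (stdGaussian E).real {y | ‖u‖ * s < |inner ℝ u y|} ≤ 2 * Real.exp (-s ^ 2 / 2) := by
  -- For `u = 0` the event is empty because its inequality is strict. This matters later, where the
  -- vector is the residual of an atom that may lie in the active space.
  rcases eq_or_ne u 0 with rfl | hu
  · simp only [norm_zero, zero_mul, inner_zero_left, abs_zero, lt_irrefl, Set.ofPred_false,
      measureReal_empty]
    positivity
  have hsub : ∀ w : E, HasSubgaussianMGF (fun y : E => inner ℝ w y) (Real.toNNReal (‖w‖ ^ 2))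
      (stdGaussian E) := fun w => by
    have hl := hasLaw_inner_stdGaussian w
    refine ⟨fun t => ?_, fun t => ?_⟩
    · have := integrable_exp_mul_gaussianReal (μ := 0) (v := Real.toNNReal (‖w‖ ^ 2)) t
      rw [← hl.map_eq] at this
      exact this.comp_aemeasurable hl.aemeasurable
    · rw [mgf_gaussianReal hl.map_eq, zero_mul, zero_add]
  have hu' : 0 < ‖u‖ := norm_pos_iff.mpr hu
  have key : ∀ w : E, ‖w‖ = ‖u‖ →
      (stdGaussian E).real {y | ‖u‖ * s ≤ inner ℝ w y} ≤ Real.exp (-s ^ 2 / 2) := by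
    intro w hw
    refine ((hsub w).measure_ge_le (by positivity)).trans (le_of_eq ?_)
    rw [Real.coe_toNNReal _ (by positivity), hw]
    congr 1
    field_simp
  calc (stdGaussian E).real {y | ‖u‖ * s < |inner ℝ u y|}
      ≤ (stdGaussian E).real ({y | ‖u‖ * s ≤ inner ℝ u y} ∪ {y | ‖u‖ * s ≤ inner ℝ (-u) y}) := by
        refine measureReal_mono fun y hy => ?_
        rw [Set.mem_ofPred_eq, lt_abs] at hy
        rcases hy with h | h
        · exact Or.inl h.le
        · exact Or.inr (by simpa using h.le)
    _ ≤ _ := measureReal_union_le _ _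
    _ ≤ 2 * Real.exp (-s ^ 2 / 2) := by
        linarith [key u rfl, key (-u) (norm_neg u)]

end Gaussian

/-! ### Simultaneous control of the noise. -/

theorem IsGaussianNoise.hasLaw {d : ℕ} {n : Fin d → ℕ} {Ω : Type*} [MeasurableSpace Ω]
    {μ : Measure Ω} [IsProbabilityMeasure μ] {σ : ℝ} (hσ : 0 < σ) {ε : Ω → Tensor n}
    (hε : IsGaussianNoise μ σ ε) :
    HasLaw (fun ω => σ⁻¹ • ε ω) (stdGaussian (Tensor n)) μ := by
  have h1 : ∀ j, HasLaw (fun ω => σ⁻¹ * ε ω j) (gaussianReal 0 1) μ := fun j => by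
    have := gaussianReal_const_mul (hε.2 j) σ⁻¹
    convert this using 2
    · simp
    · rw [← NNReal.coe_inj]
      simp [Real.coe_toNNReal _ (sq_nonneg σ), hσ.ne']
  have h2 : iIndepFun (fun j ω => σ⁻¹ * ε ω j) μ :=
    hε.1.comp (fun _ z => σ⁻¹ * z) fun _ => by fun_prop
  have h3 := h2.hasLaw_pi h1
  have h4 : HasLaw (fun z : Idx n → ℝ => (WithLp.toLp 2 z : Tensor n)) (stdGaussian (Tensor n))
      (Measure.pi fun _ => gaussianReal 0 1) := ⟨by fun_prop, map_pi_eq_stdGaussian⟩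
  exact h4.fun_comp h3

/-- The noise is controlled simultaneously on a subspace `V` and along finitely many directions. -/
theorem IsGaussianNoise.event {d : ℕ} {n : Fin d → ℕ} {Ω : Type*} [MeasurableSpace Ω]
    {μ : Measure Ω} [IsProbabilityMeasure μ] {σ : ℝ} (hσ : 0 < σ) {ε : Ω → Tensor n}
    (hε : IsGaussianNoise μ σ ε) (V : Submodule ℝ (Tensor n)) {κ : Type*} [Fintype κ]
    (u : κ → Tensor n) {s : ℝ} (hs : 0 ≤ s) (x : ℝ) :
    1 - Real.exp (-x) - Fintype.card κ * (2 * Real.exp (-s ^ 2 / 2)) ≤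
      μ.real {ω | ‖V.starProjection (ε ω)‖ ^ 2 ≤ σ ^ 2 * (3 * x + 2 * (Module.finrank ℝ V : ℝ)) ∧
        ∀ i, |inner ℝ (u i) (ε ω)| ≤ σ * (‖u i‖ * s)} := by
  set A : Set (Tensor n) := {y | 3 * x + 2 * (Module.finrank ℝ V : ℝ) ≤ ‖V.starProjection y‖ ^ 2}
  set B : κ → Set (Tensor n) := fun i => {y | ‖u i‖ * s < |inner ℝ (u i) y|}
  have hA : MeasurableSet A := measurableSet_le (by fun_prop) (by fun_prop)
  have hB : ∀ i, MeasurableSet (B i) := fun i => measurableSet_lt (by fun_prop) (by fun_prop)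
  have hG : MeasurableSet (A ∪ ⋃ i, B i)ᶜ := (hA.union (MeasurableSet.iUnion hB)).compl
  have hle : (stdGaussian (Tensor n)).real (A ∪ ⋃ i, B i) ≤
      Real.exp (-x) + Fintype.card κ * (2 * Real.exp (-s ^ 2 / 2)) := by
    refine (measureReal_union_le _ _).trans (add_le_add (stdGaussian_projection_tail V x) ?_)
    refine (measureReal_iUnion_fintype_le _).trans ?_
    refine (Finset.sum_le_sum fun i _ => stdGaussian_inner_tail (u i) hs).trans ?_
    simp
  have hcompl := probReal_compl_eq_one_sub (μ := stdGaussian (Tensor n))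
    (hA.union (MeasurableSet.iUnion hB))
  have hlaw := (hε.hasLaw hσ).measureReal_eq (p := fun y => y ∈ (A ∪ ⋃ i, B i)ᶜ) hG
  have hsub : {ω | σ⁻¹ • ε ω ∈ (A ∪ ⋃ i, B i)ᶜ} ⊆
      {ω | ‖V.starProjection (ε ω)‖ ^ 2 ≤ σ ^ 2 * (3 * x + 2 * (Module.finrank ℝ V : ℝ)) ∧
        ∀ i, |inner ℝ (u i) (ε ω)| ≤ σ * (‖u i‖ * s)} := by
    intro ω hω
    have hω' : ε ω = σ • (σ⁻¹ • ε ω) := by rw [smul_smul, mul_inv_cancel₀ hσ.ne', one_smul]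
    simp only [Set.compl_union, Set.compl_iUnion, Set.mem_inter_iff, Set.mem_compl_iff,
      Set.mem_iInter, Set.mem_ofPred_eq, A, B, not_le, not_lt] at hω
    constructor
    · rw [hω', map_smul, norm_smul, mul_pow, Real.norm_eq_abs, sq_abs]
      exact mul_le_mul_of_nonneg_left hω.1.le (sq_nonneg σ)
    · intro i
      rw [hω', inner_smul_right, abs_mul, abs_of_pos hσ]
      exact mul_le_mul_of_nonneg_left (hω.2 i) hσ.le
  have := measureReal_mono (μ := μ) hsub
  simp only [Set.ofPred_mem_eq] at hlaw
  rw [hlaw, hcompl] at this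
  linarith

end Noise

/-! ### Discrete polynomials and backward differences -/

/-- The discrete monomial `m ↦ (m + r choose r)` on the integers. -/
def discretePoly (r : ℕ) (m : ℤ) : ℝ := ((Ring.choose (m + r) r : ℤ) : ℝ)

/-- The truncation of `discretePoly r` to the nonnegative integers. -/
def truncPoly (r : ℕ) (m : ℤ) : ℝ := if 0 ≤ m then discretePoly r m else 0

/-- The `k`-th backward difference. -/
def bdiff (k : ℕ) (f : ℤ → ℝ) (y : ℤ) : ℝ :=
  ∑ l ∈ Finset.range (k + 1), (-1 : ℝ) ^ l * (k.choose l : ℝ) * f (y - l)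

/-- Pascal's rule. It allows inductions on the order that first difference the function once. -/
theorem bdiff_succ (k : ℕ) (f : ℤ → ℝ) (y : ℤ) :
    bdiff (k + 1) f y = bdiff k (fun z => f z - f (z - 1)) y := by
  unfold bdiff
  rw [Finset.sum_range_succ']
  simp_rw [mul_sub]
  rw [Finset.sum_sub_distrib, Finset.sum_range_succ' (fun l => (-1 : ℝ) ^ l * _ * f (y - l))]
  have h1 : ∀ l ∈ Finset.range (k + 1), (-1 : ℝ) ^ (l + 1) * ((k + 1).choose (l + 1) : ℝ) *
      f (y - ((l + 1 : ℕ) : ℤ)) = (-1 : ℝ) ^ (l + 1) * (k.choose (l + 1) : ℝ) *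
      f (y - ((l + 1 : ℕ) : ℤ)) - (-1 : ℝ) ^ l * (k.choose l : ℝ) * f (y - l - 1) := by
    intro l _
    rw [Nat.choose_succ_succ]
    have : y - ((l + 1 : ℕ) : ℤ) = y - l - 1 := by push_cast; ring
    rw [this]
    push_cast
    ring
  rw [Finset.sum_congr rfl h1, Finset.sum_sub_distrib, Finset.sum_range_succ
    (fun l => (-1 : ℝ) ^ (l + 1) * (k.choose (l + 1) : ℝ) * f (y - ((l + 1 : ℕ) : ℤ)))]
  simp
  ring

theorem bdiff_sub (k : ℕ) (f g : ℤ → ℝ) (y : ℤ) :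
    bdiff k (fun z => f z - g z) y = bdiff k f y - bdiff k g y := by
  simp only [bdiff, mul_sub, Finset.sum_sub_distrib]

theorem bdiff_congr {k : ℕ} {f g : ℤ → ℝ} {y : ℤ} (h : ∀ z, y - k ≤ z → z ≤ y → f z = g z) :
    bdiff k f y = bdiff k g y := by
  refine Finset.sum_congr rfl fun l hl => ?_
  rw [h _ (by simp at hl; omega) (by omega)]

theorem bdiff_zero_fun (k : ℕ) (y : ℤ) : bdiff k (fun _ => 0) y = 0 := by simp [bdiff]

theorem discretePoly_zero (m : ℤ) : discretePoly 0 m = 1 := by simp [discretePoly]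

theorem discretePoly_sub (r : ℕ) (m : ℤ) :
    discretePoly (r + 1) m - discretePoly (r + 1) (m - 1) = discretePoly r m := by
  have h := Ring.choose_succ_succ (m + r) r
  unfold discretePoly
  have e1 : m + ((r + 1 : ℕ) : ℤ) = m + r + 1 := by push_cast; ring
  have e2 : m - 1 + ((r + 1 : ℕ) : ℤ) = m + r := by push_cast; ring
  rw [e1, e2, h]
  push_cast
  ring

theorem discretePoly_of_nat_add (r a : ℕ) : discretePoly r ((a : ℤ) - r) = (a.choose r : ℝ) := by
  unfold discretePoly
  rw [sub_add_cancel, Ring.choose_natCast]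
  simp

/-- Truncation commutes with differencing: at the only critical point `m = 0` all discrete monomials
have the value `1`. -/
theorem truncPoly_sub (r : ℕ) (m : ℤ) :
    truncPoly (r + 1) m - truncPoly (r + 1) (m - 1) = truncPoly r m := by
  unfold truncPoly
  rcases lt_trichotomy m 0 with h | rfl | h
  · rw [if_neg (by omega), if_neg (by omega), if_neg (by omega), sub_zero]
  · rw [if_pos le_rfl, if_pos le_rfl, if_neg (by omega), sub_zero]
    have h1 := discretePoly_of_nat_add r r
    have h2 := discretePoly_of_nat_add (r + 1) (r + 1)
    rw [sub_self] at h1 h2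
    rw [h1, h2]
    simp
  · rw [if_pos h.le, if_pos h.le, if_pos (by omega), discretePoly_sub]

theorem bdiff_discretePoly {k r : ℕ} (h : r < k) (c y : ℤ) :
    bdiff k (fun z => discretePoly r (z - c)) y = 0 := by
  induction k generalizing r with
  | zero => omega
  | succ k ih =>
    rw [bdiff_succ]
    rcases r with _ | r
    · simp only [discretePoly_zero, sub_self, bdiff_zero_fun]
    · have : ∀ z : ℤ, z - 1 - c = z - c - 1 := fun z => by ring
      simp only [this, discretePoly_sub]
      exact ih (by omega)

theorem bdiff_discretePoly_self (k : ℕ) (c y : ℤ) :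
    bdiff k (fun z => discretePoly k (z - c)) y = 1 := by
  induction k with
  | zero => simp [bdiff, discretePoly_zero]
  | succ k ih =>
    rw [bdiff_succ]
    have : ∀ z : ℤ, z - 1 - c = z - c - 1 := fun z => by ring
    simp only [this, discretePoly_sub]
    exact ih

/-- Truncated monomials are Green's functions of the difference operator. This is the source of the
biorthogonality between the dictionary and the differences. -/
theorem bdiff_truncPoly (r : ℕ) (c y : ℤ) :
    bdiff (r + 1) (fun z => truncPoly r (z - c)) y = if y = c then 1 else 0 := by
  induction r with
  | zero =>
    simp only [bdiff, truncPoly, discretePoly_zero, Finset.sum_range_succ, Finset.sum_range_zero]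
    rcases lt_trichotomy y c with h | h | h
    · simp [show ¬ c ≤ y by omega, show ¬ y = c by omega, show ¬ c ≤ y - 1 by omega]
    · simp [h]
    · simp [show c ≤ y by omega, show ¬ y = c by omega, h]
  | succ r ih =>
    rw [bdiff_succ]
    have : ∀ z : ℤ, z - 1 - c = z - c - 1 := fun z => by ring
    simp only [this, truncPoly_sub]
    exact ih

theorem choose_le_pow_succ (m r : ℕ) : (m + r).choose r ≤ (m + 1) ^ r := by
  induction r with
  | zero => simp
  | succ r ih =>
    have h := Nat.add_one_mul_choose_eq (m + r) r
    have h2 : (m + r + 1) ≤ (m + 1) * (r + 1) := by nlinarith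
    have : (r + 1) * (m + (r + 1)).choose (r + 1) ≤ (r + 1) * (m + 1) ^ (r + 1) := by
      calc (r + 1) * (m + (r + 1)).choose (r + 1) = (m + r + 1) * (m + r).choose r := by
            rw [h, mul_comm, add_assoc]
        _ ≤ ((m + 1) * (r + 1)) * (m + 1) ^ r := Nat.mul_le_mul h2 ih
        _ = _ := by ring
    exact Nat.le_of_mul_le_mul_left this (by omega)

theorem abs_discretePoly_le_of_nonneg (r m : ℕ) : |discretePoly r m| ≤ ((m : ℝ) + 1) ^ r := by
  have h := discretePoly_of_nat_add r (m + r)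
  have e : ((m + r : ℕ) : ℤ) - r = m := by push_cast; ring
  rw [e] at h
  rw [h, abs_of_nonneg (by positivity)]
  exact_mod_cast choose_le_pow_succ m r

/-- Left of the zeros of `discretePoly r`. -/
theorem abs_discretePoly_neg_le (r u : ℕ) :
    |discretePoly r (-(r : ℤ) - (u + 1))| ≤ ((u : ℝ) + 1) ^ r := by
  unfold discretePoly
  have e : -(r : ℤ) - (u + 1) + r = -((u : ℤ) + 1) := by ring
  rw [e, Ring.choose_neg]
  have e2 : (u : ℤ) + 1 + r - 1 = ((u + r : ℕ) : ℤ) := by push_cast; ring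
  rw [e2, Ring.choose_natCast]
  have h3 := choose_le_pow_succ u r
  rcases Nat.even_or_odd r with h | h
  · rw [Int.negOnePow_even _ (by exact_mod_cast h)]
    simpa using by exact_mod_cast h3
  · rw [Int.negOnePow_odd _ (by exact_mod_cast h)]
    simpa using by exact_mod_cast h3

/-- These `r` zeros are the reason for windows of length `k = r + 1`: they make truncation invisible
on the diagonal atoms, and they shorten the distance from an atom to a window on its left. -/
theorem discretePoly_eq_zero {r : ℕ} {m : ℤ} (h1 : -(r : ℤ) ≤ m) (h2 : m < 0) :
    discretePoly r m = 0 := by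
  obtain ⟨a, ha⟩ := Int.eq_ofNat_of_zero_le (show 0 ≤ m + r by omega)
  have : m = (a : ℤ) - r := by omega
  rw [this, discretePoly_of_nat_add, Nat.choose_eq_zero_of_lt (by omega), Nat.cast_zero]

/-! ### The one-dimensional dictionary -/

/-- The averaging step in the dictionary telescopes by `truncPoly_sub`. The condition `r ≤ j`
excludes the atoms inherited from lower orders. -/
theorem atom_apply (N r j : ℕ) (hj : r ≤ j) (x : Fin N) :
    atom N (r + 1) j x = truncPoly r ((x : ℤ) - j) / (N : ℝ) ^ r := by
  induction r generalizing j with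
  | zero =>
    simp only [atom, truncPoly, discretePoly_zero, pow_zero, div_one]
    congr 1
    simp
  | succ r ih =>
    rw [atom, if_neg (by omega)]
    have h1 : ∀ l ∈ Finset.Ico j N, atom N (r + 1) l x =
        (truncPoly (r + 1) ((x : ℤ) - l) - truncPoly (r + 1) ((x : ℤ) - (l + 1 : ℕ))) /
          (N : ℝ) ^ r := by
      intro l hl
      rw [ih l (by simp at hl; omega)]
      have : (x : ℤ) - (l + 1 : ℕ) = (x : ℤ) - l - 1 := by push_cast; ring
      rw [this, truncPoly_sub]
    rw [PiLp.smul_apply, WithLp.ofLp_sum, Finset.sum_apply, Finset.sum_congr rfl h1,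
      ← Finset.sum_div]
    have hx := x.isLt
    rcases le_or_gt j N with hjN | hjN
    · rw [Finset.sum_Ico_eq_sum_range]
      have h2 := Finset.sum_range_sub' (fun i => truncPoly (r + 1) ((x : ℤ) - (j + i : ℕ))) (N - j)
      simp only [add_assoc] at h2 ⊢
      rw [h2, show j + (N - j) = N by omega]
      have h3 : truncPoly (r + 1) ((x : ℤ) - (N : ℕ)) = 0 := if_neg (by omega)
      rw [h3, add_zero, sub_zero, smul_eq_mul, pow_succ]
      field_simp
    · rw [Finset.Ico_eq_empty (by omega), Finset.sum_empty, zero_div, smul_zero]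
      have h3 : truncPoly (r + 1) ((x : ℤ) - j) = 0 := if_neg (by omega)
      rw [h3, zero_div]

/-- The points left of `l` are zeros of the monomial, so truncation changes nothing and the diagonal
atoms are true polynomials on the grid. -/
theorem atom_diag_apply (N l : ℕ) (x : Fin N) :
    atom N (l + 1) l x = discretePoly l ((x : ℤ) - l) / (N : ℝ) ^ l := by
  rw [atom_apply N l l le_rfl, truncPoly]
  split_ifs with h
  · rfl
  · rw [discretePoly_eq_zero (by omega) (by omega)]

/-- The coefficient vector of the `k`-th order difference at position `j`. -/
def diffVec (N k j : ℕ) : EuclideanSpace ℝ (Fin N) :=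
  WithLp.toLp 2 fun x => if (x : ℕ) ≤ j then
    (N : ℝ) ^ (k - 1) * ((-1 : ℝ) ^ (j - x : ℕ) * (k.choose (j - x) : ℝ)) else 0

theorem inner_diffVec {N k j : ℕ} (hk : k ≤ j) (hj : j < N) (v : EuclideanSpace ℝ (Fin N))
    (f : ℤ → ℝ) (hv : ∀ x : Fin N, v x = f x) :
    inner ℝ (diffVec N k j) v = (N : ℝ) ^ (k - 1) * bdiff k f j := by
  rw [PiLp.inner_apply, bdiff, Finset.mul_sum, ← Fin.sum_univ_eq_sum_range
    (fun l => (N : ℝ) ^ (k - 1) * ((-1 : ℝ) ^ l * (k.choose l : ℝ) * f ((j : ℤ) - l)))]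
  symm
  refine Fintype.sum_of_injective
    (fun l : Fin (k + 1) => (⟨j - l, by omega⟩ : Fin N)) ?_ _ _ ?_ ?_
  · intro a b hab
    simp only [Fin.mk.injEq] at hab
    ext
    omega
  · intro x hx
    simp only [Set.mem_range, not_exists, Fin.ext_iff] at hx
    simp only [diffVec]
    split_ifs with h
    · have : k < j - x := by
        by_contra hc
        exact hx ⟨j - x, by omega⟩ (by simp; omega)
      rw [Nat.choose_eq_zero_of_lt this]
      simp
    · simp
  · intro l
    have h1 : j - (j - (l : ℕ)) = l := by omega
    have h2 : ((j - (l : ℕ) : ℕ) : ℤ) = (j : ℤ) - l := by omega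
    simp only [diffVec, hv, RCLike.inner_apply, conj_trivial, h2, h1,
      if_pos (Nat.sub_le j (l : ℕ))]
    ring

theorem inner_diffVec_atom {N k i j : ℕ} (hk : 1 ≤ k) (hi : k ≤ i) (hiN : i < N) (hj : k ≤ j) :
    inner ℝ (diffVec N k i) (atom N k j) = if i = j then (1 : ℝ) else 0 := by
  obtain ⟨r, rfl⟩ : ∃ r, k = r + 1 := ⟨k - 1, by omega⟩
  have hN : (N : ℝ) ≠ 0 := by norm_cast; omega
  have h := inner_diffVec (v := (N : ℝ) ^ r • atom N (r + 1) j) hi hiN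
    (fun z => truncPoly r (z - j)) fun x => by
      rw [PiLp.smul_apply, atom_apply N r j (by omega), smul_eq_mul]
      field_simp
  rw [bdiff_truncPoly, inner_smul_right, Nat.add_sub_cancel] at h
  have h2 := mul_left_cancel₀ (pow_ne_zero r hN) h
  simpa using h2

theorem diffVec_inner_poly {N k i : ℕ} (hi : k ≤ i) (hiN : i < N) {v : EuclideanSpace ℝ (Fin N)}
    (hv : v ∈ polySpan N k) : inner ℝ (diffVec N k i) v = 0 := by
  induction hv using Submodule.span_induction with
  | mem v hv =>
    obtain ⟨l, hl, rfl⟩ := hv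
    -- The function is `discretePoly l (z - l)` divided by `N ^ l`, written as a difference.
    rw [inner_diffVec hi hiN _ (fun z => discretePoly l (z - l) - (1 - ((N : ℝ) ^ l)⁻¹) *
      discretePoly l (z - l)) fun x => by rw [atom_diag_apply]; ring]
    have : ∀ z : ℤ, discretePoly l (z - l) - (1 - ((N : ℝ) ^ l)⁻¹) * discretePoly l (z - l) =
        ((N : ℝ) ^ l)⁻¹ * discretePoly l (z - l) := fun z => by ring
    have h0 := bdiff_discretePoly hl l i
    simp only [bdiff] at h0 ⊢
    simp only [this, mul_left_comm _ (((N : ℝ) ^ l)⁻¹), ← Finset.mul_sum, h0, mul_zero]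
  | zero => exact inner_zero_right _
  | add _ _ _ _ h1 h2 => rw [inner_add_right, h1, h2, add_zero]
  | smul c _ _ h => rw [inner_smul_right, h, mul_zero]

/-- The `h`-th difference annihilates the monomials of lower degree but not the one of degree `h`.
Consequently the normalization in `orthoAtom` does not divide by zero. -/
theorem atom_diag_notMem_polySpan {N h : ℕ} (hN : h < N) : atom N (h + 1) h ∉ polySpan N h := by
  intro hm
  have h1 := diffVec_inner_poly le_rfl hN hm
  have hN0 : (N : ℝ) ≠ 0 := by norm_cast; omega
  have h2 := inner_diffVec (v := (N : ℝ) ^ h • atom N (h + 1) h) (le_refl h) hN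
    (fun z => discretePoly h (z - h)) fun x => by
      rw [PiLp.smul_apply, atom_diag_apply, smul_eq_mul]
      field_simp
  rw [bdiff_discretePoly_self, inner_smul_right, h1, mul_zero, mul_one] at h2
  exact pow_ne_zero _ hN0 h2.symm

theorem polySpan_mono (N : ℕ) {r s : ℕ} (h : r ≤ s) : polySpan N r ≤ polySpan N s :=
  Submodule.span_mono fun _ ⟨l, hl, e⟩ => ⟨l, by omega, e⟩

theorem orthoAtom_low {N k j : ℕ} (hj : j < k) : orthoAtom N k j =
    (√(N : ℝ) / ‖(polySpan N j)ᗮ.starProjection (atom N (j + 1) j)‖) •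
      (polySpan N j)ᗮ.starProjection (atom N (j + 1) j) := if_pos hj

theorem orthoAtom_high {N k j : ℕ} (hj : k ≤ j) :
    orthoAtom N k j = (polySpan N k)ᗮ.starProjection (atom N k j) := if_neg (by omega)

theorem orthoAtom_low_mem {N k j : ℕ} (hj : j < k) : orthoAtom N k j ∈ polySpan N k := by
  rw [orthoAtom_low hj, Submodule.starProjection_orthogonal']
  refine Submodule.smul_mem _ _ (Submodule.sub_mem _ ?_ ?_)
  · exact Submodule.subset_span ⟨j, hj, rfl⟩
  · exact polySpan_mono N hj.le (Submodule.starProjection_apply_mem _ _)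

theorem orthoAtom_low_mem_orthogonal {N k j : ℕ} (hj : j < k) :
    orthoAtom N k j ∈ (polySpan N j)ᗮ := by
  rw [orthoAtom_low hj]
  exact Submodule.smul_mem _ _ (Submodule.starProjection_apply_mem _ _)

theorem orthoAtom_high_mem {N k j : ℕ} (hj : k ≤ j) : orthoAtom N k j ∈ (polySpan N k)ᗮ := by
  rw [orthoAtom_high hj]
  exact Submodule.starProjection_apply_mem _ _

theorem norm_orthoAtom_low {N k j : ℕ} (hj : j < k) (hN : j < N) :
    ‖orthoAtom N k j‖ ^ 2 = N := by
  rw [orthoAtom_low hj, norm_smul, norm_div, norm_norm, div_mul_cancel₀, Real.norm_eq_abs, sq_abs,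
    Real.sq_sqrt (by positivity)]
  rw [norm_ne_zero_iff]
  intro h0
  rw [Submodule.starProjection_orthogonal', sub_apply, sub_eq_zero] at h0
  have h0 := Submodule.starProjection_eq_self_iff.mp h0.symm
  exact atom_diag_notMem_polySpan hN h0

theorem inner_orthoAtom_low {N k i j : ℕ} (hi : i < k) (hj : j < k) (hN : i < N) :
    inner ℝ (orthoAtom N k i) (orthoAtom N k j) = if i = j then (N : ℝ) else 0 := by
  have key : ∀ {a b : ℕ}, a < b → b < k → inner ℝ (orthoAtom N k a) (orthoAtom N k b) = (0 : ℝ) := by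
    intro a b hab hb
    have h1 : orthoAtom N k a ∈ polySpan N b := by
      rw [orthoAtom_low (hab.trans hb), ← orthoAtom_low hab]
      exact orthoAtom_low_mem hab
    exact Submodule.inner_right_of_mem_orthogonal h1 (orthoAtom_low_mem_orthogonal hb)
  rcases lt_trichotomy i j with h | rfl | h
  · rw [if_neg h.ne, key h hj]
  · rw [if_pos rfl, real_inner_self_eq_norm_sq, norm_orthoAtom_low hi hN]
  · rw [if_neg h.ne', real_inner_comm, key h hi]

theorem inner_orthoAtom_low_high {N k i j : ℕ} (hi : i < k) (hj : k ≤ j) :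
    inner ℝ (orthoAtom N k i) (orthoAtom N k j) = (0 : ℝ) :=
  Submodule.inner_right_of_mem_orthogonal (orthoAtom_low_mem hi) (orthoAtom_high_mem hj)

theorem inner_diffVec_orthoAtom {N k i j : ℕ} (hk : 1 ≤ k) (hi : k ≤ i) (hiN : i < N)
    (hj : k ≤ j) : inner ℝ (diffVec N k i) (orthoAtom N k j) = if i = j then (1 : ℝ) else 0 := by
  rw [orthoAtom_high hj, Submodule.starProjection_orthogonal', sub_apply,
    inner_sub_right, diffVec_inner_poly hi hiN (Submodule.starProjection_apply_mem _ _), sub_zero]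
  exact inner_diffVec_atom hk hi hiN hj

theorem norm_orthoAtom_le {N k j : ℕ} (hk : 1 ≤ k) (hj : j < N) :
    ‖orthoAtom N k j‖ ^ 2 ≤ N := by
  rcases lt_or_ge j k with h | h
  · exact (norm_orthoAtom_low h hj).le
  obtain ⟨r, rfl⟩ : ∃ r, k = r + 1 := ⟨k - 1, by omega⟩
  have hN : (0 : ℝ) < N := by norm_cast; omega
  have h1 : ‖orthoAtom N (r + 1) j‖ ≤ ‖atom N (r + 1) j‖ := by
    rw [orthoAtom_high h]
    exact Submodule.norm_starProjection_apply_le _ _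
  refine (pow_le_pow_left₀ (norm_nonneg _) h1 2).trans ?_
  rw [EuclideanSpace.norm_sq_eq]
  refine (Finset.sum_le_card_nsmul _ _ 1 fun x _ => ?_).trans (by simp)
  rw [atom_apply N r j (by omega), Real.norm_eq_abs, sq_abs]
  refine (sq_le_one_iff_abs_le_one _).mpr ?_
  rw [abs_div, abs_of_pos (pow_pos hN r), div_le_one (pow_pos hN r), truncPoly]
  split_ifs with hx
  · obtain ⟨m, hm⟩ := Int.eq_ofNat_of_zero_le hx
    rw [hm]
    refine (abs_discretePoly_le_of_nonneg r m).trans ?_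
    have : m + 1 ≤ N := by have := x.isLt; omega
    gcongr
    exact_mod_cast this
  · simp

/-! ### Biorthogonal systems -/

/-- Pairing with `a` reads off coefficients, which makes `b` independent; by the count of dimensions
it is a basis. -/
theorem eq_sum_of_biorthogonal {I E : Type*} [Fintype I] [DecidableEq I] [NormedAddCommGroup E]
    [InnerProductSpace ℝ E] [FiniteDimensional ℝ E] {a b : I → E}
    (h : ∀ i j, inner ℝ (a i) (b j) = if i = j then (1 : ℝ) else 0)
    (hc : Fintype.card I = Module.finrank ℝ E) (v : E) :
    v = ∑ i, (inner ℝ (a i) v : ℝ) • b i := by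
  have hcoef : ∀ (c : I → ℝ) (i : I), inner ℝ (a i) (∑ j, c j • b j) = c i := by
    intro c i
    rw [inner_sum, Finset.sum_congr rfl fun j _ => by rw [inner_smul_right, h i j]]
    simp
  have hli : LinearIndependent ℝ b := by
    rw [Fintype.linearIndependent_iff]
    intro c hc i
    rw [← hcoef c i, hc, inner_zero_right]
  have hsp := hli.span_eq_top_of_card_eq_finrank' hc
  have hv : v ∈ Submodule.span ℝ (Set.range b) := by rw [hsp]; trivial
  obtain ⟨c, hc⟩ := (Submodule.mem_span_range_iff_exists_fun ℝ).mp hv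
  rw [← hc]
  exact Finset.sum_congr rfl fun i _ => by rw [hcoef]

/-- The system biorthogonal to the partially orthonormalized dictionary. -/
def dualVec (N k j : ℕ) : EuclideanSpace ℝ (Fin N) :=
  if j < k then (N : ℝ)⁻¹ • orthoAtom N k j else diffVec N k j

theorem inner_dualVec_orthoAtom {N k : ℕ} (hk : 1 ≤ k) (i j : ℕ) (hi : i < N) :
    inner ℝ (dualVec N k i) (orthoAtom N k j) = if i = j then (1 : ℝ) else 0 := by
  have hN : (N : ℝ) ≠ 0 := by norm_cast; omega
  unfold dualVec
  split_ifs with h1 h2 h2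
  · rw [inner_smul_left, inner_orthoAtom_low h1 (h2 ▸ h1) hi, if_pos h2]
    simp [hN]
  · rw [inner_smul_left]
    rcases lt_or_ge j k with hj | hj
    · rw [inner_orthoAtom_low h1 hj hi, if_neg h2, mul_zero]
    · rw [inner_orthoAtom_low_high h1 hj, mul_zero]
  · rw [inner_diffVec_orthoAtom hk (by omega) hi (by omega), if_pos h2]
  · rcases lt_or_ge j k with hj | hj
    · exact diffVec_inner_poly (by omega) hi (orthoAtom_low_mem hj)
    · rw [inner_diffVec_orthoAtom hk (by omega) hi hj, if_neg h2]

/-- Modulo discrete polynomials a vector is determined by its `k`-th differences, which are its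
coefficients in the projected atoms. -/
theorem starProjection_poly_orthogonal {N k : ℕ} (hk : 1 ≤ k) (v : EuclideanSpace ℝ (Fin N)) :
    (polySpan N k)ᗮ.starProjection v =
      ∑ j : Fin N, if k ≤ (j : ℕ) then (inner ℝ (diffVec N k j) v : ℝ) • orthoAtom N k j else 0 := by
  have h := eq_sum_of_biorthogonal (a := fun i : Fin N => dualVec N k i)
    (b := fun i : Fin N => orthoAtom N k i)
    (fun i j => by simp only [inner_dualVec_orthoAtom hk _ _ i.isLt, Fin.ext_iff]) (by simp) v
  conv_lhs => rw [h, map_sum]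
  refine Finset.sum_congr rfl fun j _ => ?_
  rw [map_smul]
  split_ifs with hj
  · rw [Submodule.starProjection_eq_self_iff.mpr (orthoAtom_high_mem hj), dualVec,
      if_neg (by omega)]
  · rw [Submodule.starProjection_orthogonal', sub_apply,
      Submodule.starProjection_eq_self_iff.mpr (orthoAtom_low_mem (by omega))]
    simp

/-! ### Distance of an atom to the atoms of an enlarged jump location -/

/-- Distance of `j` to `[t : t + k - 1]`. -/
def gap (k t j : ℕ) : ℕ := if j < t then t - j else j - (t + k - 1)

/-- Span of the atoms of the enlarged jump location `[t : t + k - 1]`. -/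
def jumpSpan (N k t : ℕ) : Submodule ℝ (EuclideanSpace ℝ (Fin N)) :=
  Submodule.span ℝ (Set.range fun l : Fin k => orthoAtom N k (t + l))

/-- From the truncated monomial starting at `j` subtract the same monomial truncated at `t`. The
`k`-th differences of the latter vanish outside the window of `t`, so modulo polynomials it lies in
`jumpSpan`. The difference `ρ` of the two lives on at most `gap` points and is at most `(gap / N) ^
(k - 1)` there. -/
theorem norm_orthoAtom_sub_le {N k t j : ℕ} (hk : 1 ≤ k) (ht : k ≤ t) (hj : k ≤ j) (hjN : j < N) :
    ‖orthoAtom N k j - (jumpSpan N k t).starProjection (orthoAtom N k j)‖ ^ 2 ≤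
      N * ((gap k t j : ℝ) / N) ^ (2 * k - 1) := by
  have hN : (0 : ℝ) < N := by norm_cast; omega
  by_cases hin : t ≤ j ∧ j < t + k
  · have hm : orthoAtom N k j ∈ jumpSpan N k t :=
      Submodule.subset_span ⟨⟨j - t, by omega⟩, by simp [show t + (j - t) = j by omega]⟩
    rw [Submodule.starProjection_eq_self_iff.mpr hm, sub_self, norm_zero, zero_pow two_ne_zero]
    positivity
  obtain ⟨r, rfl⟩ : ∃ r, k = r + 1 := ⟨k - 1, by omega⟩
  set f : ℤ → ℝ := fun z => truncPoly r (z - j) -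
    if (t : ℤ) ≤ z then discretePoly r (z - j) else 0 with hf
  set ρ : EuclideanSpace ℝ (Fin N) := WithLp.toLp 2 fun x => f x / (N : ℝ) ^ r with hρ
  have hD : ∀ i : ℕ, r + 1 ≤ i → i < N → ¬ (t ≤ i ∧ i < t + (r + 1)) →
      inner ℝ (diffVec N (r + 1) i) ρ = if i = j then (1 : ℝ) else 0 := by
    intro i hi hiN hit
    have h := inner_diffVec (v := (N : ℝ) ^ r • ρ) hi hiN f fun x => by
      simp only [hρ, PiLp.smul_apply, smul_eq_mul]
      field_simp
    rw [hf, bdiff_sub, bdiff_truncPoly, inner_smul_right, Nat.add_sub_cancel] at h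
    have h0 : bdiff (r + 1) (fun z : ℤ => if (t : ℤ) ≤ z then discretePoly r (z - j) else 0) i
        = 0 := by
      rcases lt_or_ge i t with h1 | h1
      · rw [bdiff_congr (g := fun _ => 0) fun z _ h => if_neg (by omega), bdiff_zero_fun]
      · rw [bdiff_congr (g := fun z => discretePoly r (z - j))
          fun z h _ => if_pos (by push_cast at h; omega), bdiff_discretePoly (by omega)]
    rw [h0, sub_zero] at h
    simpa using mul_left_cancel₀ (pow_ne_zero r hN.ne') h
  -- By `hD` the coefficients of the atom and of `ρ` agree outside the window, so only atoms of the
  -- window survive.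
  have hB : orthoAtom N (r + 1) j - (polySpan N (r + 1))ᗮ.starProjection ρ ∈
      jumpSpan N (r + 1) t := by
    rw [starProjection_poly_orthogonal hk]
    have hsplit : orthoAtom N (r + 1) j =
        ∑ i : Fin N, if (i : ℕ) = j then orthoAtom N (r + 1) i else 0 := by
      rw [Finset.sum_eq_single (⟨j, hjN⟩ : Fin N)]
      · simp
      · intro b _ hb
        rw [if_neg fun h => hb (Fin.ext h)]
      · simp
    rw [hsplit, ← Finset.sum_sub_distrib]
    refine Submodule.sum_mem _ fun i _ => ?_
    by_cases hit : t ≤ (i : ℕ) ∧ (i : ℕ) < t + (r + 1)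
    · have hm : orthoAtom N (r + 1) i ∈ jumpSpan N (r + 1) t :=
        Submodule.subset_span ⟨⟨i - t, by omega⟩, by simp [show t + ((i : ℕ) - t) = i by omega]⟩
      refine Submodule.sub_mem _ ?_ ?_ <;> split_ifs
      · exact hm
      · exact Submodule.zero_mem _
      · exact Submodule.smul_mem _ _ hm
      · exact Submodule.zero_mem _
    · by_cases hi : r + 1 ≤ (i : ℕ)
      · rw [if_pos hi, hD i hi i.isLt hit]
        split_ifs <;> simp
      · rw [if_neg hi, if_neg (by omega), sub_zero]
        exact Submodule.zero_mem _
  have hle : ‖orthoAtom N (r + 1) j -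
      (jumpSpan N (r + 1) t).starProjection (orthoAtom N (r + 1) j)‖ ≤ ‖ρ‖ := by
    rw [Submodule.starProjection_minimal]
    refine (ciInf_le ⟨0, ?_⟩ ⟨_, hB⟩).trans ?_
    · rintro _ ⟨x, rfl⟩
      exact norm_nonneg _
    · simp only [sub_sub_cancel]
      exact Submodule.norm_starProjection_apply_le _ _
  refine (pow_le_pow_left₀ (norm_nonneg _) hle 2).trans ?_
  set δ := gap (r + 1) t j with hδ
  -- `A` contains the support of `f`. If `j` lies to the right of the window, the zeros of the
  -- monomial at `j - r, …, j - 1` stop the support before `j - r`, and `j - r - t` is exactly the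
  -- gap.
  set A : Finset (Fin N) := if j < t then Finset.univ.filter (fun x : Fin N => j ≤ x ∧ (x : ℕ) < t)
    else Finset.univ.filter (fun x : Fin N => t ≤ (x : ℕ) ∧ (x : ℕ) < j - r) with hA
  have hcard : A.card ≤ δ := by
    rw [hA, hδ, gap]
    split_ifs with h
    · refine (Finset.card_le_card_of_injOn (fun x : Fin N => (x : ℕ)) (t := Finset.Ico j t) ?_
        Fin.val_injective.injOn).trans (by simp)
      intro x hx
      simpa using hx
    · refine (Finset.card_le_card_of_injOn (fun x : Fin N => (x : ℕ)) (t := Finset.Ico t (j - r)) ?_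
        Fin.val_injective.injOn).trans (by simp; omega)
      intro x hx
      simpa using hx
  have hz : ∀ x : Fin N, x ∉ A → f x = 0 := by
    intro x hx
    simp only [hf, truncPoly]
    rcases lt_or_ge j t with h | h
    · rw [hA, if_pos h] at hx
      simp only [Finset.mem_filter, Finset.mem_univ, true_and, not_and, not_lt] at hx
      by_cases h1 : (0 : ℤ) ≤ (x : ℤ) - j
      · rw [if_pos h1, if_pos (by have := hx (by omega); omega), sub_self]
      · rw [if_neg h1, if_neg (by omega), sub_self]
    · rw [hA, if_neg (by omega)] at hx
      simp only [Finset.mem_filter, Finset.mem_univ, true_and, not_and, not_lt] at hx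
      by_cases h1 : (t : ℤ) ≤ x
      · have h2 := hx (by omega)
        rw [if_pos h1]
        split_ifs with h3
        · rw [sub_self]
        · rw [discretePoly_eq_zero (by omega) (by omega), sub_self]
      · rw [if_neg h1, if_neg (by omega), sub_self]
  have hb : ∀ x ∈ A, |f x| ≤ (δ : ℝ) ^ r := by
    intro x hx
    simp only [hf, truncPoly]
    rcases lt_or_ge j t with h | h
    · rw [hA, if_pos h] at hx
      simp only [Finset.mem_filter, Finset.mem_univ, true_and] at hx
      rw [if_pos (by omega), if_neg (by omega), sub_zero]
      have e : (x : ℤ) - j = ((x - j : ℕ) : ℤ) := by omega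
      rw [e]
      refine (abs_discretePoly_le_of_nonneg r _).trans ?_
      have : (x : ℕ) - j + 1 ≤ δ := by rw [hδ, gap, if_pos h]; omega
      gcongr
      exact_mod_cast this
    · rw [hA, if_neg (by omega)] at hx
      simp only [Finset.mem_filter, Finset.mem_univ, true_and] at hx
      rw [if_neg (by omega), if_pos (by omega), zero_sub, abs_neg]
      have e : (x : ℤ) - j = -(r : ℤ) - (((j - r - 1 - x : ℕ) : ℤ) + 1) := by omega
      rw [e]
      refine (abs_discretePoly_neg_le r _).trans ?_
      have : j - r - 1 - (x : ℕ) + 1 ≤ δ := by rw [hδ, gap, if_neg (by omega)]; omega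
      gcongr
      exact_mod_cast this
  calc ‖ρ‖ ^ 2 = ∑ x : Fin N, (f x / (N : ℝ) ^ r) ^ 2 := by
        rw [EuclideanSpace.norm_sq_eq]
        exact Finset.sum_congr rfl fun x _ => by simp [hρ, div_pow]
    _ = ∑ x ∈ A, (f x / (N : ℝ) ^ r) ^ 2 := by
        symm
        refine Finset.sum_subset (Finset.subset_univ _) fun x _ hx => ?_
        rw [hz x hx, zero_div, zero_pow two_ne_zero]
    _ ≤ A.card • ((δ : ℝ) ^ r / (N : ℝ) ^ r) ^ 2 := by
        refine Finset.sum_le_card_nsmul _ _ _ fun x hx => ?_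
        rw [← sq_abs, abs_div, abs_of_pos (pow_pos hN r)]
        gcongr
        exact hb x hx
    _ ≤ (δ : ℝ) * ((δ : ℝ) ^ r / (N : ℝ) ^ r) ^ 2 := by
        rw [nsmul_eq_mul]
        gcongr
    _ = N * ((δ : ℝ) / N) ^ (2 * (r + 1) - 1) := by
        have e : ∀ a : ℝ, a ^ (2 * (r + 1) - 1) = (a ^ r) ^ 2 * a := fun a => by
          rw [show 2 * (r + 1) - 1 = 2 * r + 1 by omega, pow_succ, pow_mul']
        rw [div_pow, div_pow, e, e, mul_div_mul_comm]
        field_simp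

/-! ### Rank-one tensors -/

section Tensors

variable {ι : Type} [Fintype ι]

/-- The outer product of vectors. -/
def rankOne {n : ι → ℕ} (a : (i : ι) → EuclideanSpace ℝ (Fin (n i))) : Tensor n :=
  WithLp.toLp 2 fun x => ∏ i, a i (x i)

theorem sum_prod_idx [DecidableEq ι] {n : ι → ℕ} (f : (i : ι) → Fin (n i) → ℝ) :
    ∑ x : Idx n, ∏ i, f i (x i) = ∏ i, ∑ y, f i y := by
  rw [Finset.prod_univ_sum, Fintype.piFinset_univ]

theorem inner_rankOne [DecidableEq ι] {n : ι → ℕ} (a b : (i : ι) → EuclideanSpace ℝ (Fin (n i))) :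
    inner ℝ (rankOne a) (rankOne b) = ∏ i, (inner ℝ (a i) (b i) : ℝ) := by
  simp only [PiLp.inner_apply, rankOne, RCLike.inner_apply, conj_trivial, ← Finset.prod_mul_distrib]
  exact sum_prod_idx fun i y => b i y * a i y

theorem norm_sq_rankOne [DecidableEq ι] {n : ι → ℕ} (a : (i : ι) → EuclideanSpace ℝ (Fin (n i))) :
    ‖rankOne a‖ ^ 2 = ∏ i, ‖a i‖ ^ 2 := by
  simp only [← real_inner_self_eq_norm_sq, inner_rankOne]

theorem tensorAtom_eq_rankOne (k : ℕ) (n : ι → ℕ) (j : ι → ℕ) :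
    tensorAtom k n j = rankOne fun i => orthoAtom (n i) k (j i) := rfl

theorem mem_diffIdx [DecidableEq ι] {k : ℕ} {n : ι → ℕ} {j : Idx n} :
    j ∈ diffIdx k n ↔ ∀ i, k ≤ (j i : ℕ) := by simp [diffIdx]

theorem diffOp_eq_inner [DecidableEq ι] {k : ℕ} {n : ι → ℕ} (f : Tensor n) {j : Idx n}
    (hj : ∀ i, k ≤ (j i : ℕ)) :
    diffOp k f j = inner ℝ (rankOne fun i => diffVec (n i) k (j i)) f := by
  rw [PiLp.inner_apply, diffOp, Finset.mul_sum]
  refine Fintype.sum_of_injective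
    (fun (l : ι → Fin (k + 1)) i => (⟨(j i : ℕ) - (l i : ℕ), by omega⟩ : Fin (n i))) ?_ _ _ ?_ ?_
  · intro a b hab
    ext i
    have := congrFun hab i
    simp only [Fin.mk.injEq] at this
    have := hj i
    omega
  · intro x hx
    simp only [Set.mem_range, not_exists] at hx
    suffices h : ∃ i, diffVec (n i) k (j i) (x i) = 0 by
      obtain ⟨i, hi⟩ := h
      simp only [rankOne, RCLike.inner_apply, conj_trivial]
      rw [Finset.prod_eq_zero (Finset.mem_univ i) hi, mul_zero]
    by_contra hc
    push Not at hc
    have h1 : ∀ i, (x i : ℕ) ≤ j i ∧ (j i : ℕ) - x i ≤ k := by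
      intro i
      have := hc i
      simp only [diffVec] at this
      split_ifs at this with h
      · refine ⟨h, ?_⟩
        by_contra h2
        exact this (by rw [Nat.choose_eq_zero_of_lt (by omega)]; simp)
      · exact absurd rfl this
    refine hx (fun i => ⟨(j i : ℕ) - x i, by have := (h1 i).2; omega⟩) ?_
    ext i
    have := (h1 i).1
    simp only
    omega
  · intro l
    have h2 : ∀ i, diffVec (n i) k (j i) ⟨(j i : ℕ) - (l i : ℕ), by omega⟩ =
        (n i : ℝ) ^ (k - 1) * ((-1 : ℝ) ^ (l i : ℕ) * (k.choose (l i) : ℝ)) := by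
      intro i
      have h1 : (j i : ℕ) - ((j i : ℕ) - (l i : ℕ)) = l i := by have := hj i; omega
      simp only [diffVec, h1, if_pos (Nat.sub_le (j i : ℕ) (l i : ℕ))]
    simp only [rankOne, RCLike.inner_apply, conj_trivial, h2, Finset.prod_mul_distrib]
    ring

theorem tensor_expansion [DecidableEq ι] {k : ℕ} (hk : 1 ≤ k) {n : ι → ℕ} (v : Tensor n) :
    v = ∑ j : Idx n, (inner ℝ (rankOne fun i => dualVec (n i) k (j i)) v : ℝ) •
      tensorAtom k n fun i => j i := by
  refine eq_sum_of_biorthogonal (a := fun j : Idx n => rankOne fun i => dualVec (n i) k (j i))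
    (b := fun j : Idx n => tensorAtom k n fun i => j i) (fun i j => ?_) (by simp) v
  simp only [tensorAtom_eq_rankOne, inner_rankOne, inner_dualVec_orthoAtom hk _ _ (i _).isLt]
  rw [Finset.prod_ite_zero]
  simp [funext_iff, Fin.ext_iff]

/-- Span of the atoms that are seen by the differences in all coordinates. -/
def coreSpace [DecidableEq ι] (k : ℕ) (n : ι → ℕ) : Submodule ℝ (Tensor n) :=
  Submodule.span ℝ {v | ∃ j ∈ diffIdx k n, v = tensorAtom k n fun i => j i}

theorem diffOp_tensorAtom [DecidableEq ι] {k : ℕ} (hk : 1 ≤ k) {n : ι → ℕ} {i : Idx n}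
    (hi : i ∈ diffIdx k n) (j : Idx n) :
    diffOp k (tensorAtom k n fun a => j a) i = if i = j then 1 else 0 := by
  rw [mem_diffIdx] at hi
  rw [diffOp_eq_inner _ hi, tensorAtom_eq_rankOne, inner_rankOne]
  have h : ∀ a, inner ℝ (diffVec (n a) k (i a)) (orthoAtom (n a) k (j a)) =
      if (i a : ℕ) = j a then (1 : ℝ) else 0 := fun a => by
    rw [← inner_dualVec_orthoAtom hk _ _ (i a).isLt, dualVec, if_neg (by have := hi a; omega)]
  simp only [h]
  rw [Finset.prod_ite_zero]
  simp [funext_iff, Fin.ext_iff]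

theorem diffOp_add [DecidableEq ι] {k : ℕ} {n : ι → ℕ} (f g : Tensor n) {j : Idx n}
    (hj : j ∈ diffIdx k n) : diffOp k (f + g) j = diffOp k f j + diffOp k g j := by
  rw [mem_diffIdx] at hj
  simp only [diffOp_eq_inner _ hj, inner_add_right]

theorem diffOp_sub [DecidableEq ι] {k : ℕ} {n : ι → ℕ} (f g : Tensor n) {j : Idx n}
    (hj : j ∈ diffIdx k n) : diffOp k (f - g) j = diffOp k f j - diffOp k g j := by
  rw [mem_diffIdx] at hj
  simp only [diffOp_eq_inner _ hj, inner_sub_right]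

theorem diffOp_smul [DecidableEq ι] {k : ℕ} {n : ι → ℕ} (c : ℝ) (f : Tensor n) {j : Idx n}
    (hj : j ∈ diffIdx k n) : diffOp k (c • f) j = c * diffOp k f j := by
  rw [mem_diffIdx] at hj
  simp only [diffOp_eq_inner _ hj, inner_smul_right]

theorem expansion_of_mem_coreSpace [DecidableEq ι] {k : ℕ} (hk : 1 ≤ k) {n : ι → ℕ}
    {F : Tensor n} (hF : F ∈ coreSpace k n) :
    F = ∑ j ∈ diffIdx k n, diffOp k F j • tensorAtom k n fun i => j i := by
  induction hF using Submodule.span_induction with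
  | mem v hv =>
    obtain ⟨i, hi, rfl⟩ := hv
    rw [Finset.sum_congr rfl fun j hj => by rw [diffOp_tensorAtom hk hj]]
    simp [hi]
  | zero =>
    symm
    refine Finset.sum_eq_zero fun j hj => ?_
    rw [diffOp_eq_inner _ (mem_diffIdx.mp hj), inner_zero_right, zero_smul]
  | add f g _ _ h1 h2 =>
    rw [Finset.sum_congr rfl fun j hj => by rw [diffOp_add f g hj, add_smul],
      Finset.sum_add_distrib, ← h1, ← h2]
  | smul c f _ h =>
    rw [Finset.sum_congr rfl fun j hj => by rw [diffOp_smul c f hj, mul_smul],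
      ← Finset.smul_sum, ← h]

theorem inner_tensorAtom_eq_zero [DecidableEq ι] {k : ℕ} {n : ι → ℕ} {i j : ι → ℕ} {a : ι}
    (h : (i a < k ∧ k ≤ j a) ∨ (k ≤ i a ∧ j a < k) ∨
      (i a < k ∧ j a < k ∧ i a ≠ j a ∧ i a < n a)) :
    inner ℝ (tensorAtom k n i) (tensorAtom k n j) = (0 : ℝ) := by
  rw [tensorAtom_eq_rankOne, tensorAtom_eq_rankOne, inner_rankOne]
  refine Finset.prod_eq_zero (Finset.mem_univ a) ?_
  rcases h with ⟨h1, h2⟩ | ⟨h1, h2⟩ | ⟨h1, h2, h3, h4⟩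
  · exact inner_orthoAtom_low_high h1 h2
  · rw [real_inner_comm, inner_orthoAtom_low_high h2 h1]
  · rw [inner_orthoAtom_low h1 h2 h4, if_neg h3]

/-- Split the expansion of `F` into atoms with all indices high (`G`) and the others (`H`). As `H`
is orthogonal to the core space, so is `G`; hence `G = 0`. The differences annihilate `H`. -/
theorem diffOp_of_mem_orthogonal [DecidableEq ι] {k : ℕ} (hk : 1 ≤ k) {n : ι → ℕ} {F : Tensor n}
    (hF : F ∈ (coreSpace k n)ᗮ) {j : Idx n} (hj : j ∈ diffIdx k n) : diffOp k F j = 0 := by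
  have hexp := tensor_expansion hk F
  rw [← Finset.sum_filter_add_sum_filter_not _ (fun j : Idx n => j ∈ diffIdx k n)] at hexp
  set G := ∑ j with j ∈ diffIdx k n, (inner ℝ (rankOne fun i => dualVec (n i) k (j i)) F : ℝ) •
      tensorAtom k n fun i => j i
  set H := ∑ j with j ∉ diffIdx k n, (inner ℝ (rankOne fun i => dualVec (n i) k (j i)) F : ℝ) •
      tensorAtom k n fun i => j i
  have hG : G ∈ coreSpace k n := by
    refine Submodule.sum_mem _ fun i hi => Submodule.smul_mem _ _ (Submodule.subset_span ?_)
    exact ⟨i, by simpa using hi, rfl⟩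
  have hH : H ∈ (coreSpace k n)ᗮ := by
    refine Submodule.sum_mem _ fun i hi => Submodule.smul_mem _ _ ?_
    rw [coreSpace, Submodule.mem_orthogonal]
    intro u hu
    induction hu using Submodule.span_induction with
    | mem v hv =>
      obtain ⟨l, hl, rfl⟩ := hv
      simp only [Finset.mem_filter, Finset.mem_univ, true_and, mem_diffIdx, not_forall,
        not_le] at hi
      obtain ⟨a, ha⟩ := hi
      exact inner_tensorAtom_eq_zero (a := a) (Or.inr (Or.inl ⟨mem_diffIdx.mp hl a, ha⟩))
    | zero => exact inner_zero_left _
    | add _ _ _ _ h1 h2 => rw [inner_add_left, h1, h2, add_zero]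
    | smul c _ _ h => rw [inner_smul_left, h, mul_zero]
  have hG' : G ∈ (coreSpace k n)ᗮ := by
    have : G = F - H := by rw [hexp]; abel
    rw [this]
    exact Submodule.sub_mem _ hF hH
  have hG0 : G = 0 := by
    have := Submodule.inner_right_of_mem_orthogonal hG hG'
    simpa using this
  have hFH : F = H := hexp.trans (by rw [hG0, zero_add])
  rw [hFH]
  have : diffOp k H j = ∑ i with i ∉ diffIdx k n,
      (inner ℝ (rankOne fun a => dualVec (n a) k (i a)) F : ℝ) *
        diffOp k (tensorAtom k n fun a => i a) j := by
    simp only [diffOp_eq_inner _ (mem_diffIdx.mp hj), H, inner_sum, inner_smul_right]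
  rw [this]
  refine Finset.sum_eq_zero fun i hi => ?_
  rw [diffOp_tensorAtom hk hj, if_neg, mul_zero]
  rintro rfl
  simp only [Finset.mem_filter] at hi
  exact hi.2 hj

theorem diffOp_starProjection [DecidableEq ι] {k : ℕ} (hk : 1 ≤ k) {n : ι → ℕ} (F : Tensor n)
    {j : Idx n} (hj : j ∈ diffIdx k n) :
    diffOp k ((coreSpace k n).starProjection F) j = diffOp k F j := by
  have h := diffOp_of_mem_orthogonal hk (F := (coreSpace k n)ᗮ.starProjection F)
    (Submodule.starProjection_apply_mem _ _) hj
  rw [Submodule.starProjection_orthogonal', sub_apply, diffOp_sub _ _ hj] at h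
  exact (sub_eq_zero.mp h).symm

theorem vitaliTV_congr [DecidableEq ι] {k : ℕ} {n : ι → ℕ} {F G : Tensor n}
    (h : ∀ j ∈ diffIdx k n, diffOp k F j = diffOp k G j) : vitaliTV k F = vitaliTV k G :=
  Finset.sum_congr rfl fun j hj => by rw [h j hj]

/-- Projecting on the core space leaves the penalty unchanged and, for `Y` in that space, improves
the fit strictly unless `F` is already there. Thus the estimator stays in its margin and is
determined by its differences. -/
theorem minimizer_mem_coreSpace [DecidableEq ι] {k : ℕ} (hk : 1 ≤ k) {n : ι → ℕ}
    (hn : 0 < size n) {lam : ℝ} {Y F : Tensor n} (hY : Y ∈ coreSpace k n)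
    (hF : ∀ G, objective k lam Y F ≤ objective k lam Y G) : F ∈ coreSpace k n := by
  set P := (coreSpace k n).starProjection
  have h := hF (P F)
  have hs : (0 : ℝ) < size n := by exact_mod_cast hn
  rw [objective, objective, vitaliTV_congr fun j hj => diffOp_starProjection hk F hj,
    add_le_add_iff_right, div_le_div_iff_of_pos_right hs] at h
  have hp : ‖Y - F‖ ^ 2 = ‖Y - P F‖ ^ 2 + ‖F - P F‖ ^ 2 := by
    have h0 : inner ℝ (Y - P F) (F - P F) = (0 : ℝ) :=
      Submodule.inner_right_of_mem_orthogonal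
        (Submodule.sub_mem _ hY (Submodule.starProjection_apply_mem _ _))
        (Submodule.sub_starProjection_mem_orthogonal F)
    have e : Y - F = (Y - P F) - (F - P F) := by abel
    rw [e, norm_sub_sq_real, h0]
    ring
  have h1 : ‖F - P F‖ ^ 2 ≤ 0 := by linarith
  have h2 : F - P F = 0 := by
    rw [← norm_eq_zero]
    exact pow_eq_zero_iff two_ne_zero |>.mp (le_antisymm h1 (sq_nonneg _))
  rw [sub_eq_zero.mp h2]
  exact Submodule.starProjection_apply_mem _ _

end Tensors

/-! ### Margins -/

section Margins

variable {d k : ℕ} {n : Fin d → ℕ}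

/-- The number of entries in the coordinates outside `M`. -/
def outSize (n : Fin d → ℕ) (M : Finset (Fin d)) : ℝ := ∏ i : {i : Fin d // i ∉ M}, (n i : ℝ)

theorem outSize_pos (hn : ∀ i, k + 1 ≤ n i) (M : Finset (Fin d)) : 0 < outSize n M :=
  Finset.prod_pos fun i _ => by have := hn i; norm_cast; omega

theorem prod_mul_prod_compl (M : Finset (Fin d)) (f : Fin d → ℝ) :
    (∏ i : M, f i) * ∏ i : {i : Fin d // i ∉ M}, f i = ∏ i, f i := by
  rw [← Fintype.prod_subtype_mul_prod_subtype (fun i => i ∈ M) f]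
  congr!

theorem outSize_mul_size (n : Fin d → ℕ) (M : Finset (Fin d)) :
    outSize n M * (size (sides n M) : ℝ) = size n := by
  unfold outSize size
  rw [mul_comm]
  push_cast
  exact prod_mul_prod_compl M fun i => (n i : ℝ)

theorem sum_glue (M : Finset (Fin d)) (f : Idx n → ℝ) :
    ∑ x, f x = ∑ y : Idx (sides n M), ∑ u : (i : {i : Fin d // i ∉ M}) → Fin (n i),
      f (glue M y u) := by
  rw [← Fintype.sum_prod_type']
  refine (Fintype.sum_equiv (Equiv.piEquivPiSubtypeProd (fun i => i ∈ M) fun i => Fin (n i)).symm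
    _ _ fun p => ?_).symm
  rfl

theorem glue_inside (M : Finset (Fin d)) (y : Idx (sides n M))
    (u : (i : {i : Fin d // i ∉ M}) → Fin (n i)) : (fun i : M => glue M y u i) = y := by
  funext i
  simp [glue, i.2]

theorem glue_outside (M : Finset (Fin d)) (y : Idx (sides n M))
    (u : (i : {i : Fin d // i ∉ M}) → Fin (n i)) (i : {i : Fin d // i ∉ M}) :
    glue M y u i = u i := by
  simp [glue, i.2]

theorem lift_glue (M : Finset (Fin d)) (h : Label k M) (F : Tensor (sides n M))
    (y : Idx (sides n M)) (u : (i : {i : Fin d // i ∉ M}) → Fin (n i)) :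
    lift k M h F (glue M y u) = F y * ∏ i : {i // i ∉ M}, orthoAtom (n i) k (h i) (u i) := by
  simp only [lift, glue_outside]
  rw [glue_inside]

theorem lift_add (M : Finset (Fin d)) (h : Label k M) (F G : Tensor (sides n M)) :
    lift k M h (F + G) = lift k M h F + lift k M h G := by
  ext x
  simp [lift, add_mul]

theorem lift_smul (M : Finset (Fin d)) (h : Label k M) (c : ℝ) (F : Tensor (sides n M)) :
    lift k M h (c • F) = c • lift k M h F := by
  ext x
  simp [lift, mul_assoc]

/-- `lift` as a linear map. -/
def liftLin (M : Finset (Fin d)) (h : Label k M) : Tensor (sides n M) →ₗ[ℝ] Tensor n where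
  toFun := lift k M h
  map_add' := lift_add M h
  map_smul' := lift_smul M h

theorem lift_sub (M : Finset (Fin d)) (h : Label k M) (F G : Tensor (sides n M)) :
    lift k M h (F - G) = lift k M h F - lift k M h G := (liftLin M h).map_sub F G

theorem prod_orthoAtom_sq (hn : ∀ i, k + 1 ≤ n i) (M : Finset (Fin d)) (h : Label k M) :
    ∑ u : (i : {i : Fin d // i ∉ M}) → Fin (n i),
      (∏ i : {i // i ∉ M}, orthoAtom (n i) k (h i) (u i)) ^ 2 = outSize n M := by
  simp only [← Finset.prod_pow]
  rw [sum_prod_idx (n := fun i : {i : Fin d // i ∉ M} => n i)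
    fun i y => orthoAtom (n i) k (h i) y ^ 2]
  refine Finset.prod_congr rfl fun i _ => ?_
  rw [← norm_orthoAtom_low (N := n i) (h i).isLt (by have := hn i; have := (h i).isLt; omega),
    EuclideanSpace.norm_sq_eq]
  simp

theorem inner_lift (hn : ∀ i, k + 1 ≤ n i) (M : Finset (Fin d)) (h : Label k M)
    (F G : Tensor (sides n M)) :
    inner ℝ (lift k M h F) (lift k M h G) = outSize n M * (inner ℝ F G : ℝ) := by
  rw [PiLp.inner_apply, PiLp.inner_apply, sum_glue M, Finset.mul_sum]
  refine Finset.sum_congr rfl fun y _ => ?_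
  simp only [lift_glue, RCLike.inner_apply, conj_trivial]
  rw [← prod_orthoAtom_sq hn M h, Finset.sum_mul]
  exact Finset.sum_congr rfl fun u _ => by ring

theorem norm_sq_lift (hn : ∀ i, k + 1 ≤ n i) (M : Finset (Fin d)) (h : Label k M)
    (F : Tensor (sides n M)) : ‖lift k M h F‖ ^ 2 = outSize n M * ‖F‖ ^ 2 := by
  rw [← real_inner_self_eq_norm_sq, inner_lift hn, real_inner_self_eq_norm_sq]

/-- Extension of a multi-index by a label. -/
def extendIdx (M : Finset (Fin d)) (h : Label k M) (j : M → ℕ) : Fin d → ℕ :=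
  fun i => if hi : i ∈ M then j ⟨i, hi⟩ else h ⟨i, hi⟩

theorem rankOne_extend (M : Finset (Fin d)) (a : (i : Fin d) → EuclideanSpace ℝ (Fin (n i)))
    (h : Label k M) (ha : ∀ i : {i // i ∉ M}, a i = orthoAtom (n i) k (h i)) :
    rankOne a = lift k M h (rankOne fun i : M => a i) := by
  ext x
  simp only [rankOne, lift]
  rw [← prod_mul_prod_compl M]
  congr 1
  exact Finset.prod_congr rfl fun i _ => by rw [ha i]

theorem lift_tensorAtom (M : Finset (Fin d)) (h : Label k M) (j : M → ℕ) :
    lift k M h (tensorAtom k (sides n M) j) = tensorAtom k n (extendIdx M h j) := by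
  rw [tensorAtom_eq_rankOne, tensorAtom_eq_rankOne, rankOne_extend M _ h]
  · congr 2
    funext i
    simp [extendIdx, i.2]
  · intro i
    simp [extendIdx, i.2]

theorem marginSpace_eq_map (M : Finset (Fin d)) (h : Label k M) :
    marginSpace k n M h = (coreSpace k (sides n M)).map (liftLin M h) := by
  rw [coreSpace, Submodule.map_span, marginSpace]
  congr 1
  ext v
  constructor
  · rintro ⟨j, h1, h2, rfl⟩
    refine ⟨_, ⟨fun i : M => ⟨j i, (h1 i i.2).2⟩, mem_diffIdx.mpr fun i => (h1 i i.2).1, rfl⟩, ?_⟩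
    refine (lift_tensorAtom M h _).trans ?_
    congr 1
    funext i
    simp only [extendIdx]
    split_ifs with hi
    · rfl
    · exact (h2 ⟨i, hi⟩).symm
  · rintro ⟨_, ⟨j, hj, rfl⟩, rfl⟩
    refine ⟨extendIdx M h fun i => j i, fun i hi => ?_, fun i => ?_, lift_tensorAtom M h _⟩
    · simp only [extendIdx, dif_pos hi]
      exact ⟨mem_diffIdx.mp hj ⟨i, hi⟩, (j ⟨i, hi⟩).isLt⟩
    · simp [extendIdx, i.2]

theorem bar_of_lift (hn : ∀ i, k + 1 ≤ n i) (M : Finset (Fin d)) (h : Label k M) {f : Tensor n}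
    {F : Tensor (sides n M)} (hF : lift k M h F = (marginSpace k n M h).starProjection f) :
    bar k M h f = F := by
  ext y
  simp only [bar, ← hF, lift_glue]
  change _ / outSize n M = _
  rw [div_eq_iff (outSize_pos hn M).ne']
  rw [← prod_orthoAtom_sq hn M h, Finset.mul_sum]
  exact Finset.sum_congr rfl fun u _ => by ring

theorem bar_spec (hn : ∀ i, k + 1 ≤ n i) (M : Finset (Fin d)) (h : Label k M) (f : Tensor n) :
    bar k M h f ∈ coreSpace k (sides n M) ∧
      lift k M h (bar k M h f) = (marginSpace k n M h).starProjection f := by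
  obtain ⟨F, hF, e⟩ := (marginSpace_eq_map M h).le
    (Submodule.starProjection_apply_mem (marginSpace k n M h) f)
  have := bar_of_lift hn M h e
  rw [this]
  exact ⟨hF, e⟩

theorem bar_mem (hn : ∀ i, k + 1 ≤ n i) (M : Finset (Fin d)) (h : Label k M) (f : Tensor n) :
    bar k M h f ∈ coreSpace k (sides n M) := (bar_spec hn M h f).1

theorem lift_mem {M : Finset (Fin d)} {h : Label k M} {F : Tensor (sides n M)}
    (hF : F ∈ coreSpace k (sides n M)) : lift k M h F ∈ marginSpace k n M h := by
  rw [marginSpace_eq_map]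
  exact Submodule.mem_map_of_mem hF

theorem bar_add (hn : ∀ i, k + 1 ≤ n i) (M : Finset (Fin d)) (h : Label k M) (f g : Tensor n) :
    bar k M h (f + g) = bar k M h f + bar k M h g := by
  apply bar_of_lift hn
  rw [lift_add, (bar_spec hn M h f).2, (bar_spec hn M h g).2, map_add]

/-- On the core space, `lift` is the adjoint of `bar` up to the factor `outSize n M`. -/
theorem inner_bar (hn : ∀ i, k + 1 ≤ n i) {M : Finset (Fin d)} {h : Label k M}
    {F : Tensor (sides n M)} (hF : F ∈ coreSpace k (sides n M)) (f : Tensor n) :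
    outSize n M * (inner ℝ (bar k M h f) F : ℝ) = inner ℝ f (lift k M h F) := by
  rw [← inner_lift hn M h, (bar_spec hn M h f).2, Submodule.inner_starProjection_left_eq_right,
    Submodule.starProjection_eq_self_iff.mpr]
  exact lift_mem hF

/-- The labels of all margins. -/
abbrev Margin (d k : ℕ) : Type := Σ M : Finset (Fin d), Label k M

/-- Atoms of different margins have a coordinate in which one index is high and the other low, or
both are low and distinct; there the one-dimensional factors are orthogonal. -/
theorem orthogonalFamily_marginSpace (hn : ∀ i, k + 1 ≤ n i) :
    OrthogonalFamily ℝ (fun p : Margin d k => marginSpace k n p.1 p.2)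
      fun p => (marginSpace k n p.1 p.2).subtypeₗᵢ := by
  refine OrthogonalFamily.of_pairwise fun p q hpq => ?_
  obtain ⟨M, h⟩ := p
  obtain ⟨M', h'⟩ := q
  refine Submodule.isOrtho_span.mpr ?_
  rintro _ ⟨i, hi, hi', rfl⟩ _ ⟨j, hj, hj', rfl⟩
  by_cases hM : M = M'
  · subst hM
    have hh : h ≠ h' := fun e => hpq (by rw [e])
    obtain ⟨a, ha⟩ := Function.ne_iff.mp hh
    have h1 : i a = h a := hi' a
    have h2 : j a = h' a := hj' a
    have h3 := (h a).isLt
    have h4 := (h' a).isLt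
    have h5 := hn a
    have h6 : (h a : ℕ) ≠ h' a := fun e => ha (Fin.ext e)
    exact inner_tensorAtom_eq_zero (a := a) (by omega)
  · have : ∃ a, (a ∈ M ∧ a ∉ M') ∨ (a ∉ M ∧ a ∈ M') := by
      by_contra hc
      push Not at hc
      exact hM (Finset.ext fun a => ⟨(hc a).1, fun h => by_contra fun h' => (hc a).2 h' h⟩)
    obtain ⟨a, ⟨h1, h2⟩ | ⟨h1, h2⟩⟩ := this
    · have h3 := (hi a h1).1
      have h4 : j a = h' ⟨a, h2⟩ := hj' ⟨a, h2⟩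
      have h5 := (h' ⟨a, h2⟩).isLt
      exact inner_tensorAtom_eq_zero (a := a) (by omega)
    · have h3 := (hj a h2).1
      have h4 : i a = h ⟨a, h1⟩ := hi' ⟨a, h1⟩
      have h5 := (h ⟨a, h1⟩).isLt
      exact inner_tensorAtom_eq_zero (a := a) (by omega)

theorem iSup_marginSpace (hk : 1 ≤ k) :
    ⨆ p : Margin d k, marginSpace k n p.1 p.2 = ⊤ := by
  rw [eq_top_iff]
  intro v _
  rw [tensor_expansion hk v]
  refine Submodule.sum_mem _ fun j _ => Submodule.smul_mem _ _ ?_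
  -- The margin of a multi-index: `M` collects its high coordinates and the label records the low
  -- ones.
  refine Submodule.mem_iSup_of_mem (⟨Finset.univ.filter fun i => k ≤ (j i : ℕ),
    fun i => ⟨j i, by have := i.2; simp at this; omega⟩⟩ : Margin d k) ?_
  exact Submodule.subset_span ⟨fun i => j i, fun i hi => ⟨by simpa using hi, (j i).isLt⟩,
    fun i => rfl, rfl⟩

theorem sum_lift_bar (hk : 1 ≤ k) (hn : ∀ i, k + 1 ≤ n i) (f : Tensor n) :
    ∑ p : Margin d k, lift k p.1 p.2 (bar k p.1 p.2 f) = f := by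
  have h := (orthogonalFamily_marginSpace (k := k) hn).sum_projection_of_mem_iSup f
    (by rw [iSup_marginSpace hk]; trivial)
  conv_rhs => rw [← h]
  exact Finset.sum_congr rfl fun p _ => (bar_spec hn p.1 p.2 f).2

theorem norm_sq_sum_lift (hn : ∀ i, k + 1 ≤ n i)
    (F : (p : Margin d k) → Tensor (sides n p.1)) (hF : ∀ p, F p ∈ coreSpace k (sides n p.1)) :
    ‖∑ p : Margin d k, lift k p.1 p.2 (F p)‖ ^ 2 = ∑ p : Margin d k, outSize n p.1 * ‖F p‖ ^ 2 := by
  have h := (orthogonalFamily_marginSpace (n := n) (k := k) hn).norm_sum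
    (fun p => ⟨lift k p.1 p.2 (F p), lift_mem (hF p)⟩) Finset.univ
  simp only [Submodule.coe_subtypeₗᵢ, Submodule.coe_subtype, Submodule.coe_norm] at h
  rw [h]
  exact Finset.sum_congr rfl fun p _ => norm_sq_lift hn p.1 p.2 (F p)

end Margins

/-! ### Backward differences of powers -/

theorem abs_bdiff_le {k : ℕ} {f : ℤ → ℝ} {y : ℤ} {B : ℝ}
    (h : ∀ z, y - k ≤ z → z ≤ y → |f z| ≤ B) : |bdiff k f y| ≤ 2 ^ k * B := by
  have hs : ∑ l ∈ Finset.range (k + 1), (k.choose l : ℝ) = 2 ^ k := by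
    exact_mod_cast Nat.sum_range_choose k
  rw [← hs, Finset.sum_mul]
  refine (Finset.abs_sum_le_sum_abs _ _).trans (Finset.sum_le_sum fun l hl => ?_)
  rw [abs_mul, abs_mul, abs_pow, abs_neg, abs_one, one_pow, one_mul, Nat.abs_cast]
  gcongr
  exact h _ (by simp at hl; omega) (by omega)

theorem bdiff_finset_sum {α : Type*} (s : Finset α) (k : ℕ) (f : α → ℤ → ℝ) (y : ℤ) :
    bdiff k (fun z => ∑ a ∈ s, f a z) y = ∑ a ∈ s, bdiff k (f a) y := by
  simp only [bdiff, Finset.mul_sum]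
  rw [Finset.sum_comm]

theorem bdiff_const_mul (k : ℕ) (c : ℝ) (f : ℤ → ℝ) (y : ℤ) :
    bdiff k (fun z => c * f z) y = c * bdiff k f y := by
  simp only [bdiff, Finset.mul_sum]
  exact Finset.sum_congr rfl fun l _ => by ring

theorem bdiff_const {k : ℕ} (hk : 1 ≤ k) (c : ℝ) (y : ℤ) : bdiff k (fun _ => c) y = 0 := by
  obtain ⟨k, rfl⟩ : ∃ r, k = r + 1 := ⟨k - 1, by omega⟩
  rw [bdiff_succ]
  simp only [sub_self, bdiff_zero_fun]

/-- The adjoint of a backward difference is a forward difference, which up to sign is a backward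
difference shifted by `k`. -/
theorem bdiff_reverse (k : ℕ) (f : ℤ → ℝ) (u : ℤ) :
    ∑ l ∈ Finset.range (k + 1), (-1 : ℝ) ^ l * (k.choose l : ℝ) * f (u + l) =
      (-1) ^ k * bdiff k f (u + k) := by
  rw [bdiff, Finset.mul_sum, ← Finset.sum_range_reflect]
  refine Finset.sum_congr rfl fun l hl => ?_
  have hl' : l ≤ k := by simpa [Nat.lt_succ_iff] using hl
  have e1 : k + 1 - 1 - l = k - l := by omega
  have e2 : u + k - l = u + ((k - l : ℕ) : ℤ) := by omega
  have e3 : (-1 : ℝ) ^ (k - l) = (-1) ^ k * (-1) ^ l := by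
    have : (-1 : ℝ) ^ k = (-1) ^ (k - l) * (-1) ^ l := by rw [← pow_add]; congr 1; omega
    rw [this, mul_assoc, ← mul_pow]
    simp
  rw [e1, e2, Nat.choose_symm hl', e3]
  ring

/-- Mean value bound for iterated differences; `F i` is the `i`-th derivative of `F 0`. -/
theorem abs_bdiff_le_of_hasDerivAt (k : ℕ) (F : ℕ → ℝ → ℝ) (y : ℤ) {B : ℝ}
    (hF : ∀ i < k, ∀ x ∈ Set.Icc ((y : ℝ) - k) y, HasDerivAt (F i) (F (i + 1) x) x)
    (hB : ∀ x ∈ Set.Icc ((y : ℝ) - k) y, |F k x| ≤ B) :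
    |bdiff k (fun z => F 0 z) y| ≤ B := by
  induction k generalizing F with
  | zero => simpa [bdiff] using hB y (by simp)
  | succ k ih =>
    rw [bdiff_succ]
    have h := ih (fun i x => F i x - F i (x - 1)) ?_ ?_
    · simpa using h
    · intro i hi x hx
      have h1 := hF i (by omega) x ⟨by push_cast; linarith [hx.1], hx.2⟩
      have h2 := hF i (by omega) (x - 1) ⟨by push_cast; linarith [hx.1], by linarith [hx.2]⟩
      exact h1.sub (h2.comp_sub_const x 1)
    · intro x hx
      have hsub : ∀ ξ ∈ Set.Icc (x - 1) x, ξ ∈ Set.Icc ((y : ℝ) - (k + 1 : ℕ)) y := fun ξ hξ =>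
        ⟨by push_cast; linarith [hx.1, hξ.1], by linarith [hx.2, hξ.2]⟩
      have h1 := (convex_Icc (x - 1) x).norm_image_sub_le_of_norm_hasDerivWithin_le
        (f := F k) (f' := F (k + 1)) (C := B)
        (fun ξ hξ => (hF k (by omega) ξ (hsub ξ hξ)).hasDerivWithinAt)
        (fun ξ hξ => hB ξ (hsub ξ hξ)) (Set.left_mem_Icc.mpr (by linarith))
        (Set.right_mem_Icc.mpr (by linarith))
      simpa using h1

/-- The falling factorial `b (b - 1) ⋯ (b - i + 1)`. -/
def fallingFactorial (b : ℝ) (i : ℕ) : ℝ := ∏ m ∈ Finset.range i, (b - m)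

theorem abs_bdiff_rpow_le (k : ℕ) (b : ℝ) (y : ℤ) {B : ℝ} (hy : (k : ℤ) < y)
    (hB : ∀ x ∈ Set.Icc ((y : ℝ) - k) y, |fallingFactorial b k| * x ^ (b - k) ≤ B) :
    |bdiff k (fun z => (z : ℝ) ^ b) y| ≤ B := by
  have hy' : (k : ℝ) < y := by exact_mod_cast hy
  have hpos : ∀ x ∈ Set.Icc ((y : ℝ) - k) y, 0 < x := fun x hx => by linarith [hx.1]
  have h := abs_bdiff_le_of_hasDerivAt k (fun i x => fallingFactorial b i * x ^ (b - i)) y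
    (B := B) ?_ ?_
  · simpa [fallingFactorial] using h
  · intro i _ x hx
    have := (Real.hasDerivAt_rpow_const (p := b - i) (Or.inl (hpos x hx).ne')).const_mul
      (fallingFactorial b i)
    refine this.congr_deriv ?_
    have e : fallingFactorial b (i + 1) = fallingFactorial b i * (b - i) :=
      Finset.prod_range_succ _ _
    rw [e]
    push_cast
    rw [sub_sub]
    ring
  · intro x hx
    rw [abs_mul, abs_of_nonneg (Real.rpow_nonneg (hpos x hx).le _)]
    exact hB x hx

/-! ### The interpolating profile -/

/-- The profile `(1 - (u / d)^a)^k`, continued by `1` to the left of `0` and by `0` to the right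
of `d`. -/
def profile (a : ℝ) (k d : ℕ) (u : ℤ) : ℝ := (1 - (max 0 (min 1 ((u : ℝ) / d))) ^ a) ^ k

theorem clamp_mem (x : ℝ) : 0 ≤ max 0 (min 1 x) ∧ max 0 (min 1 x) ≤ 1 :=
  ⟨le_max_left _ _, max_le zero_le_one (min_le_left _ _)⟩

theorem clamp_rpow_mem {a : ℝ} (ha : 0 ≤ a) (x : ℝ) :
    0 ≤ (max 0 (min 1 x)) ^ a ∧ (max 0 (min 1 x)) ^ a ≤ 1 :=
  ⟨Real.rpow_nonneg (clamp_mem x).1 _, Real.rpow_le_one (clamp_mem x).1 (clamp_mem x).2 ha⟩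

theorem profile_nonneg {a : ℝ} (ha : 0 ≤ a) (k d : ℕ) (u : ℤ) : 0 ≤ profile a k d u :=
  pow_nonneg (by linarith [(clamp_rpow_mem ha ((u : ℝ) / d)).2]) _

theorem profile_le_one {a : ℝ} (ha : 0 ≤ a) (k d : ℕ) (u : ℤ) : profile a k d u ≤ 1 :=
  pow_le_one₀ (by linarith [(clamp_rpow_mem ha ((u : ℝ) / d)).2])
    (by linarith [(clamp_rpow_mem ha ((u : ℝ) / d)).1])

theorem profile_of_nonpos {a : ℝ} (ha : 0 < a) (k d : ℕ) {u : ℤ} (hu : u ≤ 0) :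
    profile a k d u = 1 := by
  have h : (u : ℝ) / d ≤ 0 := div_nonpos_of_nonpos_of_nonneg (by exact_mod_cast hu) (by positivity)
  rw [profile, max_eq_left ((min_le_right _ _).trans h), Real.zero_rpow ha.ne', sub_zero, one_pow]

theorem profile_of_ge (a : ℝ) {k d : ℕ} (hk : 1 ≤ k) (hd : 1 ≤ d) {u : ℤ} (hu : (d : ℤ) ≤ u) :
    profile a k d u = 0 := by
  have hd' : (0 : ℝ) < d := by exact_mod_cast hd
  have h : 1 ≤ (u : ℝ) / d := by rw [le_div_iff₀ hd', one_mul]; exact_mod_cast hu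
  rw [profile, min_eq_left h, max_eq_right zero_le_one, Real.one_rpow, sub_self,
    zero_pow (by omega)]

theorem profile_le_one_sub {a : ℝ} (ha : 0 ≤ a) {k d : ℕ} (hk : 1 ≤ k) {u : ℤ} (hu : 0 ≤ u)
    (hud : u ≤ d) : profile a k d u ≤ 1 - ((u : ℝ) / d) ^ a := by
  have h0 : 0 ≤ (u : ℝ) / d := div_nonneg (by exact_mod_cast hu) (by positivity)
  have h1 : (u : ℝ) / d ≤ 1 := div_le_one_of_le₀ (by exact_mod_cast hud) (by positivity)
  have h := clamp_rpow_mem ha ((u : ℝ) / d)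
  rw [profile]
  rw [min_eq_right h1, max_eq_right h0] at h ⊢
  exact pow_le_of_le_one (by linarith) (by linarith) (by omega)

theorem abs_profile_sub_one_le {a : ℝ} (ha : 0 ≤ a) {k d : ℕ} (hd : 1 ≤ d) {u : ℤ}
    (hu : u ≤ k) : |profile a k d u - 1| ≤ k * ((k : ℝ) / d) ^ a := by
  have h := clamp_rpow_mem ha ((u : ℝ) / d)
  have hb := one_add_mul_le_pow
    (a := -(max 0 (min 1 ((u : ℝ) / d))) ^ a) (by linarith) k
  have h1 := profile_le_one ha k d u
  have h2 : (max 0 (min 1 ((u : ℝ) / d))) ^ a ≤ ((k : ℝ) / d) ^ a := by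
    refine Real.rpow_le_rpow (clamp_mem _).1 (max_le (by positivity) ?_) ha
    refine (min_le_right _ _).trans ?_
    gcongr
    exact_mod_cast hu
  rw [abs_sub_comm, abs_of_nonneg (by linarith)]
  rw [← sub_eq_add_neg] at hb
  have : (k : ℝ) * (max 0 (min 1 ((u : ℝ) / d))) ^ a ≤ k * ((k : ℝ) / d) ^ a := by gcongr
  unfold profile
  linarith

theorem one_sub_rpow_le {a x : ℝ} {k : ℕ} (hk : 1 ≤ k) (hak : a ≤ k) (hx : 0 ≤ x)
    (hx1 : x ≤ 1) : 1 - x ^ a ≤ k * (1 - x) := by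
  have h1 : x ^ (k : ℝ) ≤ x ^ a := by
    rcases hx.eq_or_lt with rfl | h
    · rw [Real.zero_rpow (by positivity)]
      exact Real.rpow_nonneg le_rfl _
    · exact Real.rpow_le_rpow_of_exponent_ge h hx1 hak
  have h2 := one_add_mul_le_pow (a := x - 1) (by linarith) k
  rw [Real.rpow_natCast] at h1
  rw [add_sub_cancel] at h2
  nlinarith

/-- The outer power `k` of the profile makes it vanish to order `k` at its end, so that continuing
it by `0` creates no large differences. -/
theorem profile_le_of_near_end {a : ℝ} {k d : ℕ} (hk : 1 ≤ k) (ha : 0 ≤ a) (hak : a ≤ k)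
    (hd : 1 ≤ d) {u : ℤ} (hu : (d : ℤ) - k ≤ u) :
    profile a k d u ≤ ((k : ℝ) ^ 2 / d) ^ k := by
  have hd' : (0 : ℝ) < d := by exact_mod_cast hd
  have h := clamp_rpow_mem ha ((u : ℝ) / d)
  have hx := clamp_mem ((u : ℝ) / d)
  have h1 := one_sub_rpow_le hk hak hx.1 hx.2
  refine pow_le_pow_left₀ (by linarith) (h1.trans ?_) k
  have h2 : 1 - (k : ℝ) / d ≤ max 0 (min 1 ((u : ℝ) / d)) := by
    refine le_max_of_le_right (le_min ?_ ?_)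
    · have : 0 ≤ (k : ℝ) / d := by positivity
      linarith
    · rw [le_div_iff₀ hd', sub_mul, one_mul, div_mul_cancel₀ _ hd'.ne']
      exact_mod_cast hu
  have h3 : (k : ℝ) * (1 - max 0 (min 1 ((u : ℝ) / d))) ≤ k * ((k : ℝ) / d) := by
    gcongr
    linarith
  refine h3.trans (le_of_eq ?_)
  ring

/-- By the binomial theorem the profile is a combination of the powers `(z / d) ^ (a m)` with `a = k
- θ`. The `k`-th difference annihilates `m = 0`; for `m ≥ 1` the mean value bound gives order `x ^
(a m - k)`, which is split into `x ^ (-θ)`, largest at the left end, and `x ^ (a m - a) ≤ d ^ (a m -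
a)`. -/
theorem abs_bdiff_profile_inner_le {θ : ℝ} (hθ : 0 ≤ θ) {k : ℕ} (hk : 1 ≤ k)
    (hθ1 : θ ≤ 1 / 2) {d : ℕ} (hd : 1 ≤ d) {y : ℤ} (hy : (k : ℤ) < y) (hyd : y ≤ d) :
    |bdiff k (profile (k - θ) k d) y| ≤
      (∑ m ∈ Finset.range (k + 1), (k.choose m : ℝ) * |fallingFactorial ((k - θ) * m) k|) *
        (((y : ℝ) - k) ^ (-θ) * (d : ℝ) ^ (-(k - θ))) := by
  set a : ℝ := k - θ with ha
  have hk' : (1 : ℝ) ≤ k := by exact_mod_cast hk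
  have ha0 : 0 < a := by rw [ha]; linarith
  have hd' : (0 : ℝ) < d := by exact_mod_cast hd
  have hy' : (k : ℝ) + 1 ≤ y := by exact_mod_cast hy
  have hyd' : (y : ℝ) ≤ d := by exact_mod_cast hyd
  have hexp : ∀ z : ℤ, y - k ≤ z → z ≤ y → profile a k d z =
      ∑ m ∈ Finset.range (k + 1), ((k.choose m : ℝ) * (-1) ^ m * (d : ℝ) ^ (-(a * m))) *
        (z : ℝ) ^ (a * m) := by
    intro z hz1 hz2
    have hz0 : (0 : ℝ) ≤ z := by exact_mod_cast (by omega : (0 : ℤ) ≤ z)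
    have hzd : (z : ℝ) ≤ d := by exact_mod_cast hz2.trans hyd
    have h1 : (z : ℝ) / d ≤ 1 := div_le_one_of_le₀ hzd hd'.le
    rw [profile, min_eq_right h1, max_eq_right (by positivity), sub_eq_neg_add, add_pow]
    refine Finset.sum_congr rfl fun m _ => ?_
    have e : (((z : ℝ) / d) ^ a) ^ m = ((z : ℝ) / d) ^ (a * m) := by
      rw [← Real.rpow_natCast, ← Real.rpow_mul (by positivity)]
    rw [neg_pow, one_pow, e, Real.div_rpow hz0 hd'.le, Real.rpow_neg hd'.le]
    ring
  rw [bdiff_congr hexp, bdiff_finset_sum, Finset.sum_mul]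
  refine (Finset.abs_sum_le_sum_abs _ _).trans (Finset.sum_le_sum fun m _ => ?_)
  rw [bdiff_const_mul, abs_mul, abs_mul, abs_mul, abs_pow, abs_neg, abs_one, one_pow, mul_one,
    Nat.abs_cast, abs_of_nonneg (Real.rpow_nonneg hd'.le _)]
  have hmain : |bdiff k (fun z => (z : ℝ) ^ (a * m)) y| ≤
      |fallingFactorial (a * m) k| * (((y : ℝ) - k) ^ (-θ) * (d : ℝ) ^ (a * m - a)) := by
    refine abs_bdiff_rpow_le k _ y hy fun x hx => ?_
    rcases Nat.eq_zero_or_pos m with rfl | hm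
    · have : fallingFactorial (a * (0 : ℕ)) k = 0 := by
        refine Finset.prod_eq_zero (Finset.mem_range.mpr hk) ?_
        simp
      rw [this]
      simp
    · have hm' : (1 : ℝ) ≤ m := by exact_mod_cast hm
      have hx0 : 0 < x := by linarith [hx.1]
      have e : a * m - k = -θ + (a * m - a) := by rw [ha]; ring
      rw [e, Real.rpow_add hx0]
      refine mul_le_mul_of_nonneg_left ?_ (abs_nonneg _)
      refine mul_le_mul ?_ ?_ (Real.rpow_nonneg hx0.le _) (Real.rpow_nonneg (by linarith) _)
      · exact Real.rpow_le_rpow_of_nonpos (by linarith) hx.1 (by linarith)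
      · exact Real.rpow_le_rpow hx0.le (hx.2.trans hyd') (by nlinarith)
  calc (k.choose m : ℝ) * (d : ℝ) ^ (-(a * m)) * |bdiff k (fun z => (z : ℝ) ^ (a * m)) y|
      ≤ (k.choose m : ℝ) * (d : ℝ) ^ (-(a * m)) * (|fallingFactorial (a * m) k| *
        (((y : ℝ) - k) ^ (-θ) * (d : ℝ) ^ (a * m - a))) := by gcongr
    _ = (k.choose m : ℝ) * |fallingFactorial (a * m) k| * (((y : ℝ) - k) ^ (-θ) *
        ((d : ℝ) ^ (-(a * m)) * (d : ℝ) ^ (a * m - a))) := by ring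
    _ = _ := by
        rw [← Real.rpow_add hd']
        congr 4
        ring

/-- Three zones: for `y ≤ k` the profile is within order `d ^ (-a)` of `1`; for `k < y ≤ d` the
power bound applies; for `d < y` the values are of order `d ^ (-k)`. The last sum is a harmonic sum
for `θ = 1/2` and equals `d` for `θ = 0`. -/
theorem sum_sq_bdiff_profile_le (k : ℕ) (hk : 1 ≤ k) {θ : ℝ} (hθ : 0 ≤ θ) (hθ1 : θ ≤ 1 / 2) :
    ∃ C : ℝ, 0 ≤ C ∧ ∀ d : ℕ, 1 ≤ d →
      ∑ y ∈ Finset.Ioo (0 : ℤ) (d + k), (bdiff k (profile (k - θ) k d) y) ^ 2 ≤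
        C * ((d : ℝ) ^ (-(2 * (k - θ))) * ∑ u ∈ Finset.Icc 1 d, (u : ℝ) ^ (-(2 * θ))) := by
  have hk' : (1 : ℝ) ≤ k := by exact_mod_cast hk
  set a : ℝ := k - θ with ha
  have ha0 : 0 < a := by rw [ha]; linarith
  set C1 : ℝ := 2 ^ k * (k * (k : ℝ) ^ a)
  set C2 : ℝ := ∑ m ∈ Finset.range (k + 1), (k.choose m : ℝ) * |fallingFactorial (a * m) k|
  set C3 : ℝ := 2 ^ k * ((k : ℝ) ^ 2) ^ k
  refine ⟨k * C1 ^ 2 + C2 ^ 2 + k * C3 ^ 2, by positivity, fun d hd => ?_⟩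
  have hd' : (1 : ℝ) ≤ d := by exact_mod_cast hd
  have hd0 : (0 : ℝ) < d := by linarith
  set T := ∑ u ∈ Finset.Icc 1 d, (u : ℝ) ^ (-(2 * θ)) with hT
  -- The term `u = 1` of `T` is enough to absorb the two boundary zones.
  have hT1 : 1 ≤ T := by
    have := Finset.single_le_sum (f := fun u : ℕ => (u : ℝ) ^ (-(2 * θ)))
      (fun u _ => Real.rpow_nonneg (Nat.cast_nonneg u) _) (Finset.left_mem_Icc.mpr hd)
    simpa using this
  set q := (d : ℝ) ^ (-(2 * a)) with hq
  have hq0 : 0 < q := Real.rpow_pos_of_pos hd0 _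
  have hqa : (((d : ℝ) ^ a)⁻¹) ^ 2 = q := by
    rw [hq, ← Real.rpow_neg hd0.le, ← Real.rpow_natCast, ← Real.rpow_mul hd0.le]
    congr 1
    push_cast
    ring
  have hb1 : ∀ y ∈ Finset.Icc (1 : ℤ) k, (bdiff k (profile a k d) y) ^ 2 ≤ C1 ^ 2 * q := by
    intro y hy
    rw [Finset.mem_Icc] at hy
    have h1 : bdiff k (profile a k d) y = bdiff k (fun z => profile a k d z - 1) y := by
      rw [bdiff_sub, bdiff_const hk, sub_zero]
    rw [h1, ← sq_abs, ← hqa, ← mul_pow]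
    refine pow_le_pow_left₀ (abs_nonneg _) ?_ 2
    refine (abs_bdiff_le fun z _ hz => abs_profile_sub_one_le ha0.le hd (hz.trans hy.2)).trans ?_
    rw [Real.div_rpow (by positivity) hd0.le]
    simp only [C1]
    exact le_of_eq (by ring)
  have hb3 : ∀ y ∈ Finset.Ioo (d : ℤ) (d + k), (bdiff k (profile a k d) y) ^ 2 ≤ C3 ^ 2 * q := by
    intro y hy
    rw [Finset.mem_Ioo] at hy
    rw [← sq_abs, ← hqa, ← mul_pow]
    refine pow_le_pow_left₀ (abs_nonneg _) ?_ 2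
    refine (abs_bdiff_le (B := ((k : ℝ) ^ 2 / d) ^ k) fun z hz _ => ?_).trans ?_
    · rw [abs_of_nonneg (profile_nonneg ha0.le _ _ _)]
      exact profile_le_of_near_end hk ha0.le (by rw [ha]; linarith) hd (by omega)
    · simp only [C3]
      rw [mul_assoc, div_pow, div_eq_mul_inv]
      have : ((d : ℝ) ^ k)⁻¹ ≤ ((d : ℝ) ^ a)⁻¹ := by
        rw [← Real.rpow_natCast]
        gcongr
        rw [ha]
        linarith
      gcongr
  have hb2 : ∀ y ∈ Finset.Icc ((k : ℤ) + 1) d, (bdiff k (profile a k d) y) ^ 2 ≤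
      C2 ^ 2 * q * ((y : ℝ) - k) ^ (-(2 * θ)) := by
    intro y hy
    rw [Finset.mem_Icc] at hy
    have hy' : (k : ℝ) + 1 ≤ y := by exact_mod_cast hy.1
    have h := abs_bdiff_profile_inner_le hθ hk hθ1 hd (y := y) (by omega) hy.2
    rw [← sq_abs]
    refine (pow_le_pow_left₀ (abs_nonneg _) h 2).trans (le_of_eq ?_)
    have e : (((y : ℝ) - k) ^ (-θ)) ^ 2 = ((y : ℝ) - k) ^ (-(2 * θ)) := by
      rw [← Real.rpow_natCast, ← Real.rpow_mul (by linarith)]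
      congr 1
      push_cast
      ring
    rw [mul_pow, mul_pow, e, Real.rpow_neg hd0.le, hqa]
    ring
  have hsub : Finset.Ioo (0 : ℤ) (d + k) ⊆
      (Finset.Icc (1 : ℤ) k ∪ Finset.Icc ((k : ℤ) + 1) d) ∪ Finset.Ioo (d : ℤ) (d + k) := by
    intro y hy
    simp only [Finset.mem_union, Finset.mem_Icc, Finset.mem_Ioo] at hy ⊢
    omega
  have hnn : ∀ y : ℤ, 0 ≤ (bdiff k (profile a k d) y) ^ 2 := fun y => sq_nonneg _
  refine (Finset.sum_le_sum_of_subset_of_nonneg hsub fun y _ _ => hnn y).trans ?_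
  have hun : ∀ s t : Finset ℤ, ∑ y ∈ s ∪ t, (bdiff k (profile a k d) y) ^ 2 ≤
      ∑ y ∈ s, (bdiff k (profile a k d) y) ^ 2 + ∑ y ∈ t, (bdiff k (profile a k d) y) ^ 2 := by
    intro s t
    rw [← Finset.sum_union_inter]
    exact le_add_of_nonneg_right (Finset.sum_nonneg fun y _ => hnn y)
  refine (hun _ _).trans ((add_le_add_left (hun _ _) _).trans ?_)
  have hs1 := Finset.sum_le_card_nsmul _ _ _ hb1
  have hs3 := Finset.sum_le_card_nsmul _ _ _ hb3
  have hs2 : ∑ y ∈ Finset.Icc ((k : ℤ) + 1) d, (bdiff k (profile a k d) y) ^ 2 ≤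
      C2 ^ 2 * q * T := by
    refine (Finset.sum_le_sum hb2).trans ?_
    rw [← Finset.mul_sum]
    refine mul_le_mul_of_nonneg_left ?_ (by positivity)
    rw [hT]
    calc ∑ y ∈ Finset.Icc ((k : ℤ) + 1) d, ((y : ℝ) - k) ^ (-(2 * θ))
        = ∑ u ∈ (Finset.Icc ((k : ℤ) + 1) d).image (fun y : ℤ => (y - k).toNat),
            (u : ℝ) ^ (-(2 * θ)) := by
          rw [Finset.sum_image]
          · refine Finset.sum_congr rfl fun y hy => ?_
            rw [Finset.mem_Icc] at hy
            congr 1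
            have : (((y - k).toNat : ℤ) : ℝ) = ((y - k : ℤ) : ℝ) := by
              rw [Int.toNat_of_nonneg (by omega)]
            push_cast at this
            exact this.symm
          · intro y hy z hz h
            simp only [Finset.coe_Icc, Set.mem_Icc] at hy hz
            simp only at h
            omega
      _ ≤ _ := by
          refine Finset.sum_le_sum_of_subset_of_nonneg ?_
            fun u _ _ => Real.rpow_nonneg (Nat.cast_nonneg u) _
          intro u hu
          simp only [Finset.mem_image, Finset.mem_Icc] at hu ⊢
          obtain ⟨y, hy, rfl⟩ := hu
          omega
  have hc1 : (Finset.Icc (1 : ℤ) k).card ≤ k := by simp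
  have hc3 : (Finset.Ioo (d : ℤ) (d + k)).card ≤ k := by simp
  rw [nsmul_eq_mul] at hs1 hs3
  have hs1' : ((Finset.Icc (1 : ℤ) k).card : ℝ) * (C1 ^ 2 * q) ≤ k * (C1 ^ 2 * q) * T := by
    calc _ ≤ (k : ℝ) * (C1 ^ 2 * q) := by gcongr
      _ ≤ _ := le_mul_of_one_le_right (by positivity) hT1
  have hs3' : ((Finset.Ioo (d : ℤ) (d + k)).card : ℝ) * (C3 ^ 2 * q) ≤ k * (C3 ^ 2 * q) * T := by
    calc _ ≤ (k : ℝ) * (C3 ^ 2 * q) := by gcongr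
      _ ≤ _ := le_mul_of_one_le_right (by positivity) hT1
  linarith

theorem sum_inv_le_log {d : ℕ} (hd : 1 ≤ d) :
    ∑ u ∈ Finset.Icc 1 d, (u : ℝ) ^ (-(2 * (1 / 2 : ℝ))) ≤ Real.log (Real.exp 1 * d) := by
  have hd' : (0 : ℝ) < d := by exact_mod_cast hd
  rw [Real.log_mul (Real.exp_pos 1).ne' hd'.ne', Real.log_exp]
  have h := harmonic_le_one_add_log d
  rw [harmonic_eq_sum_Icc] at h
  push_cast at h
  refine le_trans (le_of_eq ?_) h
  refine Finset.sum_congr rfl fun u _ => ?_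
  norm_num [Real.rpow_neg_one]

/-- The profile with exponent `k - 1/2`. -/
theorem exists_rough_profile_bound (k : ℕ) (hk : 1 ≤ k) :
    ∃ C : ℝ, 0 ≤ C ∧ ∀ d : ℕ, 1 ≤ d →
      ∑ y ∈ Finset.Ioo (0 : ℤ) (d + k), (bdiff k (profile (k - 1 / 2) k d) y) ^ 2 ≤
        C * (Real.log (Real.exp 1 * d) * (1 / (d : ℝ)) ^ (2 * k - 1)) := by
  obtain ⟨C, hC, h⟩ := sum_sq_bdiff_profile_le k hk (θ := 1 / 2) (by norm_num) le_rfl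
  refine ⟨C, hC, fun d hd => (h d hd).trans ?_⟩
  have hd' : (0 : ℝ) < d := by exact_mod_cast hd
  refine mul_le_mul_of_nonneg_left ?_ hC
  rw [mul_comm]
  refine mul_le_mul (sum_inv_le_log hd) (le_of_eq ?_) (Real.rpow_nonneg hd'.le _)
    ((Finset.sum_nonneg fun u _ => Real.rpow_nonneg (Nat.cast_nonneg u) _).trans
      (sum_inv_le_log hd))
  rw [one_div_pow, one_div (_ ^ _), Real.rpow_neg hd'.le, ← Real.rpow_natCast,
    Nat.cast_sub (by omega)]
  congr 2
  push_cast
  ring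

/-- The profile with exponent `k`. -/
theorem exists_smooth_profile_bound (k : ℕ) (hk : 1 ≤ k) :
    ∃ C : ℝ, 0 ≤ C ∧ ∀ d : ℕ, 1 ≤ d →
      ∑ y ∈ Finset.Ioo (0 : ℤ) (d + k), (bdiff k (profile k k d) y) ^ 2 ≤
        C * (1 / (d : ℝ)) ^ (2 * k - 1) := by
  obtain ⟨C, hC, h⟩ := sum_sq_bdiff_profile_le k hk (θ := 0) le_rfl (by norm_num)
  refine ⟨C, hC, fun d hd => ?_⟩
  have hd' : (0 : ℝ) < d := by exact_mod_cast hd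
  have h' := h d hd
  rw [sub_zero] at h'
  refine h'.trans (mul_le_mul_of_nonneg_left (le_of_eq ?_) hC)
  simp only [mul_zero, neg_zero, Real.rpow_zero, Finset.sum_const, Nat.card_Icc, nsmul_eq_mul,
    mul_one, Nat.add_sub_cancel]
  have e : (d : ℝ) ^ (-(2 * (k : ℝ))) = ((d : ℝ) ^ (2 * k))⁻¹ := by
    rw [Real.rpow_neg hd'.le, ← Real.rpow_natCast]
    push_cast
    rfl
  have e2 : (d : ℝ) ^ (2 * k) = (d : ℝ) ^ (2 * k - 1) * d := by
    rw [← pow_succ]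
    congr 1
    omega
  rw [e, e2, one_div, inv_pow]
  field_simp

/-! ### Interpolating weights in one dimension -/

/-- The weight that equals `1` on `[t : t + k - 1]` and falls to `0` at `lo` and `hi`. -/
def edgeWeight (a : ℝ) (k t lo hi : ℕ) (z : ℤ) : ℝ :=
  if z < t then profile a k (t - lo) (t - z) else profile a k (hi - (t + k - 1)) (z - (t + k - 1))

/-- The adjoint of the `k`-th order difference, applied to `W`. -/
def adjDiff (N k : ℕ) (W : ℤ → ℝ) : EuclideanSpace ℝ (Fin N) :=
  ∑ j : Fin N, if k ≤ (j : ℕ) then W j • diffVec N k j else 0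

section OneDim

variable {a : ℝ} {k t lo hi : ℕ}

theorem edgeWeight_nonneg (ha : 0 < a) (z : ℤ) : 0 ≤ edgeWeight a k t lo hi z := by
  unfold edgeWeight
  split_ifs <;> exact profile_nonneg ha.le _ _ _

theorem edgeWeight_le_one (ha : 0 < a) (z : ℤ) : edgeWeight a k t lo hi z ≤ 1 := by
  unfold edgeWeight
  split_ifs <;> exact profile_le_one ha.le _ _ _

theorem edgeWeight_self (ha : 0 < a) (hk : 1 ≤ k) : edgeWeight a k t lo hi t = 1 := by
  rw [edgeWeight, if_neg (lt_irrefl _)]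
  exact profile_of_nonpos ha _ _ (by omega)

theorem edgeWeight_eq_zero (hk : 1 ≤ k) (hlo : lo < t) (hhi : t + k - 1 < hi) {z : ℤ}
    (hz : z ≤ lo ∨ (hi : ℤ) ≤ z) : edgeWeight a k t lo hi z = 0 := by
  unfold edgeWeight
  split_ifs <;> exact profile_of_ge a hk (by omega) (by omega)

theorem edgeWeight_le (ha : 0 < a) (hk : 1 ≤ k) (hlo : lo < t) (hhi : t + k - 1 < hi) {j D : ℕ}
    (hj1 : lo ≤ j) (hj2 : j ≤ hi) (hD1 : t - lo ≤ D) (hD2 : hi - (t + k - 1) ≤ D) :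
    edgeWeight a k t lo hi j ≤ 1 - ((gap k t j : ℝ) / D) ^ a := by
  have hDD : ∀ {u d : ℕ}, 1 ≤ d → d ≤ D → ((u : ℝ) / D) ^ a ≤ ((u : ℝ) / d) ^ a := by
    intro u d h1 h2
    have : (0 : ℝ) < d := by exact_mod_cast h1
    refine Real.rpow_le_rpow (by positivity) ?_ ha.le
    gcongr
  unfold edgeWeight gap
  rcases lt_or_ge j t with h | h
  · rw [if_pos (by exact_mod_cast h), if_pos h]
    have e : (t : ℤ) - j = ((t - j : ℕ) : ℤ) := by omega
    have h1 := profile_le_one_sub (d := t - lo) ha.le hk (u := (t : ℤ) - j) (by omega) (by omega)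
    have h2 := hDD (u := t - j) (d := t - lo) (by omega) hD1
    rw [e] at h1 ⊢
    rw [Int.cast_natCast] at h1
    linarith
  · rw [if_neg (by omega), if_neg (by omega)]
    rcases le_or_gt j (t + k - 1) with h3 | h3
    · rw [profile_of_nonpos ha _ _ (by omega), Nat.sub_eq_zero_of_le h3, Nat.cast_zero, zero_div,
        Real.zero_rpow ha.ne', sub_zero]
    · have e : (j : ℤ) - (t + k - 1) = ((j - (t + k - 1) : ℕ) : ℤ) := by omega
      have h1 := profile_le_one_sub (d := hi - (t + k - 1)) ha.le hk
        (u := (j : ℤ) - (t + k - 1)) (by omega) (by omega)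
      have h2 := hDD (u := j - (t + k - 1)) (d := hi - (t + k - 1)) (by omega) hD2
      rw [e] at h1 ⊢
      rw [Int.cast_natCast] at h1
      linarith

/-- Since `W` vanishes outside `[k, N)`, the sum over admissible positions may be completed to the
full forward difference without boundary terms. -/
theorem adjDiff_apply {N : ℕ} {W : ℤ → ℝ} (hW : ∀ z : ℤ, z < k ∨ (N : ℤ) ≤ z → W z = 0)
    (x : Fin N) : adjDiff N k W x = (N : ℝ) ^ (k - 1) *
      ∑ l ∈ Finset.range (k + 1), (-1 : ℝ) ^ l * (k.choose l : ℝ) * W ((x : ℤ) + l) := by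
  set H : ℕ → ℝ := fun j => if (x : ℕ) ≤ j then
    (N : ℝ) ^ (k - 1) * ((-1 : ℝ) ^ (j - x : ℕ) * (k.choose (j - x) : ℝ) * W j) else 0 with hH
  have h1 : adjDiff N k W x = ∑ j ∈ Finset.range N, H j := by
    rw [← Fin.sum_univ_eq_sum_range, adjDiff, WithLp.ofLp_sum, Finset.sum_apply]
    refine Finset.sum_congr rfl fun j _ => ?_
    simp only [hH]
    by_cases hj : k ≤ (j : ℕ)
    · rw [if_pos hj, PiLp.smul_apply, diffVec, smul_eq_mul]
      simp only
      split_ifs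
      · ring
      · rw [mul_zero]
    · rw [if_neg hj, hW j (Or.inl (by omega))]
      simp
  have h2 : (N : ℝ) ^ (k - 1) *
      ∑ l ∈ Finset.range (k + 1), (-1 : ℝ) ^ l * (k.choose l : ℝ) * W ((x : ℤ) + l) =
      ∑ j ∈ Finset.Ico (x : ℕ) (x + (k + 1)), H j := by
    rw [Finset.sum_Ico_eq_sum_range, Finset.mul_sum, Nat.add_sub_cancel_left]
    refine Finset.sum_congr rfl fun l _ => ?_
    simp only [hH, Nat.le_add_right, if_true, Nat.add_sub_cancel_left]
    push_cast
    rfl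
  rw [h1, h2]
  have h3 : ∑ j ∈ Finset.range N ∪ Finset.Ico (x : ℕ) (x + (k + 1)), H j =
      ∑ j ∈ Finset.range N, H j := by
    symm
    refine Finset.sum_subset Finset.subset_union_left fun j _ hj => ?_
    simp only [Finset.mem_range, not_lt] at hj
    simp only [hH]
    rw [hW j (Or.inr (by exact_mod_cast hj))]
    simp
  rw [← h3]
  symm
  refine Finset.sum_subset Finset.subset_union_right fun j _ hj => ?_
  simp only [Finset.mem_Ico, not_and, not_lt] at hj
  simp only [hH]
  split_ifs with h
  · rw [Nat.choose_eq_zero_of_lt (by have := hj h; omega)]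
    simp
  · rfl

theorem sum_comp_le_of_injOn {α β : Type*} [DecidableEq β] {s : Finset α} {T : Finset β} {φ : α → β}
    (hφ : Set.InjOn φ s) {g : β → ℝ} (hg : ∀ y, 0 ≤ g y)
    (h0 : ∀ x ∈ s, φ x ∉ T → g (φ x) = 0) : ∑ x ∈ s, g (φ x) ≤ ∑ y ∈ T, g y := by
  rw [← Finset.sum_image hφ]
  have : ∑ y ∈ s.image φ ∩ T, g y = ∑ y ∈ s.image φ, g y := by
    refine Finset.sum_subset Finset.inter_subset_left fun y hy hyT => ?_
    obtain ⟨x, hx, rfl⟩ := Finset.mem_image.mp hy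
    exact h0 x hx fun h => hyT (Finset.mem_inter.mpr ⟨hy, h⟩)
  rw [← this]
  exact Finset.sum_le_sum_of_subset_of_nonneg Finset.inter_subset_right fun y _ _ => hg y

theorem edgeWeight_support {N : ℕ} (hk : 1 ≤ k) (hklo : k ≤ lo) (hlo : lo < t)
    (hhi : t + k - 1 < hi) (hN : hi < N) (z : ℤ) (hz : z < k ∨ (N : ℤ) ≤ z) :
    edgeWeight a k t lo hi z = 0 :=
  edgeWeight_eq_zero hk hlo hhi (by omega)

theorem bdiff_profile_eq_zero (hk : 1 ≤ k) {d : ℕ} (hd : 1 ≤ d) (ha : 0 < a) {y : ℤ}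
    (hy : y ∉ Finset.Ioo (0 : ℤ) (d + k)) : bdiff k (profile a k d) y = 0 := by
  simp only [Finset.mem_Ioo, not_and, not_lt] at hy
  rcases le_or_gt y 0 with h | h
  · rw [bdiff_congr (g := fun _ => 1) fun z _ hz => profile_of_nonpos ha _ _ (by omega),
      bdiff_const hk]
  · rw [bdiff_congr (g := fun _ => 0) fun z hz _ => profile_of_ge a hk hd
      (by have := hy h; omega), bdiff_zero_fun]

/-- The forward difference at `x` looks at `x, …, x + k`. As the plateau has length `k`, for `x < t`
these points do not pass its right end, so only the left profile, continued by `1`, is seen; for `x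
≥ t` only the right one is. The two halves therefore never mix. -/
theorem norm_sq_adjDiff_edgeWeight_le {N : ℕ} (ha : 0 < a) (hk : 1 ≤ k) (hklo : k ≤ lo)
    (hlo : lo < t) (hhi : t + k - 1 < hi) (hN : hi < N) :
    ‖adjDiff N k (edgeWeight a k t lo hi)‖ ^ 2 ≤ ((N : ℝ) ^ (k - 1)) ^ 2 *
      (∑ y ∈ Finset.Ioo (0 : ℤ) ((t - lo : ℕ) + k), (bdiff k (profile a k (t - lo)) y) ^ 2 +
        ∑ y ∈ Finset.Ioo (0 : ℤ) ((hi - (t + k - 1) : ℕ) + k),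
          (bdiff k (profile a k (hi - (t + k - 1))) y) ^ 2) := by
  have hval := adjDiff_apply (edgeWeight_support (a := a) hk hklo hlo hhi hN)
  rw [EuclideanSpace.norm_sq_eq]
  simp only [hval, norm_mul, mul_pow]
  rw [← Finset.mul_sum]
  simp only [Real.norm_eq_abs, sq_abs]
  refine mul_le_mul_of_nonneg_left ?_ (by positivity)
  rw [← Finset.sum_filter_add_sum_filter_not _ (fun x : Fin N => (x : ℕ) < t)]
  refine add_le_add ?_ ?_
  · have h1 : ∀ x ∈ Finset.univ.filter (fun x : Fin N => (x : ℕ) < t),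
        (∑ l ∈ Finset.range (k + 1), (-1 : ℝ) ^ l * (k.choose l : ℝ) *
          edgeWeight a k t lo hi ((x : ℤ) + l)) ^ 2 =
        (fun y : ℤ => (bdiff k (profile a k (t - lo)) y) ^ 2) ((t : ℤ) - (x : ℕ)) := by
      intro x hx
      simp only [Finset.mem_filter, Finset.mem_univ, true_and] at hx
      simp only [bdiff]
      congr 1
      refine Finset.sum_congr rfl fun l hl => ?_
      simp only [Finset.mem_range] at hl
      congr 1
      unfold edgeWeight
      split_ifs with h
      · congr 1
        ring
      · rw [profile_of_nonpos ha _ _ (by omega), profile_of_nonpos ha _ _ (by omega)]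
    rw [Finset.sum_congr rfl h1]
    refine sum_comp_le_of_injOn (φ := fun x : Fin N => (t : ℤ) - (x : ℕ))
      (g := fun y : ℤ => (bdiff k (profile a k (t - lo)) y) ^ 2) ?_ (fun y => sq_nonneg _) ?_
    · intro x _ y _ h
      simp only at h
      exact Fin.ext (by omega)
    · intro x _ hx
      rw [bdiff_profile_eq_zero hk (by omega) ha hx, zero_pow two_ne_zero]
  · have h1 : ∀ x ∈ Finset.univ.filter (fun x : Fin N => ¬ (x : ℕ) < t),
        (∑ l ∈ Finset.range (k + 1), (-1 : ℝ) ^ l * (k.choose l : ℝ) *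
          edgeWeight a k t lo hi ((x : ℤ) + l)) ^ 2 =
        (fun y : ℤ => (bdiff k (profile a k (hi - (t + k - 1))) y) ^ 2)
          ((x : ℕ) - (t + k - 1) + k) := by
      intro x hx
      simp only [Finset.mem_filter, Finset.mem_univ, true_and] at hx
      have h2 := bdiff_reverse k (profile a k (hi - (t + k - 1))) ((x : ℕ) - (t + k - 1))
      have h3 : ((-1 : ℝ) ^ k) ^ 2 = 1 := by rw [← pow_mul, mul_comm, pow_mul]; simp
      have h4 : ∀ b : ℝ, b ^ 2 = ((-1) ^ k * b) ^ 2 := fun b => by rw [mul_pow, h3, one_mul]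
      simp only
      rw [h4 (bdiff k _ _), ← h2]
      congr 1
      refine Finset.sum_congr rfl fun l _ => ?_
      congr 1
      unfold edgeWeight
      rw [if_neg (by omega)]
      congr 1
      ring
    rw [Finset.sum_congr rfl h1]
    refine sum_comp_le_of_injOn (φ := fun x : Fin N => (x : ℕ) - ((t : ℤ) + k - 1) + k)
      (g := fun y : ℤ => (bdiff k (profile a k (hi - (t + k - 1))) y) ^ 2) ?_
      (fun y => sq_nonneg _) ?_
    · intro x _ y _ h
      simp only at h
      exact Fin.ext (by omega)
    · intro x _ hx
      rw [bdiff_profile_eq_zero hk (by omega) ha hx, zero_pow two_ne_zero]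

theorem exists_of_adjDiff_ne_zero {N : ℕ} (hk : 1 ≤ k) (hklo : k ≤ lo) (hlo : lo < t)
    (hhi : t + k - 1 < hi) (hN : hi < N) {x : Fin N}
    (hx : adjDiff N k (edgeWeight a k t lo hi) x ≠ 0) :
    ∃ l : Fin (k + 1), lo < (x : ℕ) + l ∧ (x : ℕ) + l < hi := by
  rw [adjDiff_apply (edgeWeight_support (a := a) hk hklo hlo hhi hN)] at hx
  obtain ⟨l, hl, h⟩ := Finset.exists_ne_zero_of_sum_ne_zero (right_ne_zero_of_mul hx)
  refine ⟨⟨l, Finset.mem_range.mp hl⟩, ?_⟩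
  by_contra hc
  exact right_ne_zero_of_mul h (edgeWeight_eq_zero hk hlo hhi (by simp only at hc; omega))

end OneDim

/-- The two exponents of the interpolating profiles. -/
def expo (k : ℕ) (b : Prop) [Decidable b] : ℝ := if b then (k : ℝ) - 1 / 2 else k

theorem expo_pos {k : ℕ} (hk : 1 ≤ k) (b : Prop) [Decidable b] : 0 < expo k b := by
  have : (1 : ℝ) ≤ k := by exact_mod_cast hk
  unfold expo
  split_ifs <;> linarith

/-- Common bound for both profiles; the logarithm is only needed for the exponent `k - 1/2`. -/
theorem exists_adjDiff_bound (k : ℕ) (hk : 1 ≤ k) :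
    ∃ C : ℝ, 1 ≤ C ∧ ∀ (N t lo hi D : ℕ) (b : Prop) [Decidable b], k ≤ lo → lo < t →
      t + k - 1 < hi → hi < N → t - lo ≤ D → hi - (t + k - 1) ≤ D →
      ‖adjDiff N k (edgeWeight (expo k b) k t lo hi)‖ ^ 2 ≤ ((N : ℝ) ^ (k - 1)) ^ 2 *
        (C * (if b then Real.log (Real.exp 1 * D) else 1) *
          ((1 / ((t - lo : ℕ) : ℝ)) ^ (2 * k - 1) +
            (1 / ((hi - (t + k - 1) : ℕ) : ℝ)) ^ (2 * k - 1))) := by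
  obtain ⟨C1, hC1, h1⟩ := exists_rough_profile_bound k hk
  obtain ⟨C2, hC2, h2⟩ := exists_smooth_profile_bound k hk
  refine ⟨C1 + C2 + 1, by linarith, fun N t lo hi D b _ hklo hlo hhi hN hD1 hD2 => ?_⟩
  refine (norm_sq_adjDiff_edgeWeight_le (expo_pos hk b) hk hklo hlo hhi hN).trans ?_
  refine mul_le_mul_of_nonneg_left ?_ (by positivity)
  rw [mul_add]
  have key : ∀ d : ℕ, 1 ≤ d → d ≤ D →
      ∑ y ∈ Finset.Ioo (0 : ℤ) (d + k), (bdiff k (profile (expo k b) k d) y) ^ 2 ≤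
        (C1 + C2 + 1) * (if b then Real.log (Real.exp 1 * D) else 1) *
          (1 / (d : ℝ)) ^ (2 * k - 1) := by
    intro d hd hdD
    have hd' : (1 : ℝ) ≤ d := by exact_mod_cast hd
    have hdD' : (d : ℝ) ≤ D := by exact_mod_cast hdD
    unfold expo
    split_ifs
    · refine (h1 d hd).trans ?_
      have hl : Real.log (Real.exp 1 * d) ≤ Real.log (Real.exp 1 * D) :=
        Real.log_le_log (by positivity) (by gcongr)
      have hl0 : 0 ≤ Real.log (Real.exp 1 * d) :=
        Real.log_nonneg (one_le_mul_of_one_le_of_one_le (Real.one_le_exp zero_le_one) hd')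
      rw [mul_assoc]
      have hC : C1 ≤ C1 + C2 + 1 := by linarith
      gcongr
    · refine (h2 d hd).trans ?_
      rw [mul_one]
      have hC : C2 ≤ C1 + C2 + 1 := by linarith
      gcongr
  exact add_le_add (key _ (by omega) hD1) (key _ (by omega) hD2)

/-! ### Interpolating tensors -/

section Interpolation

variable {ι : Type} [Fintype ι] [DecidableEq ι] {k : ℕ} {n : ι → ℕ}

theorem IsTessellation.lo_ge {S : Finset (Idx n)} {R : Rects n} (h : IsTessellation k S R)
    {t : Idx n} (ht : t ∈ S) (i : ι) : k ≤ (R.lo t i : ℕ) := by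
  refine h.subset t ht (R.lo t) (fun i => ⟨le_rfl, ?_⟩) i
  have := h.interior t ht i
  rw [Fin.le_def]
  omega

theorem IsTessellation.mem_diffIdx {S : Finset (Idx n)} {R : Rects n} (h : IsTessellation k S R)
    {t : Idx n} (ht : t ∈ S) : t ∈ diffIdx k n := by
  rw [TensorTF.mem_diffIdx]
  intro i
  have := h.interior t ht i
  have := h.lo_ge ht i
  omega

theorem IsTessellation.mem_self {S : Finset (Idx n)} {R : Rects n} (h : IsTessellation k S R)
    (hk : 1 ≤ k) {t : Idx n} (ht : t ∈ S) : R.Mem t t := by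
  intro i
  have := h.interior t ht i
  simp only [Fin.le_def]
  omega

theorem dist_le_dmax {S : Finset (Idx n)} (R : Rects n) {t : Idx n} (ht : t ∈ S) (i : ι)
    (z : Bool) : R.dist k t i z ≤ R.dmax k S i := by
  have h := Finset.le_sup (f := fun t => max (R.dist k t i false) (R.dist k t i true)) ht
  refine le_trans ?_ h
  cases z
  · exact le_max_left _ _
  · exact le_max_right _ _

/-- The weight of the coordinate `i'` in the `i`-th summand of the interpolating tensor. -/
def tileEdge (k : ℕ) (R : Rects n) (t : Idx n) (i i' : ι) : ℤ → ℝ :=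
  edgeWeight (expo k (i' = i)) k (t i') (R.lo t i') (R.hi t i')

/-- The interpolating tensor of a single hyperrectangle: an average of products, of which the
`i`-th has the rough profile in the coordinate `i` only. -/
def tileWeight (k : ℕ) (R : Rects n) (t j : Idx n) : ℝ :=
  (Fintype.card ι : ℝ)⁻¹ * ∑ i, ∏ i', tileEdge k R t i i' (j i' : ℕ)

/-- The adjoint difference of `tileWeight`. -/
def tileAdj (k : ℕ) (R : Rects n) (t : Idx n) : Tensor n :=
  ∑ j ∈ diffIdx k n, tileWeight k R t j • rankOne fun i => diffVec (n i) k (j i)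

theorem sum_prod_smul_rankOne (W : (i : ι) → ℤ → ℝ) :
    ∑ j ∈ diffIdx k n, (∏ i, W i (j i : ℕ)) • (rankOne fun i => diffVec (n i) k (j i) : Tensor n) =
      rankOne fun i => adjDiff (n i) k (W i) := by
  ext x
  simp only [rankOne, adjDiff, WithLp.ofLp_sum, Finset.sum_apply, PiLp.smul_apply, smul_eq_mul]
  rw [← sum_prod_idx (fun i (y : Fin (n i)) =>
    (if k ≤ (y : ℕ) then W i (y : ℕ) • diffVec (n i) k y else 0 : EuclideanSpace ℝ (Fin (n i)))
      (x i)), diffIdx, Finset.sum_filter]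
  refine Finset.sum_congr rfl fun j _ => ?_
  split_ifs with h
  · rw [← Finset.prod_mul_distrib]
    refine Finset.prod_congr rfl fun i _ => ?_
    rw [if_pos (h i), PiLp.smul_apply, smul_eq_mul]
  · push Not at h
    obtain ⟨i, hi⟩ := h
    symm
    refine Finset.prod_eq_zero (Finset.mem_univ i) ?_
    rw [if_neg (by omega), PiLp.zero_apply]

theorem tileAdj_eq (R : Rects n) (t : Idx n) :
    tileAdj k R t = (Fintype.card ι : ℝ)⁻¹ •
      ∑ i, rankOne fun i' => adjDiff (n i') k (tileEdge k R t i i') := by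
  simp only [tileAdj, tileWeight, mul_smul, Finset.sum_smul]
  rw [← Finset.smul_sum, Finset.sum_comm]
  simp only [sum_prod_smul_rankOne]

variable {S : Finset (Idx n)} {R : Rects n}

theorem tileEdge_nonneg (hk : 1 ≤ k) (t : Idx n) (i i' : ι) (z : ℤ) :
    0 ≤ tileEdge k R t i i' z := edgeWeight_nonneg (expo_pos hk _) z

theorem tileWeight_nonneg (hk : 1 ≤ k) (t j : Idx n) : 0 ≤ tileWeight k R t j :=
  mul_nonneg (by positivity)
    (Finset.sum_nonneg fun i _ => Finset.prod_nonneg fun i' _ => tileEdge_nonneg hk t i i' _)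

theorem interior_of_tileWeight_ne_zero (h : IsTessellation k S R) (hk : 1 ≤ k) {t : Idx n}
    (ht : t ∈ S) {j : Idx n} (hj : tileWeight k R t j ≠ 0) : R.Interior t j := by
  obtain ⟨i, _, hi⟩ := Finset.exists_ne_zero_of_sum_ne_zero (right_ne_zero_of_mul hj)
  intro i'
  have h1 := Finset.prod_ne_zero_iff.mp hi i' (Finset.mem_univ _)
  have h2 := h.interior t ht i'
  simp only [Fin.lt_def]
  by_contra hc
  exact h1 (edgeWeight_eq_zero hk h2.1 h2.2 (by omega))

theorem tileWeight_self [Nonempty ι] (hk : 1 ≤ k) (t : Idx n) : tileWeight k R t t = 1 := by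
  have : ∀ i i', tileEdge k R t i i' (t i' : ℕ) = 1 := fun i i' =>
    edgeWeight_self (expo_pos hk _) hk
  simp [tileWeight, this]

/-- In the `i`-th product keep only the rough factor, that of coordinate `i`, and bound the others
by `1`; then average over `i`. -/
theorem tileWeight_le [Nonempty ι] (h : IsTessellation k S R) (hk : 1 ≤ k) {t : Idx n}
    (ht : t ∈ S) {j : Idx n} (hj : R.Mem t j) :
    tileWeight k R t j ≤ 1 - (Fintype.card ι : ℝ)⁻¹ *
      ∑ i, ((gap k (t i) (j i) : ℝ) / R.dmax k S i) ^ ((k : ℝ) - 1 / 2) := by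
  have hc : (0 : ℝ) < Fintype.card ι := by exact_mod_cast Fintype.card_pos
  have h1 : ∀ i, ∏ i', tileEdge k R t i i' (j i' : ℕ) ≤
      1 - ((gap k (t i) (j i) : ℝ) / R.dmax k S i) ^ ((k : ℝ) - 1 / 2) := by
    intro i
    have h2 := h.interior t ht i
    have h3 : tileEdge k R t i i (j i : ℕ) ≤
        1 - ((gap k (t i) (j i) : ℝ) / R.dmax k S i) ^ ((k : ℝ) - 1 / 2) := by
      have := edgeWeight_le (expo_pos hk (i = i)) hk h2.1 h2.2 (hj i).1 (hj i).2
        (dist_le_dmax R ht i false) (dist_le_dmax R ht i true)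
      simpa [tileEdge, expo] using this
    refine le_trans ?_ h3
    rw [← Finset.mul_prod_erase _ _ (Finset.mem_univ i)]
    exact mul_le_of_le_one_right (tileEdge_nonneg hk t i i _)
      (Finset.prod_le_one (fun i' _ => tileEdge_nonneg hk t i i' _)
        fun i' _ => edgeWeight_le_one (expo_pos hk _) _)
  calc tileWeight k R t j ≤ (Fintype.card ι : ℝ)⁻¹ *
        ∑ i, (1 - ((gap k (t i) (j i) : ℝ) / R.dmax k S i) ^ ((k : ℝ) - 1 / 2)) := by
        unfold tileWeight
        gcongr with i
        exact h1 i
    _ = _ := by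
        rw [Finset.sum_sub_distrib, mul_sub]
        simp [hc.ne']

/-- The normalized distances in a hyperrectangle. -/
theorem gap_div_dmax_le_one (h : IsTessellation k S R) {t : Idx n} (ht : t ∈ S) {j : Idx n}
    (hj : R.Mem t j) (i : ι) : (gap k (t i) (j i) : ℝ) / R.dmax k S i ≤ 1 := by
  refine div_le_one_of_le₀ ?_ (by positivity)
  have h1 := dist_le_dmax (k := k) R ht i false
  have h2 := dist_le_dmax (k := k) R ht i true
  have h3 := hj i
  have h4 := h.interior t ht i
  simp only [Rects.dist, Bool.false_eq_true, if_false, if_true, Fin.le_def] at h1 h2 h3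
  have : gap k (t i) (j i) ≤ R.dmax k S i := by
    unfold gap
    split_ifs <;> omega
  exact_mod_cast this

/-- Signed sum of the interpolating tensors of all hyperrectangles. -/
def signedWeight (k : ℕ) (S : Finset (Idx n)) (R : Rects n) (s : Idx n → ℝ) (j : Idx n) : ℝ :=
  ∑ t ∈ S, s t * tileWeight k R t j

/-- The weight of a hyperrectangle vanishes on its own boundary, so shared boundary points do no
harm: at a point of `R t` no other hyperrectangle contributes. -/
theorem signedWeight_of_mem (h : IsTessellation k S R) (hk : 1 ≤ k) (s : Idx n → ℝ) {t : Idx n}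
    (ht : t ∈ S) {j : Idx n} (hj : R.Mem t j) :
    signedWeight k S R s j = s t * tileWeight k R t j ∨ signedWeight k S R s j = 0 := by
  by_cases hz : ∃ t' ∈ S, tileWeight k R t' j ≠ 0
  · left
    obtain ⟨t', ht', hne⟩ := hz
    have key : ∀ t'' ∈ S, tileWeight k R t'' j ≠ 0 → t'' = t := fun t'' h1 h2 => by
      by_contra hc
      exact h.disjoint t'' h1 t ht hc j (interior_of_tileWeight_ne_zero h hk h1 h2) hj
    refine Finset.sum_eq_single_of_mem t ht fun b hb hbt => ?_
    by_contra hc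
    exact hbt (key b hb (right_ne_zero_of_mul hc))
  · right
    push Not at hz
    exact Finset.sum_eq_zero fun t' ht' => by rw [hz t' ht', mul_zero]

theorem signedWeight_self [Nonempty ι] (h : IsTessellation k S R) (hk : 1 ≤ k) (s : Idx n → ℝ)
    {t : Idx n} (ht : t ∈ S) : signedWeight k S R s t = s t := by
  have h1 := tileWeight_self (R := R) hk t
  rw [signedWeight, Finset.sum_eq_single_of_mem t ht, h1, mul_one]
  intro b hb hbt
  by_contra hc
  exact h.disjoint b hb t ht hbt t
    (interior_of_tileWeight_ne_zero h hk hb (right_ne_zero_of_mul hc)) (h.mem_self hk ht)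

theorem abs_signedWeight_le [Nonempty ι] (h : IsTessellation k S R) (hk : 1 ≤ k) {s : Idx n → ℝ}
    (hs : ∀ j, |s j| ≤ 1) {t : Idx n} (ht : t ∈ S) {j : Idx n} (hj : R.Mem t j) :
    |signedWeight k S R s j| ≤ 1 - (Fintype.card ι : ℝ)⁻¹ *
      ∑ i, ((gap k (t i) (j i) : ℝ) / R.dmax k S i) ^ ((k : ℝ) - 1 / 2) := by
  have hc : (0 : ℝ) < Fintype.card ι := by exact_mod_cast Fintype.card_pos
  have hk' : (1 : ℝ) ≤ k := by exact_mod_cast hk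
  rcases signedWeight_of_mem h hk s ht hj with e | e
  · rw [e, abs_mul, abs_of_nonneg (tileWeight_nonneg hk t j)]
    exact (mul_le_of_le_one_left (tileWeight_nonneg hk t j) (hs t)).trans
      (tileWeight_le h hk ht hj)
  · rw [e, abs_zero, sub_nonneg]
    have : ∑ i, ((gap k (t i) (j i) : ℝ) / R.dmax k S i) ^ ((k : ℝ) - 1 / 2) ≤
        ∑ _i : ι, (1 : ℝ) := Finset.sum_le_sum fun i _ =>
      Real.rpow_le_one (by positivity) (gap_div_dmax_le_one h ht hj i) (by linarith)
    rw [inv_mul_le_iff₀ hc]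
    simpa using this

/-- If the adjoint difference of a tile is nonzero at `x`, then some shift `x + l` with `l ∈ {0, …,
k}^ι` is interior to its hyperrectangle. An interior point determines the hyperrectangle, so `t ↦ l`
is injective. This bounded overlap replaces orthogonality of the tiles. -/
theorem card_active_le (h : IsTessellation k S R) (hk : 1 ≤ k) (x : Idx n) :
    (S.filter fun t => tileAdj k R t x ≠ 0).card ≤ (k + 1) ^ Fintype.card ι := by
  have key : ∀ t ∈ S.filter (fun t => tileAdj k R t x ≠ 0), ∃ l : ι → Fin (k + 1),
      ∀ i, (R.lo t i : ℕ) < (x i : ℕ) + l i ∧ (x i : ℕ) + l i < R.hi t i := by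
    intro t ht
    rw [Finset.mem_filter] at ht
    have h1 := ht.2
    rw [tileAdj_eq, PiLp.smul_apply, WithLp.ofLp_sum, Finset.sum_apply, smul_eq_mul] at h1
    obtain ⟨i, _, hi⟩ := Finset.exists_ne_zero_of_sum_ne_zero (right_ne_zero_of_mul h1)
    have h2 : ∀ i', ∃ l : Fin (k + 1), (R.lo t i' : ℕ) < (x i' : ℕ) + l ∧
        (x i' : ℕ) + l < R.hi t i' := fun i' =>
      exists_of_adjDiff_ne_zero hk (h.lo_ge ht.1 i') (h.interior t ht.1 i').1
        (h.interior t ht.1 i').2 (R.hi t i').isLt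
        (Finset.prod_ne_zero_iff.mp hi i' (Finset.mem_univ _))
    choose l hl using h2
    exact ⟨l, hl⟩
  choose! l hl using key
  have hcard : (Finset.univ : Finset (ι → Fin (k + 1))).card = (k + 1) ^ Fintype.card ι := by simp
  rw [← hcard]
  refine Finset.card_le_card_of_injOn l (fun _ _ => Finset.mem_univ _) fun t ht t' ht' e => ?_
  by_contra hne
  have h1 := hl t ht
  have h2 := hl t' ht'
  rw [Finset.mem_coe, Finset.mem_filter] at ht ht'
  rw [← e] at h2
  refine h.disjoint t ht.1 t' ht'.1 hne
    (fun i => ⟨(x i : ℕ) + l t i, (h1 i).2.trans (R.hi t i).isLt⟩) (fun i => ?_) fun i => ?_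
  · simpa [Fin.lt_def] using h1 i
  · have := h2 i
    simp only [Fin.le_def]
    omega

theorem norm_sq_sum_tileAdj_le (h : IsTessellation k S R) (hk : 1 ≤ k) {s : Idx n → ℝ}
    (hs : ∀ j, |s j| ≤ 1) :
    ‖∑ t ∈ S, s t • tileAdj k R t‖ ^ 2 ≤
      ((k : ℝ) + 1) ^ Fintype.card ι * ∑ t ∈ S, ‖tileAdj k R t‖ ^ 2 := by
  simp only [EuclideanSpace.norm_sq_eq, Real.norm_eq_abs, sq_abs]
  rw [Finset.sum_comm, Finset.mul_sum]
  refine Finset.sum_le_sum fun x _ => ?_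
  simp only [WithLp.ofLp_sum, Finset.sum_apply, PiLp.smul_apply, smul_eq_mul]
  set A := S.filter fun t => tileAdj k R t x ≠ 0
  have h1 : ∑ t ∈ S, s t * tileAdj k R t x = ∑ t ∈ A, s t * tileAdj k R t x := by
    symm
    refine Finset.sum_subset (Finset.filter_subset _ _) fun t ht hA => ?_
    have : tileAdj k R t x = 0 := by
      by_contra hc
      exact hA (Finset.mem_filter.mpr ⟨ht, hc⟩)
    rw [this, mul_zero]
  rw [h1]
  have hA : (A.card : ℝ) ≤ ((k : ℝ) + 1) ^ Fintype.card ι := by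
    have h2 : ((A.card : ℕ) : ℝ) ≤ (((k + 1) ^ Fintype.card ι : ℕ) : ℝ) :=
      Nat.cast_le.mpr (card_active_le h hk x)
    rwa [Nat.cast_pow, Nat.cast_add, Nat.cast_one] at h2
  calc (∑ t ∈ A, s t * tileAdj k R t x) ^ 2
      ≤ A.card * ∑ t ∈ A, (s t * tileAdj k R t x) ^ 2 := sq_sum_le_card_mul_sum_sq
    _ ≤ A.card * ∑ t ∈ A, (tileAdj k R t x) ^ 2 := by
        refine mul_le_mul_of_nonneg_left (Finset.sum_le_sum fun t _ => ?_) (Nat.cast_nonneg _)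
        rw [mul_pow]
        refine mul_le_of_le_one_left (sq_nonneg _) ?_
        rw [sq_le_one_iff_abs_le_one]
        exact hs t
    _ ≤ ((k : ℝ) + 1) ^ Fintype.card ι * ∑ t ∈ S, (tileAdj k R t x) ^ 2 := by
        refine mul_le_mul hA ?_ (Finset.sum_nonneg fun _ _ => sq_nonneg _) (by positivity)
        exact Finset.sum_le_sum_of_subset_of_nonneg (Finset.filter_subset _ _)
          fun _ _ _ => sq_nonneg _

/-- Cauchy–Schwarz costs the number of coordinates, less than what the squared averaging factor
gains. -/
theorem norm_sq_tileAdj_le [Nonempty ι] (t : Idx n) :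
    ‖tileAdj k R t‖ ^ 2 ≤ ∑ i, ∏ i', ‖adjDiff (n i') k (tileEdge k R t i i')‖ ^ 2 := by
  have hc : (1 : ℝ) ≤ Fintype.card ι := by exact_mod_cast Fintype.card_pos
  rw [tileAdj_eq, norm_smul, mul_pow, norm_inv, Real.norm_natCast]
  have h1 : ‖∑ i, (rankOne fun i' => adjDiff (n i') k (tileEdge k R t i i') : Tensor n)‖ ^ 2 ≤
      Fintype.card ι * ∑ i, ∏ i', ‖adjDiff (n i') k (tileEdge k R t i i')‖ ^ 2 := by
    refine (pow_le_pow_left₀ (norm_nonneg _) (norm_sum_le _ _) 2).trans ?_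
    refine sq_sum_le_card_mul_sum_sq.trans (le_of_eq ?_)
    simp only [norm_sq_rankOne, Finset.card_univ]
  have h0 : 0 ≤ ∑ i, ∏ i', ‖adjDiff (n i') k (tileEdge k R t i i')‖ ^ 2 :=
    Finset.sum_nonneg fun _ _ => Finset.prod_nonneg fun _ _ => sq_nonneg _
  refine (mul_le_mul_of_nonneg_left h1 (by positivity)).trans ?_
  rw [inv_pow, ← mul_assoc]
  refine mul_le_of_le_one_left h0 ?_
  rw [inv_mul_le_iff₀ (by positivity), mul_one, sq]
  exact le_mul_of_one_le_left (by positivity) hc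

theorem exists_interpolation_bound (k : ℕ) (hk : 1 ≤ k) :
    ∃ C : ℝ, 1 ≤ C ∧ ∀ {ι : Type} [Fintype ι] [DecidableEq ι] [Nonempty ι] {n : ι → ℕ}
      {S : Finset (Idx n)} {R : Rects n}, IsTessellation k S R →
      ∀ s : Idx n → ℝ, (∀ j, |s j| ≤ 1) →
      (size n : ℝ) * ‖∑ j ∈ diffIdx k n, signedWeight k S R s j •
        (rankOne fun i => diffVec (n i) k (j i) : Tensor n)‖ ^ 2 ≤
          C ^ Fintype.card ι * sparsityBound k S R := by
  obtain ⟨C, hC, hb⟩ := exists_adjDiff_bound k hk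
  refine ⟨(k + 1) * C, by nlinarith [(Nat.cast_nonneg k : (0 : ℝ) ≤ k)], ?_⟩
  intro ι _ _ _ n S R h s hs
  have hsum : ∑ j ∈ diffIdx k n, signedWeight k S R s j •
      (rankOne fun i => diffVec (n i) k (j i) : Tensor n) = ∑ t ∈ S, s t • tileAdj k R t := by
    simp only [signedWeight, Finset.sum_smul, tileAdj, Finset.smul_sum, mul_smul]
    rw [Finset.sum_comm]
  rw [hsum]
  set P : ℝ := ∏ i, ((n i : ℝ) ^ (k - 1)) ^ 2 with hP
  set L : ι → ℝ := fun i => Real.log (Real.exp 1 * (R.dmax k S i : ℝ)) with hL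
  have htile : ∀ t ∈ S, ‖tileAdj k R t‖ ^ 2 ≤ P * (C ^ Fintype.card ι * ((∑ i, L i) *
      ∑ z : ι → Bool, (1 / ∏ i, (R.dist k t i (z i) : ℝ)) ^ (2 * k - 1))) := by
    intro t ht
    refine (norm_sq_tileAdj_le t).trans ?_
    -- Multiplying out the two sides of every coordinate produces the sum over the sign vectors `z`.
    have hprod : ∏ i, ((1 / (R.dist k t i false : ℝ)) ^ (2 * k - 1) +
        (1 / (R.dist k t i true : ℝ)) ^ (2 * k - 1)) =
        ∑ z : ι → Bool, (1 / ∏ i, (R.dist k t i (z i) : ℝ)) ^ (2 * k - 1) := by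
      have e : ∀ i, (1 / (R.dist k t i false : ℝ)) ^ (2 * k - 1) +
          (1 / (R.dist k t i true : ℝ)) ^ (2 * k - 1) =
          ∑ b : Bool, (1 / (R.dist k t i b : ℝ)) ^ (2 * k - 1) := fun i => by
        rw [Fintype.sum_bool, add_comm]
      simp only [e]
      rw [Finset.prod_univ_sum, Fintype.piFinset_univ]
      refine Finset.sum_congr rfl fun z _ => ?_
      rw [Finset.prod_pow]
      simp
    rw [← hprod, Finset.sum_mul, Finset.mul_sum, Finset.mul_sum]
    refine Finset.sum_le_sum fun i _ => ?_
    have hone : ∀ i', ‖adjDiff (n i') k (tileEdge k R t i i')‖ ^ 2 ≤ ((n i' : ℝ) ^ (k - 1)) ^ 2 *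
        (C * (if i' = i then L i' else 1) * ((1 / (R.dist k t i' false : ℝ)) ^ (2 * k - 1) +
          (1 / (R.dist k t i' true : ℝ)) ^ (2 * k - 1))) := fun i' =>
      hb (n i') (t i') (R.lo t i') (R.hi t i') (R.dmax k S i') (i' = i) (h.lo_ge ht i')
        (h.interior t ht i').1 (h.interior t ht i').2 (R.hi t i').isLt
        (dist_le_dmax R ht i' false) (dist_le_dmax R ht i' true)
    -- In the `i`-th product only coordinate `i` carries a logarithm, so summing over `i` gives the
    -- sum of the `L i`.
    refine (Finset.prod_le_prod (fun _ _ => sq_nonneg _) fun i' _ => hone i').trans (le_of_eq ?_)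
    rw [Finset.prod_mul_distrib, Finset.prod_mul_distrib, Finset.prod_mul_distrib,
      Finset.prod_const, Finset.prod_ite_eq' Finset.univ i L, if_pos (Finset.mem_univ i),
      Finset.card_univ]
    ring
  have hscale : ∀ q : ℝ, (size n : ℝ) * P * (1 / q) ^ (2 * k - 1) =
      ((size n : ℝ) / q) ^ (2 * k - 1) := by
    intro q
    have e1 : P = ((size n : ℝ) ^ (k - 1)) ^ 2 := by
      rw [hP, Finset.prod_pow, Finset.prod_pow, size]
      push_cast
      rfl
    have e2 : (size n : ℝ) * ((size n : ℝ) ^ (k - 1)) ^ 2 = (size n : ℝ) ^ (2 * k - 1) := by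
      rw [← pow_mul, ← pow_succ']
      congr 1
      omega
    rw [e1, e2, ← mul_pow, mul_one_div]
  calc (size n : ℝ) * ‖∑ t ∈ S, s t • tileAdj k R t‖ ^ 2
      ≤ (size n : ℝ) * (((k : ℝ) + 1) ^ Fintype.card ι * ∑ t ∈ S,
        P * (C ^ Fintype.card ι * ((∑ i, L i) *
          ∑ z : ι → Bool, (1 / ∏ i, (R.dist k t i (z i) : ℝ)) ^ (2 * k - 1)))) := by
        gcongr
        refine (norm_sq_sum_tileAdj_le h hk hs).trans ?_
        gcongr with t ht
        exact htile t ht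
    _ = (((k : ℝ) + 1) * C) ^ Fintype.card ι * ((∑ i, L i) * ∑ t ∈ S, ∑ z : ι → Bool,
          (size n : ℝ) * P * (1 / ∏ i, (R.dist k t i (z i) : ℝ)) ^ (2 * k - 1)) := by
        rw [mul_pow]
        simp only [Finset.mul_sum]
        refine Finset.sum_congr rfl fun t _ => ?_
        refine Finset.sum_congr rfl fun z _ => ?_
        ring
    _ = _ := by simp only [hscale]; rfl

/-- Effective sparsity: outside the active set the differences may be discounted by any weights
`v` dominated by the normalized distances. -/
theorem effective_sparsity_le [Nonempty ι] (h : IsTessellation k S R) (hk : 1 ≤ k) {B : ℝ}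
    (hB : ∀ s : Idx n → ℝ, (∀ j, |s j| ≤ 1) →
      ‖∑ j ∈ diffIdx k n, signedWeight k S R s j •
        (rankOne fun i => diffVec (n i) k (j i) : Tensor n)‖ ≤ B)
    {v : Idx n → ℝ} (hv : ∀ j ∈ diffIdx k n \ S, ∃ t ∈ S, R.Mem t j ∧
      v j ≤ (Fintype.card ι : ℝ)⁻¹ *
        ∑ i, ((gap k (t i) (j i) : ℝ) / R.dmax k S i) ^ ((k : ℝ) - 1 / 2)) (Δ : Tensor n) :
    ∑ j ∈ S, |diffOp k Δ j| - ∑ j ∈ diffIdx k n \ S, (1 - v j) * |diffOp k Δ j| ≤ B * ‖Δ‖ := by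
  -- With these signs the interpolating tensor turns the differences on `S` into their absolute
  -- values, while elsewhere it is at most `1 - v`. The pairing with the differences is then moved
  -- to the adjoint.
  set s : Idx n → ℝ := fun j => SignType.sign (diffOp k Δ j) with hs
  have hs1 : ∀ j, |s j| ≤ 1 := fun j => by
    simp only [hs]
    rcases lt_trichotomy (diffOp k Δ j) 0 with h | h | h <;> simp [h]
  have hSsub : S ⊆ diffIdx k n := fun t ht => h.mem_diffIdx ht
  have h1 : ∑ j ∈ diffIdx k n, signedWeight k S R s j * diffOp k Δ j ≤ B * ‖Δ‖ := by
    have e : ∑ j ∈ diffIdx k n, signedWeight k S R s j * diffOp k Δ j =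
        inner ℝ (∑ j ∈ diffIdx k n, signedWeight k S R s j •
          (rankOne fun i => diffVec (n i) k (j i) : Tensor n)) Δ := by
      rw [sum_inner]
      refine Finset.sum_congr rfl fun j hj => ?_
      rw [inner_smul_left, diffOp_eq_inner _ (TensorTF.mem_diffIdx.mp hj)]
      rfl
    rw [e]
    refine (real_inner_le_norm _ _).trans ?_
    exact mul_le_mul_of_nonneg_right (hB s hs1) (norm_nonneg _)
  refine le_trans ?_ h1
  rw [← Finset.sum_sdiff hSsub, sub_eq_neg_add, ← Finset.sum_neg_distrib]
  refine add_le_add (Finset.sum_le_sum fun j hj => ?_) (Finset.sum_le_sum fun j hj => ?_)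
  · obtain ⟨t, ht, hm, hvt⟩ := hv j hj
    have h2 := abs_signedWeight_le h hk hs1 ht hm
    have h3 : |signedWeight k S R s j| * |diffOp k Δ j| ≤ (1 - v j) * |diffOp k Δ j| :=
      mul_le_mul_of_nonneg_right (by linarith) (abs_nonneg _)
    rw [← abs_mul] at h3
    linarith [neg_abs_le (signedWeight k S R s j * diffOp k Δ j)]
  · rw [signedWeight_self h hk s hj]
    simp only [hs]
    rw [sign_mul_self]

end Interpolation

/-! ### Approximation of the atoms by the active ones -/

/-- Exchange the factors one at a time; all of them lie in `[0, 1]`. -/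
theorem prod_sub_prod_le_sum {ι : Type*} (s : Finset ι) {a b : ι → ℝ} (hb : ∀ i ∈ s, 0 ≤ b i)
    (hab : ∀ i ∈ s, b i ≤ a i) (ha : ∀ i ∈ s, a i ≤ 1) :
    ∏ i ∈ s, a i - ∏ i ∈ s, b i ≤ ∑ i ∈ s, (a i - b i) := by
  classical
  induction s using Finset.induction_on with
  | empty => simp
  | insert i s hi ih =>
    rw [Finset.prod_insert hi, Finset.prod_insert hi, Finset.sum_insert hi]
    have h1 := ih (fun i hi => hb i (Finset.mem_insert_of_mem hi))
      (fun i hi => hab i (Finset.mem_insert_of_mem hi))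
      fun i hi => ha i (Finset.mem_insert_of_mem hi)
    have hp : ∏ i ∈ s, b i ≤ 1 := Finset.prod_le_one
      (fun i hi => hb i (Finset.mem_insert_of_mem hi))
      fun i h => (hab i (Finset.mem_insert_of_mem h)).trans (ha i (Finset.mem_insert_of_mem h))
    have hp0 : ∏ i ∈ s, b i ≤ ∏ i ∈ s, a i := Finset.prod_le_prod
      (fun i hi => hb i (Finset.mem_insert_of_mem hi))
      fun i hi => hab i (Finset.mem_insert_of_mem hi)
    have h2 := hb i (Finset.mem_insert_self i s)
    have h3 := hab i (Finset.mem_insert_self i s)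
    have h4 := ha i (Finset.mem_insert_self i s)
    nlinarith [mul_nonneg (sub_nonneg.mpr h4) (sub_nonneg.mpr hp0),
      mul_nonneg (sub_nonneg.mpr h3) (sub_nonneg.mpr hp)]

section Approximation

variable {ι : Type} [Fintype ι] [DecidableEq ι] {k : ℕ} {n : ι → ℕ}

/-- Span of the tensor atoms in the enlarged jump location of `t`. -/
def jumpTensorSpan (k : ℕ) (n : ι → ℕ) (t : ι → ℕ) : Submodule ℝ (Tensor n) :=
  Submodule.span ℝ (Set.range fun l : ι → Fin k => tensorAtom k n fun i => t i + l i)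

theorem rankOne_mem_jumpTensorSpan {t : ι → ℕ} {b : (i : ι) → EuclideanSpace ℝ (Fin (n i))}
    (hb : ∀ i, b i ∈ jumpSpan (n i) k (t i)) : rankOne b ∈ jumpTensorSpan k n t := by
  have h1 : ∀ i, ∃ c : Fin k → ℝ, ∑ l, c l • orthoAtom (n i) k (t i + l) = b i := fun i =>
    (Submodule.mem_span_range_iff_exists_fun ℝ).mp (hb i)
  choose c hc using h1
  refine (Submodule.mem_span_range_iff_exists_fun ℝ).mpr ⟨fun l => ∏ i, c i (l i), ?_⟩
  ext x
  simp only [WithLp.ofLp_sum, Finset.sum_apply, PiLp.smul_apply, smul_eq_mul, tensorAtom, rankOne,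
    ← hc, Finset.prod_univ_sum, Fintype.piFinset_univ, Finset.prod_mul_distrib]

/-- The approximant is the product of the one-dimensional projections. As `⟨a i, b i⟩ = ‖b i‖²`, the
squared distance is a difference of two products of squared norms. After dividing each factor by `n
i ≥ ‖a i‖²`, this is at most a sum of one-dimensional squared distances. -/
theorem exists_jumpTensorSpan_approx (hk : 1 ≤ k) {t j : Idx n} (ht : ∀ i, k ≤ (t i : ℕ))
    (hj : ∀ i, k ≤ (j i : ℕ)) : ∃ w ∈ jumpTensorSpan k n (fun i => t i),
      ‖(tensorAtom k n fun i => j i) - w‖ ^ 2 ≤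
        (size n : ℝ) * ∑ i, ((gap k (t i) (j i) : ℝ) / n i) ^ (2 * k - 1) := by
  set a : (i : ι) → EuclideanSpace ℝ (Fin (n i)) := fun i => orthoAtom (n i) k (j i) with ha
  set b : (i : ι) → EuclideanSpace ℝ (Fin (n i)) :=
    fun i => (jumpSpan (n i) k (t i)).starProjection (a i) with hb
  refine ⟨rankOne b, rankOne_mem_jumpTensorSpan fun i => Submodule.starProjection_apply_mem _ _, ?_⟩
  have horth : ∀ i, (inner ℝ (a i) (b i) : ℝ) = ‖b i‖ ^ 2 := fun i => by
    have := Submodule.starProjection_inner_eq_zero (K := jumpSpan (n i) k (t i)) (a i) (b i)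
      (Submodule.starProjection_apply_mem _ _)
    rw [inner_sub_left, sub_eq_zero] at this
    rw [this, real_inner_self_eq_norm_sq]
  have hn : ∀ i, (0 : ℝ) < n i := fun i => by exact_mod_cast (Fin.pos (j i))
  have hdiff : ∀ i, ‖a i‖ ^ 2 - ‖b i‖ ^ 2 = ‖a i - b i‖ ^ 2 := fun i => by
    rw [norm_sub_sq_real, horth]
    ring
  have h1 : ‖(tensorAtom k n fun i => j i) - rankOne b‖ ^ 2 = ∏ i, ‖a i‖ ^ 2 - ∏ i, ‖b i‖ ^ 2 := by
    rw [tensorAtom_eq_rankOne, norm_sub_sq_real, inner_rankOne, norm_sq_rankOne, norm_sq_rankOne,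
      Finset.prod_congr rfl fun i _ => horth i]
    ring
  have hscale : ∀ c : (i : ι) → EuclideanSpace ℝ (Fin (n i)),
      ∏ i, ‖c i‖ ^ 2 = (size n : ℝ) * ∏ i, (‖c i‖ ^ 2 / n i) := fun c => by
    rw [size, Nat.cast_prod, ← Finset.prod_mul_distrib]
    exact Finset.prod_congr rfl fun i _ => by field_simp [(hn i).ne']
  rw [h1, hscale a, hscale b, ← mul_sub]
  refine mul_le_mul_of_nonneg_left ?_ (Nat.cast_nonneg _)
  refine (prod_sub_prod_le_sum _ (fun i _ => by positivity) (fun i _ => ?_) fun i _ => ?_).trans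
    (Finset.sum_le_sum fun i _ => ?_)
  · have := hdiff i
    have := hn i
    gcongr ?_ / _
    nlinarith [sq_nonneg ‖a i - b i‖]
  · rw [div_le_one (hn i)]
    exact norm_orthoAtom_le hk (j i).isLt
  · rw [← sub_div, hdiff, div_le_iff₀ (hn i), mul_comm]
    exact norm_orthoAtom_sub_le hk (ht i) (hj i) (j i).isLt

/-- A tuning parameter of the order of `scaling` dominates the noise outside the active set. -/
theorem noise_weight_le [Nonempty ι] (hk : 1 ≤ k) {S : Finset (Idx n)} {R : Rects n}
    (hd : ∀ i, 0 < R.dmax k S i) {c ell lam : ℝ} (hc : 1 ≤ c) (hell : 0 ≤ ell)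
    (hlam : c * scaling k S R * ell ≤ lam) (q : ι → ℕ) :
    ell * √(∑ i, ((q i : ℝ) / n i) ^ (2 * k - 1)) ≤ lam * ((Fintype.card ι : ℝ)⁻¹ *
      ∑ i, ((q i : ℝ) / R.dmax k S i) ^ ((k : ℝ) - 1 / 2)) := by
  have hcard : (0 : ℝ) < Fintype.card ι := by exact_mod_cast Fintype.card_pos
  set r : ι → ℝ := fun i => ((q i : ℝ) / R.dmax k S i) ^ ((k : ℝ) - 1 / 2) with hr
  set T : ℝ := ∑ i, ((R.dmax k S i : ℝ) / n i) ^ (2 * k - 1) with hT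
  have hr0 : ∀ i, 0 ≤ r i := fun i => by positivity
  have hT0 : 0 ≤ T := Finset.sum_nonneg fun i _ => by positivity
  have hterm : ∀ i, ((q i : ℝ) / n i) ^ (2 * k - 1) =
      r i ^ 2 * ((R.dmax k S i : ℝ) / n i) ^ (2 * k - 1) := fun i => by
    have hd' : (0 : ℝ) < R.dmax k S i := by exact_mod_cast hd i
    have e : r i ^ 2 = ((q i : ℝ) / R.dmax k S i) ^ (2 * k - 1) := by
      rw [hr, ← Real.rpow_natCast, ← Real.rpow_natCast, ← Real.rpow_mul (by positivity)]
      congr 1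
      rw [Nat.cast_sub (by omega)]
      push_cast
      ring
    rw [e, ← mul_pow, div_mul_div_cancel₀ hd'.ne']
  -- Each `r i` is bounded by the sum of all. The average over the coordinates on the right then
  -- loses a factor equal to their number, which `scaling` contains.
  have h1 : √(∑ i, ((q i : ℝ) / n i) ^ (2 * k - 1)) ≤ (∑ i, r i) * √T := by
    rw [Real.sqrt_le_left (mul_nonneg (Finset.sum_nonneg fun i _ => hr0 i) (Real.sqrt_nonneg _)),
      mul_pow, Real.sq_sqrt hT0, Finset.mul_sum]
    refine Finset.sum_le_sum fun i _ => ?_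
    rw [hterm]
    gcongr
    exact Finset.single_le_sum (fun i _ => hr0 i) (Finset.mem_univ i)
  have hs0 : 0 ≤ scaling k S R := by unfold scaling; positivity
  have h2 : scaling k S R * ell ≤ lam := by
    refine le_trans ?_ hlam
    rw [mul_assoc]
    exact le_mul_of_one_le_left (mul_nonneg hs0 hell) hc
  calc ell * √(∑ i, ((q i : ℝ) / n i) ^ (2 * k - 1)) ≤ ell * ((∑ i, r i) * √T) := by gcongr
    _ = scaling k S R * ell * ((Fintype.card ι : ℝ)⁻¹ * ∑ i, r i) := by
        rw [scaling]
        field_simp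
        rfl
    _ ≤ _ := by
        refine mul_le_mul_of_nonneg_right h2 ?_
        exact mul_nonneg (by positivity) (Finset.sum_nonneg fun i _ => hr0 i)

end Approximation

section Active

variable {d k : ℕ} {n : Fin d → ℕ}

/-- The space spanned by the atoms in the enlarged jump locations of all margins. -/
def activeSpace (k : ℕ) (n : Fin d → ℕ) (A : (p : Margin d k) → Finset (Idx (sides n p.1))) :
    Submodule ℝ (Tensor n) :=
  Submodule.span ℝ (Set.range fun v : Σ p : Margin d k, A p × (p.1 → Fin k) =>
    lift k v.1.1 v.1.2 (tensorAtom k (sides n v.1.1) fun i => v.2.1.1 i + v.2.2 i))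

theorem finrank_activeSpace_le (A : (p : Margin d k) → Finset (Idx (sides n p.1))) :
    Module.finrank ℝ (activeSpace k n A) ≤ ∑ p : Margin d k, (A p).card * k ^ p.1.card := by
  refine (finrank_range_le_card _).trans (le_of_eq ?_)
  simp [Fintype.card_sigma]

theorem lift_mem_activeSpace {A : (p : Margin d k) → Finset (Idx (sides n p.1))} {p : Margin d k}
    {t : Idx (sides n p.1)} (ht : t ∈ A p) {w : Tensor (sides n p.1)}
    (hw : w ∈ jumpTensorSpan k (sides n p.1) fun i => t i) :
    lift k p.1 p.2 w ∈ activeSpace k n A := by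
  have h : (jumpTensorSpan k (sides n p.1) fun i => (t i : ℕ)).map (liftLin p.1 p.2) ≤
      activeSpace k n A := by
    rw [jumpTensorSpan, Submodule.map_span, Submodule.span_le]
    rintro _ ⟨_, ⟨l, rfl⟩, rfl⟩
    exact Submodule.subset_span ⟨⟨p, ⟨t, ht⟩, l⟩, rfl⟩
  exact h (Submodule.mem_map_of_mem hw)

theorem tensorAtom_mem_activeSpace (hk : 1 ≤ k)
    {A : (p : Margin d k) → Finset (Idx (sides n p.1))} {p : Margin d k}
    {t : Idx (sides n p.1)} (ht : t ∈ A p) :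
    lift k p.1 p.2 (tensorAtom k (sides n p.1) fun i => t i) ∈ activeSpace k n A :=
  lift_mem_activeSpace ht (Submodule.subset_span ⟨fun _ => ⟨0, hk⟩, rfl⟩)

theorem norm_sub_starProjection_le {E : Type*} [NormedAddCommGroup E] [InnerProductSpace ℝ E]
    (V : Submodule ℝ E) [V.HasOrthogonalProjection] (a : E) {w : E} (hw : w ∈ V) :
    ‖a - V.starProjection a‖ ≤ ‖a - w‖ := by
  rw [Submodule.starProjection_minimal]
  exact ciInf_le ⟨0, by rintro _ ⟨_, rfl⟩; exact norm_nonneg _⟩ (⟨w, hw⟩ : V)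

/-- Lifting multiplies squared norms by `outSize`, which completes the size of the margin to the
full size. -/
theorem norm_sq_sub_activeSpace_le (hk : 1 ≤ k) (hn : ∀ i, k + 1 ≤ n i)
    {A : (p : Margin d k) → Finset (Idx (sides n p.1))} {p : Margin d k}
    {t j : Idx (sides n p.1)} (htA : t ∈ A p) (ht : ∀ i, k ≤ (t i : ℕ)) (hj : ∀ i, k ≤ (j i : ℕ)) :
    ‖lift k p.1 p.2 (tensorAtom k (sides n p.1) fun i => j i) -
      (activeSpace k n A).starProjection
        (lift k p.1 p.2 (tensorAtom k (sides n p.1) fun i => j i))‖ ^ 2 ≤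
      (size n : ℝ) * ∑ i : p.1, ((gap k (t i) (j i) : ℝ) / n i) ^ (2 * k - 1) := by
  obtain ⟨w, hw, hle⟩ := exists_jumpTensorSpan_approx hk ht hj
  have h1 := norm_sub_starProjection_le (activeSpace k n A)
    (lift k p.1 p.2 (tensorAtom k (sides n p.1) fun i => j i)) (lift_mem_activeSpace htA hw)
  refine (pow_le_pow_left₀ (norm_nonneg _) h1 2).trans ?_
  rw [← lift_sub, norm_sq_lift hn, ← outSize_mul_size n p.1, mul_assoc]
  exact mul_le_mul_of_nonneg_left hle (outSize_pos hn p.1).le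

end Active

/-! ### Deterministic oracle inequalities -/

section Basic

variable {ι : Type} [Fintype ι] [DecidableEq ι] {k : ℕ} {n : ι → ℕ}

theorem vitaliTV_segment_le (F G : Tensor n) {s : ℝ} (hs : 0 ≤ s) (hs1 : s ≤ 1) :
    vitaliTV k (F + s • (G - F)) ≤ vitaliTV k F + s * (vitaliTV k G - vitaliTV k F) := by
  have h : vitaliTV k F + s * (vitaliTV k G - vitaliTV k F) =
      ∑ j ∈ diffIdx k n, ((1 - s) * |diffOp k F j| + s * |diffOp k G j|) := by
    simp only [vitaliTV, Finset.sum_add_distrib, ← Finset.mul_sum]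
    ring
  rw [h]
  refine Finset.sum_le_sum fun j hj => ?_
  rw [diffOp_add _ _ hj, diffOp_smul _ _ hj, diffOp_sub _ _ hj]
  have e : diffOp k F j + s * (diffOp k G j - diffOp k F j) =
      (1 - s) * diffOp k F j + s * diffOp k G j := by ring
  rw [e]
  refine (abs_add_le _ _).trans (le_of_eq ?_)
  rw [abs_mul, abs_mul, abs_of_nonneg hs, abs_of_nonneg (sub_nonneg.mpr hs1)]

/-- Compare `F` with points of the segment towards `G`: the penalty is convex, the loss exactly
quadratic. Letting the step tend to zero yields the additional `‖F - G‖ ^ 2`, which plain minimality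
does not give. -/
theorem minimizer_basic_inequality (hn : 0 < size n) {lam : ℝ} (hlam : 0 ≤ lam) {Y F : Tensor n}
    (hF : ∀ G, objective k lam Y F ≤ objective k lam Y G) (G : Tensor n) :
    ‖Y - F‖ ^ 2 + ‖F - G‖ ^ 2 ≤
      ‖Y - G‖ ^ 2 + 2 * lam * size n * (vitaliTV k G - vitaliTV k F) := by
  have hs : (0 : ℝ) < size n := by exact_mod_cast hn
  set D := ‖F - G‖ ^ 2 with hD
  have hexp : ∀ s : ℝ, ‖Y - (F + s • (G - F))‖ ^ 2 =
      ‖Y - F‖ ^ 2 - 2 * s * inner ℝ (Y - F) (G - F) + s ^ 2 * D := fun s => by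
    rw [← sub_sub, norm_sub_sq_real, inner_smul_right, norm_smul, mul_pow, Real.norm_eq_abs,
      sq_abs, hD, norm_sub_rev F G]
    ring
  set a : ℝ := 2 * inner ℝ (Y - F) (G - F) - 2 * lam * size n * (vitaliTV k G - vitaliTV k F)
    with ha
  have key : ∀ s : ℝ, 0 < s → s ≤ 1 → a ≤ s * D := fun s h0 h1 => by
    have h2 := hF (F + s • (G - F))
    rw [objective, objective, hexp] at h2
    have h3 := mul_le_mul_of_nonneg_left (vitaliTV_segment_le (k := k) F G h0.le h1)
      (mul_nonneg zero_le_two hlam)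
    have h4 : ‖Y - F‖ ^ 2 / (size n : ℝ) ≤
        (‖Y - F‖ ^ 2 - 2 * s * inner ℝ (Y - F) (G - F) + s ^ 2 * D) / size n +
        2 * lam * (s * (vitaliTV k G - vitaliTV k F)) := by linarith
    rw [div_add' _ _ _ hs.ne', div_le_div_iff_of_pos_right hs] at h4
    have h5 : s * a ≤ s * (s * D) := by
      rw [ha]
      linarith
    exact le_of_mul_le_mul_left h5 h0
  have h0 : a ≤ 0 := by
    by_contra hc
    push Not at hc
    have hD0 : 0 ≤ D := sq_nonneg _
    -- If `a` were positive, this step length `s` would satisfy `s * D < a`, contradicting `key`.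
    have h1 := key (a / (a + D)) (by positivity) (by rw [div_le_one (by positivity)]; linarith)
    rw [div_mul_eq_mul_div, le_div_iff₀ (by positivity)] at h1
    nlinarith
  have h1 := hexp 1
  rw [one_smul, add_sub_cancel] at h1
  rw [h1]
  linarith

theorem vitaliTV_sub_le {S : Finset (Idx n)} (hS : S ⊆ diffIdx k n) (F G : Tensor n) :
    vitaliTV k G - vitaliTV k F ≤ 2 * vitaliTVOff k S G + ∑ j ∈ S, |diffOp k (F - G) j| -
      ∑ j ∈ diffIdx k n \ S, |diffOp k (F - G) j| := by
  rw [vitaliTV, vitaliTV, vitaliTVOff, ← Finset.sum_sdiff hS, ← Finset.sum_sdiff hS]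
  have h1 : ∑ j ∈ S, |diffOp k G j| ≤
      ∑ j ∈ S, |diffOp k F j| + ∑ j ∈ S, |diffOp k (F - G) j| := by
    rw [← Finset.sum_add_distrib]
    refine Finset.sum_le_sum fun j hj => ?_
    rw [diffOp_sub _ _ (hS hj)]
    have := abs_sub_abs_le_abs_sub (diffOp k G j) (diffOp k F j)
    rw [abs_sub_comm] at this
    linarith
  have h2 : ∑ j ∈ diffIdx k n \ S, |diffOp k (F - G) j| ≤
      ∑ j ∈ diffIdx k n \ S, |diffOp k F j| + ∑ j ∈ diffIdx k n \ S, |diffOp k G j| := by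
    rw [← Finset.sum_add_distrib]
    refine Finset.sum_le_sum fun j hj => ?_
    rw [diffOp_sub _ _ (Finset.mem_sdiff.mp hj).1]
    exact abs_sub _ _
  linarith

theorem IsSuitable.dmax_pos {S : Finset (Idx n)} {R : Rects n} (h : IsSuitable k S R) (hk : 1 ≤ k)
    (hS : S.Nonempty) (i : ι) : 0 < R.dmax k S i := by
  obtain ⟨t, ht⟩ := hS
  have h1 := h.dist_ge t ht i false
  have h2 := dist_le_dmax (k := k) R ht i false
  nlinarith

theorem IsSuitable.nonempty {S : Finset (Idx n)} {R : Rects n} (h : IsSuitable k S R)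
    (hn : ∀ i, k + 1 ≤ n i) : S.Nonempty := by
  obtain ⟨t, ht, -⟩ := h.cover (fun i => ⟨k, hn i⟩) fun i => le_rfl
  exact ⟨t, ht⟩

/-- The remainder term dominates the variance of the estimated jumps. -/
theorem card_le_sq_mul_sparsityBound [Nonempty ι] (hk : 1 ≤ k) {S : Finset (Idx n)} {R : Rects n}
    (h : IsSuitable k S R) (hS : S.Nonempty) {c ell lam : ℝ} (hc : 1 ≤ c) (hell : 0 ≤ ell)
    (hlam : c * scaling k S R * ell ≤ lam) :
    ell ^ 2 * S.card ≤ lam ^ 2 * sparsityBound k S R := by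
  have hcard : (1 : ℝ) ≤ Fintype.card ι := by exact_mod_cast Fintype.card_pos
  set T : ℝ := ∑ i, ((R.dmax k S i : ℝ) / n i) ^ (2 * k - 1) with hT
  have hT0 : 0 ≤ T := Finset.sum_nonneg fun i _ => by positivity
  have h1 : T * ell ^ 2 ≤ lam ^ 2 := by
    have h2 : √T * ell ≤ lam := by
      refine le_trans ?_ hlam
      refine mul_le_mul_of_nonneg_right ?_ hell
      rw [scaling, ← mul_assoc]
      exact le_mul_of_one_le_left (Real.sqrt_nonneg _) (one_le_mul_of_one_le_of_one_le hc hcard)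
    have h3 := pow_le_pow_left₀ (by positivity) h2 2
    rwa [mul_pow, Real.sq_sqrt hT0] at h3
  obtain ⟨i₀⟩ := ‹Nonempty ι›
  -- In one coordinate `i₀` the factor `dmax / n` compensates `n / dist`; in all other coordinates
  -- `n / dist ≥ 1`.
  have hterm : ∀ t ∈ S, 1 ≤ T * ((size n : ℝ) / ∏ i, (R.dist k t i false : ℝ)) ^ (2 * k - 1) := by
    intro t ht
    have hpos : ∀ i, (0 : ℝ) < R.dist k t i false := fun i => by
      have := h.dist_ge t ht i false
      have : 0 < R.dist k t i false := by nlinarith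
      exact_mod_cast this
    have hn : ∀ i, (0 : ℝ) < n i := fun i => by exact_mod_cast Fin.pos (t i)
    have hle : ∀ i, (R.dist k t i false : ℝ) ≤ n i := fun i => by
      have : R.dist k t i false ≤ n i := by
        simp only [Rects.dist, Bool.false_eq_true, if_false]
        omega
      exact_mod_cast this
    have hmax : (R.dist k t i₀ false : ℝ) ≤ R.dmax k S i₀ := by
      exact_mod_cast dist_le_dmax R ht i₀ false
    have h2 : ((R.dmax k S i₀ : ℝ) / n i₀) ^ (2 * k - 1) ≤ T :=
      Finset.single_le_sum (f := fun i => ((R.dmax k S i : ℝ) / n i) ^ (2 * k - 1))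
        (fun i _ => by positivity) (Finset.mem_univ i₀)
    refine le_trans ?_ (mul_le_mul_of_nonneg_right h2 (by positivity))
    rw [← mul_pow]
    refine one_le_pow₀ ?_
    rw [div_mul_div_comm, one_le_div (mul_pos (hn i₀) (Finset.prod_pos fun i _ => hpos i)), size,
      Nat.cast_prod, ← Finset.mul_prod_erase _ _ (Finset.mem_univ i₀),
      ← Finset.mul_prod_erase _ (fun i => (n i : ℝ)) (Finset.mem_univ i₀), mul_left_comm]
    refine mul_le_mul hmax ?_ (by positivity) (Nat.cast_nonneg _)
    refine mul_le_mul_of_nonneg_left ?_ (hn i₀).le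
    exact Finset.prod_le_prod (fun i _ => (hpos i).le) fun i _ => hle i
  have hlog : 1 ≤ ∑ i, Real.log (Real.exp 1 * (R.dmax k S i : ℝ)) := by
    have h2 : ∀ i, 1 ≤ Real.log (Real.exp 1 * (R.dmax k S i : ℝ)) := fun i => by
      have h3 : (1 : ℝ) ≤ R.dmax k S i := by exact_mod_cast h.dmax_pos hk hS i
      rw [Real.log_mul (Real.exp_pos 1).ne' (by positivity), Real.log_exp]
      linarith [Real.log_nonneg h3]
    exact (h2 i₀).trans (Finset.single_le_sum
      (f := fun i => Real.log (Real.exp 1 * (R.dmax k S i : ℝ)))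
      (fun i _ => zero_le_one.trans (h2 i)) (Finset.mem_univ i₀))
  have hsum : (S.card : ℝ) ≤ T * sparsityBound k S R := by
    rw [sparsityBound, mul_left_comm]
    refine le_trans ?_ (le_mul_of_one_le_left (mul_nonneg hT0 (Finset.sum_nonneg fun t _ =>
      Finset.sum_nonneg fun z _ => by positivity)) hlog)
    rw [Finset.mul_sum, Finset.card_eq_sum_ones, Nat.cast_sum]
    refine Finset.sum_le_sum fun t ht => ?_
    rw [Nat.cast_one]
    refine (hterm t ht).trans (mul_le_mul_of_nonneg_left ?_ hT0)
    exact Finset.single_le_sum (f := fun z : ι → Bool =>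
      ((size n : ℝ) / ∏ i, (R.dist k t i (z i) : ℝ)) ^ (2 * k - 1))
      (fun z _ => by positivity) (Finset.mem_univ fun _ => false)
  have hsp : 0 ≤ sparsityBound k S R := by
    rw [sparsityBound]
    exact mul_nonneg (zero_le_one.trans hlog) (Finset.sum_nonneg fun t _ =>
      Finset.sum_nonneg fun z _ => by positivity)
  nlinarith [mul_le_mul_of_nonneg_left hsum (sq_nonneg ell), mul_le_mul_of_nonneg_right h1 hsp]

end Basic

section MarginOracle

variable {d k : ℕ} {n : Fin d → ℕ}

theorem inner_sub_starProjection {E : Type*} [NormedAddCommGroup E] [InnerProductSpace ℝ E]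
    (V : Submodule ℝ E) [V.HasOrthogonalProjection] (a e : E) :
    (inner ℝ (a - V.starProjection a) e : ℝ) = inner ℝ a (e - V.starProjection e) := by
  rw [inner_sub_left, inner_sub_right, Submodule.inner_starProjection_left_eq_right]

/-- Oracle inequality for one margin, up to the noise in the active space. -/
theorem margin_oracle (hk : 1 ≤ k) (hn : ∀ i, k + 1 ≤ n i)
    {A : (p : Margin d k) → Finset (Idx (sides n p.1))} {p : Margin d k} (hM : p.1.Nonempty)
    {R : Rects (sides n p.1)} (hS : IsSuitable k (A p) R) {C c ell lam : ℝ}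
    (hC : ∀ s : Idx (sides n p.1) → ℝ, (∀ j, |s j| ≤ 1) →
      (size (sides n p.1) : ℝ) * ‖∑ j ∈ diffIdx k (sides n p.1), signedWeight k (A p) R s j •
        (rankOne fun i => diffVec (sides n p.1 i) k (j i) : Tensor (sides n p.1))‖ ^ 2 ≤
          C * sparsityBound k (A p) R)
    (hc : 1 ≤ c) (hell : 0 ≤ ell) (hlam0 : 0 < lam)
    (hlam : c * scaling k (A p) R * ell ≤ lam) {f0 g e : Tensor n} {F : Tensor (sides n p.1)}
    (hF : ∀ G, objective k lam (bar k p.1 p.2 (f0 + e)) F ≤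
      objective k lam (bar k p.1 p.2 (f0 + e)) G)
    (hnoise : ∀ j : Idx (sides n p.1),
      |(inner ℝ (lift k p.1 p.2 (tensorAtom k (sides n p.1) fun i => j i) -
        (activeSpace k n A).starProjection
          (lift k p.1 p.2 (tensorAtom k (sides n p.1) fun i => j i))) e : ℝ)| ≤
        √(size n : ℝ) * ell * ‖lift k p.1 p.2 (tensorAtom k (sides n p.1) fun i => j i) -
        (activeSpace k n A).starProjection
          (lift k p.1 p.2 (tensorAtom k (sides n p.1) fun i => j i))‖) :
    outSize n p.1 * ‖F - bar k p.1 p.2 f0‖ ^ 2 +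
        3 / 4 * (outSize n p.1 * ‖F - bar k p.1 p.2 g‖ ^ 2) ≤
      outSize n p.1 * ‖bar k p.1 p.2 g - bar k p.1 p.2 f0‖ ^ 2 +
      2 * (inner ℝ ((activeSpace k n A).starProjection e)
        (lift k p.1 p.2 (F - bar k p.1 p.2 g)) : ℝ) +
      size n * (4 * (lam * vitaliTVOff k (A p) (bar k p.1 p.2 g)) +
        4 * C * (lam ^ 2 * sparsityBound k (A p) R)) := by
  obtain ⟨M, h⟩ := p
  dsimp only at *
  have : Nonempty M := hM.to_subtype
  set P := (activeSpace k n A).starProjection with hP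
  set o := outSize n M with ho
  set N' : ℝ := (size (sides n M) : ℝ) with hN'
  have hopos : 0 < o := outSize_pos hn M
  have hsz : 0 < size (sides n M) :=
    Finset.prod_pos fun i _ => (Nat.succ_pos k).trans_le (hn i)
  have hN'pos : 0 < N' := Nat.cast_pos.mpr hsz
  have hoN : o * N' = size n := outSize_mul_size n M
  have hNpos : (0 : ℝ) < size n := hoN ▸ mul_pos hopos hN'pos
  set f0' := bar k M h f0
  set g' := bar k M h g
  set e' := bar k M h e
  rw [bar_add hn] at hF
  have hFcore : F ∈ coreSpace k (sides n M) := minimizer_mem_coreSpace hk hsz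
    (Submodule.add_mem _ (bar_mem hn M h f0) (bar_mem hn M h e)) hF
  set Δ := F - g' with hΔ
  have hΔcore : Δ ∈ coreSpace k (sides n M) := Submodule.sub_mem _ hFcore (bar_mem hn M h g)
  -- basic inequality
  have hbasic := minimizer_basic_inequality hsz hlam0.le hF g'
  have hbasic2 : ‖F - f0'‖ ^ 2 + ‖Δ‖ ^ 2 ≤ ‖g' - f0'‖ ^ 2 + 2 * inner ℝ e' Δ +
      2 * lam * N' * (vitaliTV k g' - vitaliTV k F) := by
    have e1 : ‖f0' + e' - F‖ ^ 2 = ‖F - f0'‖ ^ 2 - 2 * inner ℝ e' (F - f0') + ‖e'‖ ^ 2 := by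
      rw [show f0' + e' - F = e' - (F - f0') by abel, norm_sub_sq_real]
      ring
    have e2 : ‖f0' + e' - g'‖ ^ 2 = ‖g' - f0'‖ ^ 2 - 2 * inner ℝ e' (g' - f0') + ‖e'‖ ^ 2 := by
      rw [show f0' + e' - g' = e' - (g' - f0') by abel, norm_sub_sq_real]
      ring
    have e3 : (inner ℝ e' Δ : ℝ) = inner ℝ e' (F - f0') - inner ℝ e' (g' - f0') := by
      rw [← inner_sub_right]
      congr 1
      rw [hΔ]
      abel
    rw [e1, e2] at hbasic
    rw [e3]
    linarith
  -- noise outside the active space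
  set b : Idx (sides n M) → Tensor n := fun j => lift k M h (tensorAtom k (sides n M) fun i => j i)
    with hb
  -- `v j` is the share of the penalty at `j` that the residual noise uses up. It vanishes on the
  -- active set, whose atoms lie in the active space.
  set v : Idx (sides n M) → ℝ := fun j => |(inner ℝ (b j - P (b j)) e : ℝ)| / (size n * lam)
    with hv
  have hvS : ∀ j ∈ A ⟨M, h⟩, v j = 0 := fun j hj => by
    have hmem : b j ∈ activeSpace k n A := tensorAtom_mem_activeSpace hk hj
    simp only [hv, hP, Submodule.starProjection_eq_self_iff.mpr hmem, sub_self, inner_zero_left,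
      abs_zero, zero_div]
  have hvoff : ∀ j ∈ diffIdx k (sides n M) \ A ⟨M, h⟩, ∃ t ∈ A ⟨M, h⟩, R.Mem t j ∧
      v j ≤ (Fintype.card M : ℝ)⁻¹ *
        ∑ i, ((gap k (t i) (j i) : ℝ) / R.dmax k (A ⟨M, h⟩) i) ^ ((k : ℝ) - 1 / 2) := by
    intro j hj
    have hj' := mem_diffIdx.mp (Finset.mem_sdiff.mp hj).1
    obtain ⟨t, ht, hm⟩ := hS.cover j hj'
    refine ⟨t, ht, hm, ?_⟩
    have hk' := norm_sq_sub_activeSpace_le hk hn (p := ⟨M, h⟩) ht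
      (mem_diffIdx.mp (hS.toIsTessellation.mem_diffIdx ht)) hj'
    have h1 := Real.le_sqrt_of_sq_le hk'
    rw [Real.sqrt_mul hNpos.le] at h1
    have h2 := noise_weight_le hk (fun i => hS.dmax_pos hk ⟨t, ht⟩ i) hc hell hlam
      fun i => gap k (t i) (j i)
    rw [hv, div_le_iff₀ (mul_pos hNpos hlam0)]
    refine (hnoise j).trans ((mul_le_mul_of_nonneg_left h1 (by positivity)).trans ?_)
    have h3 := mul_le_mul_of_nonneg_left h2 hNpos.le
    have h4 := Real.mul_self_sqrt hNpos.le
    calc _ = (√(size n : ℝ) * √(size n : ℝ)) * (ell * √(∑ i : M,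
          ((gap k (t i) (j i) : ℝ) / sides n M i) ^ (2 * k - 1))) := by ring
      _ ≤ _ := by
        rw [h4]
        refine h3.trans (le_of_eq ?_)
        ring
  have hresid : (inner ℝ (e - P e) (lift k M h Δ) : ℝ) ≤
      size n * lam * ∑ j ∈ diffIdx k (sides n M) \ A ⟨M, h⟩, v j * |diffOp k Δ j| := by
    have hexp : lift k M h Δ = ∑ j ∈ diffIdx k (sides n M), diffOp k Δ j • b j := by
      conv_lhs => rw [expansion_of_mem_coreSpace hk hΔcore]
      rw [show lift k M h = ⇑(liftLin (n := n) M h) from rfl, map_sum]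
      exact Finset.sum_congr rfl fun j _ => map_smul _ _ _
    rw [hexp, inner_sum, ← Finset.sum_sdiff (s₁ := A ⟨M, h⟩)
      fun t ht => hS.toIsTessellation.mem_diffIdx ht]
    have hterm : ∀ j, (inner ℝ (e - P e) (diffOp k Δ j • b j) : ℝ) ≤
        size n * lam * (v j * |diffOp k Δ j|) := fun j => by
      rw [inner_smul_right, real_inner_comm, ← inner_sub_starProjection]
      refine (le_abs_self _).trans (le_of_eq ?_)
      rw [abs_mul, hv]
      field_simp
      rfl
    rw [Finset.mul_sum]
    refine (add_le_add (Finset.sum_le_sum fun j _ => hterm j)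
      (Finset.sum_nonpos fun j hj => ?_)).trans (add_zero _).le
    refine (hterm j).trans (le_of_eq ?_)
    rw [hvS j hj, zero_mul, mul_zero]
  -- effective sparsity
  have hsp0 : 0 ≤ C * sparsityBound k (A ⟨M, h⟩) R :=
    (mul_nonneg hN'pos.le (sq_nonneg _)).trans (hC 0 fun j => by simp)
  set B := √(C * sparsityBound k (A ⟨M, h⟩) R / N') with hBdef
  have hB2 : B ^ 2 = C * sparsityBound k (A ⟨M, h⟩) R / N' := Real.sq_sqrt (by positivity)
  have heff := effective_sparsity_le hS.toIsTessellation hk (B := B)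
    (fun s hs => Real.le_sqrt_of_sq_le (by
      rw [le_div_iff₀ hN'pos, mul_comm]
      exact hC s hs)) hvoff Δ
  have htv := vitaliTV_sub_le (k := k) (S := A ⟨M, h⟩)
    (fun t ht => hS.toIsTessellation.mem_diffIdx ht) F g'
  rw [← hΔ] at htv
  have hsplit : ∑ j ∈ diffIdx k (sides n M) \ A ⟨M, h⟩, (1 - v j) * |diffOp k Δ j| =
      ∑ j ∈ diffIdx k (sides n M) \ A ⟨M, h⟩, |diffOp k Δ j| -
      ∑ j ∈ diffIdx k (sides n M) \ A ⟨M, h⟩, v j * |diffOp k Δ j| := by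
    rw [← Finset.sum_sub_distrib]
    exact Finset.sum_congr rfl fun j _ => by ring
  rw [hsplit] at heff
  have hnl : 0 ≤ 2 * (size n * lam) := by positivity
  -- The term with `v` in the bound on the residual noise cancels the part of the penalty that
  -- effective sparsity leaves over.
  have hcomb : 2 * (inner ℝ (e - P e) (lift k M h Δ) : ℝ) +
      2 * (size n * lam) * (vitaliTV k g' - vitaliTV k F) ≤
      2 * (size n * lam) * (2 * vitaliTVOff k (A ⟨M, h⟩) g' + B * ‖Δ‖) := by
    have h1 := mul_le_mul_of_nonneg_left (add_le_add htv heff) hnl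
    nlinarith
  -- Only a quarter of `‖Δ‖ ^ 2` is spent here; three quarters are reserved for the noise in the
  -- active space, which is treated for all margins at once.
  have hyoung : 2 * (size n * lam) * (B * ‖Δ‖) ≤ 1 / 4 * (o * ‖Δ‖ ^ 2) +
      size n * (4 * C * (lam ^ 2 * sparsityBound k (A ⟨M, h⟩) R)) := by
    have h1 : size n * (4 * C * (lam ^ 2 * sparsityBound k (A ⟨M, h⟩) R)) =
        4 * o * (N' * lam * B) ^ 2 := by
      rw [mul_pow, hB2, ← hoN]
      field_simp
    rw [h1, ← hoN]
    have h2 := mul_nonneg hopos.le (sq_nonneg (1 / 2 * ‖Δ‖ - 2 * (N' * lam * B)))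
    linarith
  have hinner : o * (inner ℝ e' Δ : ℝ) = inner ℝ (P e) (lift k M h Δ) +
      inner ℝ (e - P e) (lift k M h Δ) := by
    rw [inner_bar hn hΔcore, ← inner_add_left, add_sub_cancel]
  have hscaled := mul_le_mul_of_nonneg_left hbasic2 hopos.le
  have h5 : o * (2 * lam * N' * (vitaliTV k g' - vitaliTV k F)) =
      2 * (size n * lam) * (vitaliTV k g' - vitaliTV k F) := by
    rw [← hoN]
    ring
  linarith

end MarginOracle

/-! ### The oracle inequality -/

section Oracle

variable {d k : ℕ} {n : Fin d → ℕ}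

theorem sum_nonempty_margin (φ : (M : Finset (Fin d)) → Label k M → ℝ) :
    ∑ M with M.Nonempty, ∑ h, φ M h =
      ∑ p : Margin d k, if p.1.Nonempty then φ p.1 p.2 else 0 := by
  rw [Fintype.sum_sigma, Finset.sum_filter]
  refine Finset.sum_congr rfl fun M _ => ?_
  split_ifs <;> simp

/-- The active sets, completed by the single index of the margins with `M = ∅`. -/
def fullActive (S : (M : Finset (Fin d)) → Label k M → Finset (Idx (sides n M)))
    (p : Margin d k) : Finset (Idx (sides n p.1)) :=
  open Classical in if p.1.Nonempty then S p.1 p.2 else Finset.univ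

theorem fullActive_of_nonempty (S : (M : Finset (Fin d)) → Label k M → Finset (Idx (sides n M)))
    {p : Margin d k} (hp : p.1.Nonempty) : fullActive S p = S p.1 p.2 := if_pos hp

theorem fullActive_of_empty (S : (M : Finset (Fin d)) → Label k M → Finset (Idx (sides n M)))
    {p : Margin d k} (hp : ¬ p.1.Nonempty) : fullActive S p = Finset.univ := if_neg hp

theorem finrank_activeSpace_fullActive_le (hk : 1 ≤ k)
    (S : (M : Finset (Fin d)) → Label k M → Finset (Idx (sides n M))) :
    (Module.finrank ℝ (activeSpace k n (fullActive S)) : ℝ) ≤ Fintype.card (Margin d k) +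
      (k : ℝ) ^ d * ∑ M with M.Nonempty, ∑ h, ((S M h).card : ℝ) := by
  have h1 : (Module.finrank ℝ (activeSpace k n (fullActive S)) : ℝ) ≤
      ∑ p : Margin d k, ((fullActive S p).card : ℝ) * (k : ℝ) ^ p.1.card := by
    exact_mod_cast finrank_activeSpace_le (fullActive S)
  refine h1.trans ?_
  rw [sum_nonempty_margin, Finset.mul_sum, Fintype.card_eq_sum_ones, Nat.cast_sum,
    ← Finset.sum_add_distrib]
  refine Finset.sum_le_sum fun p _ => ?_
  by_cases hp : p.1.Nonempty
  · rw [fullActive_of_nonempty S hp, if_pos hp, Nat.cast_one]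
    have h2 : (k : ℝ) ^ p.1.card ≤ (k : ℝ) ^ d :=
      pow_le_pow_right₀ (by exact_mod_cast hk) (by simpa using Finset.card_le_univ p.1)
    have := mul_le_mul_of_nonneg_left h2 (Nat.cast_nonneg (α := ℝ) (S p.1 p.2).card)
    linarith
  · have hp' := Finset.not_nonempty_iff_eq_empty.mp hp
    rw [fullActive_of_empty S hp, if_neg hp]
    have h3 : IsEmpty p.1 := by rw [hp']; infer_instance
    simp [hp']

theorem lift_mem_activeSpace_of_empty {S : (M : Finset (Fin d)) → Label k M →
    Finset (Idx (sides n M))} {p : Margin d k} (hp : ¬ p.1.Nonempty) (hk : 1 ≤ k)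
    {F : Tensor (sides n p.1)} (hF : F ∈ coreSpace k (sides n p.1)) :
    lift k p.1 p.2 F ∈ activeSpace k n (fullActive S) := by
  rw [expansion_of_mem_coreSpace hk hF, show lift k p.1 p.2 = ⇑(liftLin (n := n) p.1 p.2) from rfl,
    map_sum]
  refine Submodule.sum_mem _ fun j _ => ?_
  rw [map_smul]
  refine Submodule.smul_mem _ _ (tensorAtom_mem_activeSpace hk ?_)
  rw [fullActive_of_empty S hp]
  exact Finset.mem_univ j

/-- Since `d ≥ 1` there is at least one nonempty margin, so one summand is available. -/
theorem le_sum_nonempty_margin (hk : 1 ≤ k) {φ : (M : Finset (Fin d)) → Label k M → ℝ}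
    (hφ : ∀ M, M.Nonempty → ∀ h, 0 ≤ φ M h) (hd : 1 ≤ d) {c : ℝ}
    (hc : ∀ M, M.Nonempty → ∀ h, c ≤ φ M h) : c ≤ ∑ M with M.Nonempty, ∑ h, φ M h := by
  have hne : (Finset.univ : Finset (Fin d)).Nonempty := ⟨⟨0, hd⟩, Finset.mem_univ _⟩
  rw [sum_nonempty_margin]
  refine le_trans ?_ (Finset.single_le_sum (f := fun p : Margin d k =>
    if p.1.Nonempty then φ p.1 p.2 else 0) (fun p _ => ?_)
    (Finset.mem_univ (⟨Finset.univ, fun _ => ⟨0, hk⟩⟩ : Margin d k)))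
  · simp only [if_pos hne]
    exact hc _ hne _
  · split_ifs with hp
    · exact hφ _ hp _
    · exact le_rfl

/-- The oracle inequality on the event on which the noise is under control. -/
theorem oracle_of_noise (hk : 1 ≤ k) (hd : 1 ≤ d) (hn : ∀ i, k + 1 ≤ n i)
    {S : (M : Finset (Fin d)) → Label k M → Finset (Idx (sides n M))}
    {R : (M : Finset (Fin d)) → Label k M → Rects (sides n M)}
    (hS : ∀ M, M.Nonempty → ∀ h, IsSuitable k (S M h) (R M h)) {C : ℝ} (hC : 1 ≤ C)
    (hinterp : ∀ M, M.Nonempty → ∀ h, ∀ s : Idx (sides n M) → ℝ, (∀ j, |s j| ≤ 1) →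
      (size (sides n M) : ℝ) * ‖∑ j ∈ diffIdx k (sides n M), signedWeight k (S M h) (R M h) s j •
        (rankOne fun i => diffVec (sides n M i) k (j i) : Tensor (sides n M))‖ ^ 2 ≤
          C ^ Fintype.card M * sparsityBound k (S M h) (R M h))
    {c : Finset (Fin d) → ℝ} (hc : ∀ M, M.Nonempty → 1 ≤ c M) {ell σ x : ℝ}
    (hx : 0 ≤ x) (hell0 : 0 < ell) (hell : σ ^ 2 ≤ size n * ell ^ 2)
    {lam : (M : Finset (Fin d)) → Label k M → ℝ}
    (hlam : ∀ M, M.Nonempty → ∀ h, c M * scaling k (S M h) (R M h) * ell ≤ lam M h)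
    {f0 g e fhat : Tensor n} (hf : IsEstimator k lam (f0 + e) fhat)
    (hproj : ‖(activeSpace k n (fullActive S)).starProjection e‖ ^ 2 ≤
      σ ^ 2 * (3 * x + 2 * (Module.finrank ℝ (activeSpace k n (fullActive S)) : ℝ)))
    (hnoise : ∀ j : Idx n, |(inner ℝ ((tensorAtom k n fun i => j i) -
      (activeSpace k n (fullActive S)).starProjection (tensorAtom k n fun i => j i)) e : ℝ)| ≤
      √(size n : ℝ) * ell * ‖(tensorAtom k n fun i => j i) -
        (activeSpace k n (fullActive S)).starProjection (tensorAtom k n fun i => j i)‖) :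
    OracleInequality k (4 * C ^ d + 8 / 3 * (Fintype.card (Margin d k) + (k : ℝ) ^ d))
      σ x S R lam f0 g fhat := by
  obtain ⟨F, hF0, hFmin, rfl⟩ := hf
  have hN : 0 < size n := Finset.prod_pos fun i _ => (Nat.succ_pos k).trans_le (hn i)
  have hNpos : (0 : ℝ) < size n := by exact_mod_cast hN
  set P := (activeSpace k n (fullActive S)).starProjection with hP
  have hSne : ∀ M, M.Nonempty → ∀ h, (S M h).Nonempty := fun M hM h =>
    (hS M hM h).nonempty fun i => hn i
  have hlampos : ∀ M, M.Nonempty → ∀ h, 0 < lam M h := by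
    intro M hM h
    have := hM.to_subtype
    refine lt_of_lt_of_le ?_ (hlam M hM h)
    have hcard : (0 : ℝ) < Fintype.card M := by exact_mod_cast Fintype.card_pos
    have hsc : 0 < scaling k (S M h) (R M h) := by
      refine mul_pos hcard (Real.sqrt_pos.mpr (Finset.sum_pos (fun i _ => ?_)
        Finset.univ_nonempty))
      have h1 := (hS M hM h).dmax_pos hk (hSne M hM h) i
      have h2 : 0 < sides n M i := (Nat.succ_pos k).trans_le (hn i)
      positivity
    have := zero_lt_one.trans_le (hc M hM)
    positivity
  have hsp : ∀ M, M.Nonempty → ∀ h, ell ^ 2 * (S M h).card ≤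
      lam M h ^ 2 * sparsityBound k (S M h) (R M h) := by
    intro M hM h
    have := hM.to_subtype
    exact card_le_sq_mul_sparsityBound hk (hS M hM h) (hSne M hM h) (hc M hM) hell0.le
      (hlam M hM h)
  have hFcore : ∀ p : Margin d k, F p.1 p.2 ∈ coreSpace k (sides n p.1) := by
    rintro ⟨M, h⟩
    rcases M.eq_empty_or_nonempty with rfl | hM
    · dsimp only
      rw [hF0 h]
      exact bar_mem hn _ _ _
    · exact minimizer_mem_coreSpace (n := sides n M) hk
        (Finset.prod_pos fun i _ => (Nat.succ_pos k).trans_le (hn i))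
        (bar_mem hn M h _) (hFmin M hM h)
  have hsub : ∀ f : Tensor n, (∑ M, ∑ h, lift k M h (F M h)) - f =
      ∑ p : Margin d k, lift k p.1 p.2 (F p.1 p.2 - bar k p.1 p.2 f) := fun f => by
    conv_lhs => rw [← sum_lift_bar hk hn f]
    rw [← Fintype.sum_sigma (f := fun p : Margin d k => lift k p.1 p.2 (F p.1 p.2)),
      ← Finset.sum_sub_distrib]
    exact Finset.sum_congr rfl fun p _ => (lift_sub _ _ _ _).symm
  have hsubg : g - f0 =
      ∑ p : Margin d k, lift k p.1 p.2 (bar k p.1 p.2 g - bar k p.1 p.2 f0) := by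
    conv_lhs => rw [← sum_lift_bar hk hn f0, ← sum_lift_bar hk hn g]
    rw [← Finset.sum_sub_distrib]
    exact Finset.sum_congr rfl fun p _ => (lift_sub _ _ _ _).symm
  set fhat := ∑ M, ∑ h, lift k M h (F M h) with hfhat
  have hmargin : ∀ p : Margin d k, outSize n p.1 * ‖F p.1 p.2 - bar k p.1 p.2 f0‖ ^ 2 +
        3 / 4 * (outSize n p.1 * ‖F p.1 p.2 - bar k p.1 p.2 g‖ ^ 2) ≤
      outSize n p.1 * ‖bar k p.1 p.2 g - bar k p.1 p.2 f0‖ ^ 2 +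
      2 * (inner ℝ (P e) (lift k p.1 p.2 (F p.1 p.2 - bar k p.1 p.2 g)) : ℝ) +
      size n * (4 * (if p.1.Nonempty then
          lam p.1 p.2 * vitaliTVOff k (S p.1 p.2) (bar k p.1 p.2 g) else 0) +
        4 * C ^ d * (if p.1.Nonempty then
          lam p.1 p.2 ^ 2 * sparsityBound k (S p.1 p.2) (R p.1 p.2) else 0)) := by
    intro p
    by_cases hp : p.1.Nonempty
    · have := hp.to_subtype
      have hA := fullActive_of_nonempty S hp
      rw [if_pos hp, if_pos hp, ← hA]
      refine margin_oracle hk hn hp (by rw [hA]; exact hS p.1 hp p.2) (fun s hs => ?_)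
        (hc p.1 hp) hell0.le (hlampos p.1 hp p.2) (by rw [hA]; exact hlam p.1 hp p.2)
        (hFmin p.1 hp p.2) fun j => ?_
      · rw [hA]
        refine (hinterp p.1 hp p.2 s hs).trans ?_
        have h0 : 0 ≤ sparsityBound k (S p.1 p.2) (R p.1 p.2) := by
          have h1 := hsp p.1 hp p.2
          have h2 := hlampos p.1 hp p.2
          exact nonneg_of_mul_nonneg_right ((by positivity : (0 : ℝ) ≤ _).trans h1) (by positivity)
        refine mul_le_mul_of_nonneg_right ?_ h0
        exact pow_le_pow_right₀ hC (by simpa using Finset.card_le_univ p.1)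
      -- A lifted atom is an atom of the full tensor. Hence the control of the `size n` full atoms
      -- covers all margins.
      · rw [lift_tensorAtom]
        have hlt : ∀ i, extendIdx p.1 p.2 (fun i => j i) i < n i := fun i => by
          unfold extendIdx
          split_ifs with hi
          · exact (j ⟨i, hi⟩).isLt
          · have := (p.2 ⟨i, hi⟩).isLt
            have := hn i
            omega
        exact hnoise fun i => ⟨_, hlt i⟩
    -- For `M = ∅` the estimator is exactly signal plus noise, and the whole margin lies in the
    -- active space; the inequality comes from expanding the square.
    · rw [if_neg hp, if_neg hp]
      have hFp : F p.1 p.2 = bar k p.1 p.2 f0 + bar k p.1 p.2 e := by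
        rw [← bar_add hn]
        obtain ⟨M, h⟩ := p
        obtain rfl := Finset.not_nonempty_iff_eq_empty.mp hp
        exact hF0 h
      have hcore : F p.1 p.2 - bar k p.1 p.2 g ∈ coreSpace k (sides n p.1) :=
        Submodule.sub_mem _ (hFcore p) (bar_mem hn _ _ _)
      have hin : (inner ℝ (P e) (lift k p.1 p.2 (F p.1 p.2 - bar k p.1 p.2 g)) : ℝ) =
          outSize n p.1 * inner ℝ (bar k p.1 p.2 e) (F p.1 p.2 - bar k p.1 p.2 g) := by
        rw [hP, Submodule.inner_starProjection_left_eq_right, Submodule.starProjection_eq_self_iff.mpr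
          (lift_mem_activeSpace_of_empty hp hk hcore), inner_bar hn hcore]
      rw [hin]
      have e1 : bar k p.1 p.2 e = F p.1 p.2 - bar k p.1 p.2 f0 := by rw [hFp]; abel
      have e2 : bar k p.1 p.2 g - bar k p.1 p.2 f0 =
          (F p.1 p.2 - bar k p.1 p.2 f0) - (F p.1 p.2 - bar k p.1 p.2 g) := by abel
      rw [e1, e2, norm_sub_sq_real (F p.1 p.2 - bar k p.1 p.2 f0) (F p.1 p.2 - bar k p.1 p.2 g)]
      have ho := (outSize_pos hn p.1).le
      nlinarith [mul_nonneg ho (sq_nonneg ‖F p.1 p.2 - bar k p.1 p.2 g‖)]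
  have hsum := Finset.sum_le_sum fun p (_ : p ∈ (Finset.univ : Finset (Margin d k))) => hmargin p
  simp only [Finset.sum_add_distrib, ← Finset.mul_sum] at hsum
  rw [← inner_sum, ← hsub g,
    ← norm_sq_sum_lift hn (fun p => F p.1 p.2 - bar k p.1 p.2 f0)
      fun p => Submodule.sub_mem _ (hFcore p) (bar_mem hn _ _ _),
    ← norm_sq_sum_lift hn (fun p => F p.1 p.2 - bar k p.1 p.2 g)
      fun p => Submodule.sub_mem _ (hFcore p) (bar_mem hn _ _ _),
    ← norm_sq_sum_lift hn (fun p => bar k p.1 p.2 g - bar k p.1 p.2 f0)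
      fun p => Submodule.sub_mem _ (bar_mem hn _ _ _) (bar_mem hn _ _ _),
    ← hsub f0, ← hsub g, ← hsubg,
    ← sum_nonempty_margin fun M h => lam M h * vitaliTVOff k (S M h) (bar k M h g),
    ← sum_nonempty_margin fun M h => lam M h ^ 2 * sparsityBound k (S M h) (R M h)] at hsum
  -- The reserved three quarters are used up. The factor `4/3` turns the noise bound `3 * x + 2 *
  -- rank` into `4 * x + 8/3 * rank`.
  have hin : 2 * (inner ℝ (P e) (fhat - g) : ℝ) ≤
      3 / 4 * ‖fhat - g‖ ^ 2 + 4 / 3 * ‖P e‖ ^ 2 := by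
    have h1 := real_inner_le_norm (P e) (fhat - g)
    nlinarith [sq_nonneg (‖fhat - g‖ - 4 / 3 * ‖P e‖)]
  have hrank := finrank_activeSpace_fullActive_le (n := n) hk S
  set Q : ℝ := (Fintype.card (Margin d k) : ℝ) with hQ
  set s : ℝ := ∑ M with M.Nonempty, ∑ h, ((S M h).card : ℝ) with hs
  set V : ℝ := ∑ M with M.Nonempty, ∑ h, lam M h ^ 2 * sparsityBound k (S M h) (R M h) with hV
  set r : ℝ := (Module.finrank ℝ (activeSpace k n (fullActive S)) : ℝ)
  have hs1 : 1 ≤ s := le_sum_nonempty_margin hk (fun M _ h => Nat.cast_nonneg _) hd fun M hM h => by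
    exact_mod_cast (hSne M hM h).card_pos
  have hsV : σ ^ 2 * s ≤ size n * V := by
    have h1 : ell ^ 2 * s ≤ V := by
      rw [hs, hV, Finset.mul_sum]
      refine Finset.sum_le_sum fun M hM => ?_
      rw [Finset.mul_sum]
      exact Finset.sum_le_sum fun h _ => hsp M (Finset.mem_filter.mp hM).2 h
    have h2 := mul_le_mul_of_nonneg_right hell (zero_le_one.trans hs1)
    have h3 := mul_le_mul_of_nonneg_left h1 hNpos.le
    linarith
  have hQ0 : 0 ≤ Q := Nat.cast_nonneg _
  -- Since `s ≥ 1`, the rank is at most `(Q + k ^ d) * s`; the variance of the estimated jumps thus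
  -- becomes part of the constant in front of the remainder.
  have hrs : σ ^ 2 * r ≤ (Q + (k : ℝ) ^ d) * (size n * V) := by
    have h1 : r ≤ (Q + (k : ℝ) ^ d) * s := by nlinarith
    have h2 := mul_le_mul_of_nonneg_left h1 (sq_nonneg σ)
    have h3 := mul_le_mul_of_nonneg_left hsV (by positivity : 0 ≤ Q + (k : ℝ) ^ d)
    linarith
  set a : ℝ := x + d * Real.log (k + 1) with ha
  have hxa : x ≤ a := by
    have : 0 ≤ Real.log ((k : ℝ) + 1) := Real.log_nonneg (by linarith [Nat.cast_nonneg (α := ℝ) k])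
    have := mul_nonneg (Nat.cast_nonneg (α := ℝ) d) this
    linarith
  -- The deviation `4 * σ ^ 2 * x` is shared: one half goes to the variance term of `M = ∅`, the
  -- other to that of a single nonempty margin.
  have hfull : ∀ b : ℝ, 2 * σ ^ 2 * x ≤ 2 * σ ^ 2 * (√a + √b) ^ 2 := fun b => by
    refine mul_le_mul_of_nonneg_left (hxa.trans ?_) (by positivity)
    nlinarith [Real.sq_sqrt (hx.trans hxa), Real.sqrt_nonneg a, Real.sqrt_nonneg b,
      mul_nonneg (Real.sqrt_nonneg a) (Real.sqrt_nonneg b)]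
  have hT1 := hfull ((k : ℝ) ^ d)
  have hT2 : 2 * σ ^ 2 * x / size n ≤ ∑ M with M.Nonempty, ∑ h : Label k M,
        2 * σ ^ 2 / (size n : ℝ) * (√a + √((k : ℝ) * ((S M h).card : ℝ))) ^ 2 :=
    le_sum_nonempty_margin hk (fun M _ h => by positivity) hd fun M hM h => by
      rw [div_mul_eq_mul_div]
      exact div_le_div_of_nonneg_right (hfull _) hNpos.le
  unfold OracleInequality
  rw [← ha, ← hV]
  refine le_trans ?_ (add_le_add_left (add_le_add_right hT2 _) _)
  rw [← mul_le_mul_iff_of_pos_right hNpos]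
  have hfin : ‖fhat - f0‖ ^ 2 ≤ ‖g - f0‖ ^ 2 + size n * (4 * ∑ M with M.Nonempty, ∑ h, lam M h *
      vitaliTVOff k (S M h) (bar k M h g)) + 2 * σ ^ 2 * (√a + √((k : ℝ) ^ d)) ^ 2 +
      2 * σ ^ 2 * x + size n * ((4 * C ^ d + 8 / 3 * (Q + (k : ℝ) ^ d)) * V) := by
    linarith
  refine le_of_eq_of_le (div_mul_cancel₀ _ hNpos.ne') (hfin.trans (le_of_eq ?_))
  field_simp

end Oracle

/-- Already `k ^ (k - 1)`, that is `1, 2, 9, 64`, is at least `a₀`. -/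
theorem one_le_limitConst {k : ℕ} (hk : k = 1 ∨ k = 2 ∨ k = 3 ∨ k = 4) : 1 ≤ limitConst k := by
  have h : ∀ m : ℕ, 1 ≤ m → ((m : ℝ) ^ (m - 1)) ≤ (m : ℝ) ^ ((2 * (m : ℝ) - 1) / 2) := by
    intro m hm
    rw [← Real.rpow_natCast]
    refine Real.rpow_le_rpow_of_exponent_le (by exact_mod_cast hm) ?_
    rw [Nat.cast_sub hm]
    push_cast
    linarith
  have h2 : √2 ≤ 3 / 2 := by rw [Real.sqrt_le_left (by norm_num)]; norm_num
  have h3 : √3 ≤ 2 := by rw [Real.sqrt_le_left (by norm_num)]; norm_num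
  rcases hk with rfl | rfl | rfl | rfl
  · simp [limitConst, aZero]
  · have := h 2 (by norm_num)
    rw [limitConst, aZero, one_le_div (by positivity)]
    norm_num at this ⊢
    linarith
  · have := h 3 (by norm_num)
    rw [limitConst, aZero, one_le_div (by positivity)]
    norm_num at this ⊢
    linarith
  · have := h 4 (by norm_num)
    rw [limitConst, aZero, one_le_div (by norm_num)]
    norm_num at this ⊢

end TensorTF

end

/-! ### Choice of the constants and probability of the event. -/

open TensorTF MeasureTheory in
theorem theorem6p1 (k : ℕ) (hk : k = 1 ∨ k = 2 ∨ k = 3 ∨ k = 4) :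
    -- `C₀` and `r₀` depend on `k` only, `K` on `k` and `d` only
    ∃ C₀ : ℝ, 0 < C₀ ∧ ∃ r₀ : ℕ, ∀ d : ℕ, 1 ≤ d → ∃ K : ℝ,
      ∀ (n : Fin d → ℕ), (∀ i, k + 1 ≤ n i) →
      ∀ (σ : ℝ), 0 < σ →
      ∀ (Ω : Type*) [MeasurableSpace Ω] (μ : Measure Ω) [IsProbabilityMeasure μ]
        (ε : Ω → Tensor n), IsGaussianNoise μ σ ε →
      ∀ (f0 g : Tensor n) (x t : ℝ), 0 < x → 0 < t →
      ∀ (S : (M : Finset (Fin d)) → Label k M → Finset (Idx (sides n M)))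
        (R : (M : Finset (Fin d)) → Label k M → Rects (sides n M)),
        (∀ M, M.Nonempty → ∀ h, IsSuitable k (S M h) (R M h)) →
      ∀ C : Finset (Fin d) → ℝ,
        -- each `C M` is large enough; `limitConst k` suffices once all distances are large
        (∀ M, M.Nonempty → C₀ ≤ C M ∨ (limitConst k ≤ C M ∧
          ∀ h, ∀ s ∈ S M h, ∀ i z, r₀ ≤ (R M h).dist k s i z)) →
      ∀ lam : (M : Finset (Fin d)) → Label k M → ℝ,
        (∀ M, M.Nonempty → ∀ h, C M * scaling k (S M h) (R M h) *
          lambdaZero σ (size n) (t + d * Real.log (k + 1)) ≤ lam M h) →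
      ∀ fhat : Ω → Tensor n, (∀ ω, IsEstimator k lam (f0 + ε ω) (fhat ω)) →
        1 - Real.exp (-x) - Real.exp (-t) ≤
          μ.real {ω | OracleInequality k K σ x S R lam f0 g (fhat ω)} := by
  have hk1 : 1 ≤ k := by omega
  -- The argument only needs `1 ≤ C M`. As `limitConst k` is at least `1`, no lower bound `r₀` on
  -- the distances is required.
  refine ⟨1, one_pos, 0, fun d hd => ?_⟩
  obtain ⟨C₁, hC₁, hinterp⟩ := exists_interpolation_bound k hk1
  refine ⟨4 * C₁ ^ d + 8 / 3 * (Fintype.card (Margin d k) + (k : ℝ) ^ d), ?_⟩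
  intro n hn σ hσ Ω _ μ _ ε hε f0 g x t hx ht S R hS C hC lam hlam fhat hf
  have hN : 0 < size n := Finset.prod_pos fun i _ => (Nat.succ_pos k).trans_le (hn i)
  have hN1 : (1 : ℝ) ≤ size n := by exact_mod_cast hN
  have hNpos : (0 : ℝ) < size n := by linarith
  set t' : ℝ := t + d * Real.log (k + 1) with ht'
  have htt' : t ≤ t' := by
    have : 0 ≤ Real.log ((k : ℝ) + 1) := Real.log_nonneg (by linarith [Nat.cast_nonneg (α := ℝ) k])
    have := mul_nonneg (Nat.cast_nonneg (α := ℝ) d) this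
    linarith
  -- This makes `q ≥ 1`, so `σ ^ 2 ≤ n * λ₀ ^ 2`: the tuning parameter dominates the variance.
  have hlog : 1 / 2 ≤ Real.log (2 * size n) := by
    have h1 : Real.log 2 ≤ Real.log (2 * size n) := Real.log_le_log (by norm_num) (by linarith)
    linarith [Real.log_two_gt_d9]
  set q : ℝ := 2 * Real.log (2 * size n) + 2 * t' with hq
  have hq1 : 1 ≤ q := by linarith
  have hell0 : 0 < lambdaZero σ (size n) t' :=
    mul_pos hσ (Real.sqrt_pos.mpr (div_pos (by linarith) hNpos))
  have hell : √(size n : ℝ) * lambdaZero σ (size n) t' = σ * √q := by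
    rw [lambdaZero, ← hq, Real.sqrt_div (by linarith)]
    have := (Real.sqrt_pos.mpr hNpos).ne'
    field_simp
  have hell2 : σ ^ 2 ≤ size n * lambdaZero σ (size n) t' ^ 2 := by
    have h1 := congrArg (· ^ 2) hell
    simp only [mul_pow, Real.sq_sqrt hNpos.le, Real.sq_sqrt (zero_le_one.trans hq1)] at h1
    rw [h1]
    exact le_mul_of_one_le_right (sq_nonneg σ) hq1
  have hc : ∀ M : Finset (Fin d), M.Nonempty → 1 ≤ C M := fun M hM =>
    (hC M hM).elim id fun h => (one_le_limitConst hk).trans h.1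
  have hevent := hε.event hσ (activeSpace k n (fullActive S))
    (fun j : Idx n => (tensorAtom k n fun i => j i) -
      (activeSpace k n (fullActive S)).starProjection (tensorAtom k n fun i => j i))
    (Real.sqrt_nonneg q) x
  -- Union bound over the `n` atoms with two-sided tails: `2 n * exp (-q / 2) = exp (-t')`.
  have htail : (Fintype.card (Idx n) : ℝ) * (2 * Real.exp (-√q ^ 2 / 2)) ≤ Real.exp (-t) := by
    have h1 : (Fintype.card (Idx n) : ℝ) = size n := by simp [size]
    have h2 : -√q ^ 2 / 2 = -Real.log (2 * size n) + -t' := by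
      rw [Real.sq_sqrt (zero_le_one.trans hq1), hq]
      ring
    rw [h1, h2, Real.exp_add, Real.exp_neg, Real.exp_log (by positivity)]
    refine le_of_eq_of_le ?_ (Real.exp_le_exp.mpr (neg_le_neg htt'))
    field_simp
  refine (by linarith : 1 - Real.exp (-x) - Real.exp (-t) ≤ _).trans
    (hevent.trans (measureReal_mono fun ω hω => ?_))
  refine oracle_of_noise hk1 hd hn hS hC₁ (fun M hM h s hs => ?_) hc hx.le hell0 hell2 hlam
    (hf ω) hω.1 fun j => ?_
  · have := hM.to_subtype
    exact hinterp (hS M hM h).toIsTessellation s hs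
  · rw [hell]
    refine (hω.2 j).trans (le_of_eq ?_)
    ring
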